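/- **Hypergraph Painting.** An instance consists of positive integers $k,b,d,q$, a finite multihypergraph $H$ with hyperedges of size at most $d$, a partial colouring $\mathrm{col}_0 : V(H)\rightharpoonup\{\mathbf B,\mathbf W\}$, and for each hyperedge $F\in E(H)$ a function $f_F:\{\mathbf B,\mathbf W\}^F\times\{0,\dots,b\}\to\{0,1,\dots,k,\infty\}$. The solution consists of the values, for $0\le\mu\le b$, $$w_\mu=\min_{\mathrm{col}\supseteq \mathrm{col}_0,\ (a_F)_{F\in E(H)}}\ \sum_{F\in E(H)} f_F(\mathrm{col}|_F,a_F),$$ where the minimum is over colourings $\mathrm{col}:V(H)\to\{\mathbf B,\mathbf W\}$ extending $\mathrm{col}_0$ and families of non-negative integers with $\sum_{F}a_F=\mu$; the sum counts as $\infty$ if it exceeds $k$, and the minimum over no choices is $\infty$. Let $n=|V(H)|$ and $m=|E(H)|$. The instance is *proper* if - (local unbreakability) $f_F(c,\mu)=\infty$ for all $F\in E(H)$, all $0\le\mu\le b$, and all $c:F\to\{\mathbf B,\mathbf W\}$ with $|c^{-1}(\mathbf B)|>3k$ and $|c^{-1}(\mathbf W)|>3k$; - (connectivity) $f_F(c,\mu)\neq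 0$ for all $F\in E(H)$, all $0\le\mu\le b$, and all $c:F\to\{\mathbf B,\mathbf W\}$ using both colours; - (global unbreakability) for each $0\le\mu\le b$ with $w_\mu<\infty$, there is a colouring $\mathrm{col}\supseteq\mathrm{col}_0$ which, together with some $(a_F)_F$ with $\sum_F a_F=\mu$, attains $w_\mu$, and which satisfies $\min(|\mathrm{col}^{-1}(\mathbf B)|,|\mathrm{col}^{-1}(\mathbf W)|)\le q$. **Lemma.** There is an $O^*\big(q^{O(k)}\cdot d^{O(k^2)}\big)$ time algorithm solving Hypergraph Painting for proper instances. That is, there are a single deterministic algorithm and a constant $C$ such that on every proper instance the algorithm outputs all the values $w_0,\dots,w_b$ after at most $$C\cdot q^{Ck}\cdot d^{Ck^2}\cdot (n+m+b)^{C}$$ steps. Here each $f_F$ is given as a list, in any order, of its finite values together with their arguments. Time is counted on a machine with memory cells (pairs of pointers) and natural numbers, on which building or reading a cell, adding or (truncated) subtracting two numbers, and testing for zero take one step each; there is no unit-cost multiplication. -/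

import Mathlib

/-! ## Machine model

Programs work on binary trees of cells whose leaves hold natural numbers, like a pure LISP machine.
Every primitive operation (copying a pointer, building or reading one cell, adding or subtracting
two numbers, testing against zero) costs one time unit, and there is no unit-cost
multiplication. As for the unit-cost RAM with addition and subtraction, the running times are
polynomially related to those of Turing machines: a step allocates at most one cell (subtrees are
shared, never copied), and a number grows by at most one bit per addition. -/

/-- Memory contents: a number, or a cell with two pointers. -/
inductive Data : Type
  | num (a : ℕ) : Data
  | pair (x y : Data) : Data

namespace Data

/-- First component of a cell (`num 0` on a number). -/
def fst : Data → Data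
  | pair x _ => x
  | num _ => num 0

/-- Second component of a cell (`num 0` on a number). -/
def snd : Data → Data
  | pair _ y => y
  | num _ => num 0

/-- Sum of the two numbers in a cell (`num 0` on any other argument). -/
def add : Data → Data
  | pair (num a) (num b) => num (a + b)
  | _ => num 0

/-- Truncated difference of the two numbers in a cell (`num 0` on any other argument). -/
def sub : Data → Data
  | pair (num a) (num b) => num (a - b)
  | _ => num 0

/-- A list is a chain of cells that ends in `num 0`. -/
def ofList : List Data → Data
  | [] => num 0
  | x :: l => pair x (ofList l)

end Data

/-- Programs of the machine; each of them describes a partial function from data to data. -/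
inductive Program : Type
  | id : Program
  | const (a : ℕ) : Program
  | fst : Program
  | snd : Program
  | add : Program
  | sub : Program
  /-- Run both programs on the input and put the two results into a new cell. -/
  | pair (p r : Program) : Program
  /-- First run `p`, then run `r` on its result. -/
  | seq (p r : Program) : Program
  /-- If the result of `c` on the input is not `num 0` then run `p`, otherwise run `r`. -/
  | ite (c p r : Program) : Program
  /-- As long as the result of `c` on the current data is not `num 0`, apply `p` to the data. -/
  | loop (c p : Program) : Program

/-- `Runs p x y t`: on input `x`, the program `p` halts with output `y` after exactly `t` steps. -/
inductive Program.Runs : Program → Data → Data → ℕ → Prop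
  | id (x : Data) : Runs .id x x 1
  | const (a : ℕ) (x : Data) : Runs (.const a) x (.num a) 1
  | fst (x : Data) : Runs .fst x x.fst 1
  | snd (x : Data) : Runs .snd x x.snd 1
  | add (x : Data) : Runs .add x x.add 1
  | sub (x : Data) : Runs .sub x x.sub 1
  | pair {p r : Program} {x y z : Data} {s t : ℕ} :
      Runs p x y s → Runs r x z t → Runs (.pair p r) x (.pair y z) (s + t + 1)
  | seq {p r : Program} {x y z : Data} {s t : ℕ} :
      Runs p x y s → Runs r y z t → Runs (.seq p r) x z (s + t + 1)
  | ite_pos {c p r : Program} {x y z : Data} {s t : ℕ} :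
      Runs c x y s → y ≠ .num 0 → Runs p x z t → Runs (.ite c p r) x z (s + t + 1)
  | ite_neg {c p r : Program} {x z : Data} {s t : ℕ} :
      Runs c x (.num 0) s → Runs r x z t → Runs (.ite c p r) x z (s + t + 1)
  | loop_done {c p : Program} {x : Data} {s : ℕ} :
      Runs c x (.num 0) s → Runs (.loop c p) x x (s + 1)
  | loop_step {c p : Program} {x y x' z : Data} {s t u : ℕ} :
      Runs c x y s → y ≠ .num 0 → Runs p x x' t → Runs (.loop c p) x' z u →
      Runs (.loop c p) x z (s + t + u + 1)

/-! ## The hypergraph painting problem -/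

/-- The two colours. -/
inductive Colour : Type
  | black : Colour
  | white : Colour
  deriving DecidableEq

instance : Fintype Colour :=
  ⟨{.black, .white}, fun x => by cases x <;> simp⟩

/-- An instance of hypergraph painting. The vertices are `0, …, n - 1`; the multihypergraph is a
family of `m` vertex sets, in which sets may repeat. -/
structure HPInstance where
  k : ℕ
  b : ℕ
  d : ℕ
  q : ℕ
  k_pos : 0 < k
  b_pos : 0 < b
  d_pos : 0 < d
  q_pos : 0 < q
  n : ℕ
  m : ℕ
  edge : Fin m → Finset (Fin n)
  edge_card_le : ∀ e, (edge e).card ≤ d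
  /-- The partial colouring; `none` means uncoloured. -/
  col₀ : Fin n → Option Colour
  /-- The functions `f_F`, with values in `{0, 1, …, k, ∞}`. -/
  cost : (e : Fin m) → ({v // v ∈ edge e} → Colour) → Fin (b + 1) → ℕ∞
  cost_range : ∀ e c μ, cost e c μ ≤ (k : ℕ∞) ∨ cost e c μ = ⊤

namespace HPInstance

/-- `col` extends the given partial colouring. -/
def Extends (I : HPInstance) (col : Fin I.n → Colour) : Prop :=
  ∀ v c, I.col₀ v = some c → col v = c

/-- The sum of the costs of all hyperedges, replaced by `∞` if it exceeds `k`. -/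
noncomputable def totalCost (I : HPInstance) (col : Fin I.n → Colour)
    (a : Fin I.m → Fin (I.b + 1)) : ℕ∞ :=
  if ∑ e, I.cost e (fun v => col v) (a e) ≤ (I.k : ℕ∞)
  then ∑ e, I.cost e (fun v => col v) (a e) else ⊤

/-- The value `w_μ`, for `0 ≤ μ ≤ b`; it is `∞` if there is no admissible pair. (The parts of a
partition of `μ` into non-negative integers are automatically at most `b`.) -/
noncomputable def w (I : HPInstance) (μ : Fin (I.b + 1)) : ℕ∞ :=
  ⨅ (col : Fin I.n → Colour) (_ : I.Extends col)
    (a : Fin I.m → Fin (I.b + 1)) (_ : ∑ e, (a e : ℕ) = (μ : ℕ)), I.totalCost col a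

/-- The colouring `col` witnesses the value `w_μ`. -/
def Witnesses (I : HPInstance) (col : Fin I.n → Colour) (μ : Fin (I.b + 1)) : Prop :=
  I.Extends col ∧ ∃ a : Fin I.m → Fin (I.b + 1),
    ∑ e, (a e : ℕ) = (μ : ℕ) ∧ I.totalCost col a = I.w μ

/-- The number of elements of colour `x` in a colouring. -/
def colourCount {V : Type} [Fintype V] (c : V → Colour) (x : Colour) : ℕ :=
  (Finset.univ.filter fun v => c v = x).card

def LocallyUnbreakable (I : HPInstance) : Prop :=
  ∀ e (c : {v // v ∈ I.edge e} → Colour),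
    3 * I.k < colourCount c .black → 3 * I.k < colourCount c .white → ∀ μ, I.cost e c μ = ⊤

def ConnectedCosts (I : HPInstance) : Prop :=
  ∀ e (c : {v // v ∈ I.edge e} → Colour),
    0 < colourCount c .black → 0 < colourCount c .white → ∀ μ, I.cost e c μ ≠ 0

def GloballyUnbreakable (I : HPInstance) : Prop :=
  ∀ μ, I.w μ < ⊤ → ∃ col, I.Witnesses col μ ∧
    min (colourCount col .black) (colourCount col .white) ≤ I.q

/-- Proper instances. -/
def IsProper (I : HPInstance) : Prop :=
  I.LocallyUnbreakable ∧ I.ConnectedCosts ∧ I.GloballyUnbreakable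

/-! ## Input and output format -/

/-- A way of writing down an instance: an ordering of the vertices of each hyperedge, and for each
hyperedge a repetition-free list, in any order, of exactly the triples `(c, μ, f_F(c, μ))` with
`f_F(c, μ) < ∞`. -/
structure Presentation (I : HPInstance) where
  order : ∀ e, Fin (I.edge e).card ≃ {v // v ∈ I.edge e}
  table : ∀ e, List (({v // v ∈ I.edge e} → Colour) × Fin (I.b + 1) × ℕ)
  table_nodup : ∀ e, (table e).Nodup
  mem_table : ∀ e c μ (a : ℕ), (c, μ, a) ∈ table e ↔ I.cost e c μ = (a : ℕ∞)

/-- Colours are written as 1 and 2. -/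
def codeColour : Colour → Data
  | .black => .num 1
  | .white => .num 2

/-- A missing colour is written as 0. -/
def codeOptColour : Option Colour → Data
  | none => .num 0
  | some c => codeColour c

/-- A table entry: the list of the colours of the vertices of the hyperedge, in the chosen order,
then `μ`, then the value. -/
def codeEntry {I : HPInstance} (P : I.Presentation) (e : Fin I.m)
    (r : ({v // v ∈ I.edge e} → Colour) × Fin (I.b + 1) × ℕ) : Data :=
  .ofList [.ofList (List.ofFn fun i => codeColour (r.1 (P.order e i))), .num r.2.1, .num r.2.2]

/-- A hyperedge: the list of its vertices in the chosen order, and the table of its function. -/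
def codeEdge {I : HPInstance} (P : I.Presentation) (e : Fin I.m) : Data :=
  .ofList [.ofList (List.ofFn fun i => .num (P.order e i).1),
    .ofList ((P.table e).map (codeEntry P e))]

/-- The input of the algorithm. -/
def input (I : HPInstance) (P : I.Presentation) : Data :=
  .ofList [.num I.k, .num I.b, .num I.d, .num I.q, .num I.n, .num I.m,
    .ofList (List.ofFn fun v => codeOptColour (I.col₀ v)),
    .ofList (List.ofFn fun e => codeEdge P e)]

/-- In the output, `∞` is written as 0 and an integer `a` as `a + 1`. -/
noncomputable def codeValue (a : ℕ∞) : Data :=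
  if a = ⊤ then .num 0 else .num (a.toNat + 1)

/-- The required output: the list of `w_0, …, w_b`. -/
noncomputable def solution (I : HPInstance) : Data :=
  .ofList (List.ofFn fun μ => codeValue (I.w μ))

end HPInstance

/-! By connectivity an optimal colouring has at most `k` bichromatic hyperedges, and by global
unbreakability some optimal colouring uses one colour `s` on at most `q` vertices. Guess patterns
for some of the hyperedges such that the guess is right on the bichromatic ones and there is none
on at most `q` others, which are coloured `s` throughout and span the hyperedges coloured `s`
throughout: equality of the colours within them forces it within each of these. A rank argument
provides the `q` hyperedges. Every other guess may be wrong: it can be ignored where the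
hyperedges without a guess already connect all vertices, and it is harmless on a hyperedge without
the colour `s`. Gluing along the hyperedges without a guess and along the vertices that are
guessed to have colour `s` gives clusters that get colour `s` independently of each other, and
min-plus convolution finds the best choice.

Instead of a random guess, as in colour coding, the algorithm overlays `k` guesses that are
supported on residue classes. One of `k + q` indices is separated from the others by a small
modulus, because a central binomial coefficient does not divide the product of the differences. By
local unbreakability each hyperedge has only `d ^ O(k)` patterns of finite cost. -/

/-! ## Programs with polynomial running time -/

/-- Number of nodes of the tree; a number has size one, whatever its value. -/
def Data.size : Data → ℕ
  | num _ => 1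
  | pair x y => size x + size y + 1

/-- Types whose elements are stored in the memory of the machine, with a chosen representation. -/
class Coded (α : Type) where
  code : α → Data

open Coded

instance : Coded ℕ := ⟨.num⟩
instance : Coded Bool := ⟨fun b => .num b.toNat⟩
instance {α β : Type} [Coded α] [Coded β] : Coded (α × β) := ⟨fun x => .pair (code x.1) (code x.2)⟩
instance {α : Type} [Coded α] : Coded (List α) := ⟨fun l => .ofList (l.map code)⟩
instance : Coded Colour := ⟨HPInstance.codeColour⟩
instance : Coded (Option Colour) := ⟨HPInstance.codeOptColour⟩
noncomputable instance : Coded ℕ∞ := ⟨HPInstance.codeValue⟩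

/-- Size of the memory representation. -/
def codeSize {α : Type} [Coded α] (x : α) : ℕ := (code x).size

section codeSize
variable {α β : Type} [Coded α] [Coded β]

theorem codeSize_prod (x : α × β) : codeSize x = codeSize x.1 + codeSize x.2 + 1 := rfl

theorem codeSize_nil : codeSize ([] : List α) = 1 := rfl

theorem codeSize_cons (a : α) (l : List α) :
    codeSize (a :: l) = codeSize a + codeSize l + 1 := rfl

theorem codeSize_nat (a : ℕ) : codeSize a = 1 := rfl

theorem codeSize_bool (a : Bool) : codeSize a = 1 := rfl

theorem codeSize_colour (a : Colour) : codeSize a = 1 := by cases a <;> rfl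

theorem codeSize_optionColour (a : Option Colour) : codeSize a = 1 := by
  rcases a with _ | _ | _ <;> rfl

theorem codeSize_enat (a : ℕ∞) : codeSize a = 1 := by
  simp only [codeSize, code, HPInstance.codeValue]
  split <;> rfl

theorem codeSize_pos (x : α) : 0 < codeSize x := by
  unfold codeSize
  cases code x <;> simp [Data.size]

theorem codeSize_append (l l' : List α) :
    codeSize (l ++ l') + 1 = codeSize l + codeSize l' := by
  induction l with
  | nil => simp [codeSize_nil, add_comm]
  | cons a l ih => simp only [List.cons_append, codeSize_cons]; lia

theorem length_lt_codeSize (l : List α) : l.length < codeSize l := by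
  induction l with
  | nil => simp [codeSize_nil]
  | cons a l ih => simp only [List.length_cons, codeSize_cons]; lia

theorem codeSize_lt_of_mem {a : α} {l : List α} (h : a ∈ l) : codeSize a < codeSize l := by
  induction l with
  | nil => simp at h
  | cons b l ih => rcases List.mem_cons.1 h with rfl | h <;> grind [codeSize_cons]

theorem codeSize_list_le {l : List α} {c : ℕ} (h : ∀ a ∈ l, codeSize a ≤ c) :
    codeSize l ≤ l.length * (c + 1) + 1 := by
  induction l with
  | nil => simp [codeSize_nil]
  | cons b l ih =>
    have hb := h b List.mem_cons_self
    have hl := ih fun a ha => h a (List.mem_cons_of_mem b ha)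
    rw [codeSize_cons, List.length_cons, add_mul]
    lia

theorem codeSize_foldl_le {β : Type} {s : α → β → α} {c : ℕ} (l : List β) (i : α)
    (h : ∀ a, ∀ b ∈ l, codeSize (s a b) ≤ codeSize a + c) :
    codeSize (l.foldl s i) ≤ codeSize i + l.length * c := by
  induction l generalizing i with
  | nil => simp
  | cons b l ih =>
    have hfold := ih (s i b) fun a b' hb' => h a b' (List.mem_cons_of_mem b hb')
    have hstep := h i b List.mem_cons_self
    rw [List.foldl_cons, List.length_cons, add_mul]
    lia

end codeSize

theorem eval_nat_mono (P : Polynomial ℕ) {a b : ℕ} (h : a ≤ b) : P.eval a ≤ P.eval b := by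
  simp only [Polynomial.eval_eq_sum_range]
  gcongr

/-- `f` is computed by a program whose running time and output size on input `x` are bounded by a
polynomial in `M x`. The output size is bounded separately because subtrees are shared: a program
may produce a tree with more nodes than it makes steps. -/
def PolyTimeIn {α β : Type} [Coded α] [Coded β] (M : α → ℕ) (f : α → β) : Prop :=
  ∃ (p : Program) (P : Polynomial ℕ), ∀ x, ∃ t, p.Runs (code x) (code (f x)) t ∧
    t ≤ P.eval (M x) ∧ codeSize (f x) ≤ P.eval (M x)

/-- Computability in time polynomial in the size of the input. -/
@[fun_prop]
def PolyTime {α β : Type} [Coded α] [Coded β] (f : α → β) : Prop := PolyTimeIn codeSize f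

theorem Program.exists_const (d : Data) : ∃ (p : Program) (t : ℕ), ∀ x, p.Runs x d t := by
  induction d with
  | num a => exact ⟨_, _, .const a⟩
  | pair x y hx hy =>
    obtain ⟨p, s, hp⟩ := hx
    obtain ⟨r, t, hr⟩ := hy
    exact ⟨_, _, fun x => .pair (hp x) (hr x)⟩

section PolyTime
variable {α β γ δ : Type} [Coded α] [Coded β] [Coded γ] [Coded δ] {M : α → ℕ}

theorem PolyTimeIn.of_eq {f g : α → β} (hf : PolyTimeIn M f) (h : ∀ x, f x = g x) :
    PolyTimeIn M g := by
  rwa [← funext h]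

theorem PolyTime.of_eq {f g : α → β} (hf : PolyTime f) (h : ∀ x, f x = g x) : PolyTime g :=
  PolyTimeIn.of_eq hf h

theorem PolyTimeIn.mono {M' : α → ℕ} {f : α → β} (hf : PolyTimeIn M f) (hM : ∀ x, M x ≤ M' x) :
    PolyTimeIn M' f := by
  obtain ⟨p, P, h⟩ := hf
  refine ⟨p, P, fun x => ?_⟩
  obtain ⟨t, hp, ht, hs⟩ := h x
  exact ⟨t, hp, ht.trans (eval_nat_mono _ (hM x)), hs.trans (eval_nat_mono _ (hM x))⟩

theorem PolyTimeIn.exists_codeSize_le {f : α → β} (h : PolyTimeIn M f) :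
    ∃ P : Polynomial ℕ, ∀ x, codeSize (f x) ≤ P.eval (M x) := by
  obtain ⟨p, P, h⟩ := h
  exact ⟨P, fun x => (h x).choose_spec.2.2⟩

theorem PolyTime.comp_polyTimeIn {g : β → γ} {f : α → β} (hg : PolyTime g)
    (hf : PolyTimeIn M f) : PolyTimeIn M fun x => g (f x) := by
  obtain ⟨p, P, hf⟩ := hf
  obtain ⟨r, Q, hg⟩ := hg
  refine ⟨.seq p r, P + Q.comp P + 1, fun x => ?_⟩
  obtain ⟨t, hp, ht, hs⟩ := hf x
  obtain ⟨u, hr, hu, hs'⟩ := hg (f x)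
  have := eval_nat_mono Q hs
  refine ⟨_, .seq hp hr, ?_, ?_⟩ <;>
  simp only [Polynomial.eval_add, Polynomial.eval_comp, Polynomial.eval_one] <;> lia

theorem PolyTimeIn.prodMk {f : α → β} {g : α → γ} (hf : PolyTimeIn M f) (hg : PolyTimeIn M g) :
    PolyTimeIn M fun x => (f x, g x) := by
  obtain ⟨p, P, hf⟩ := hf
  obtain ⟨r, Q, hg⟩ := hg
  refine ⟨.pair p r, P + Q + 1, fun x => ?_⟩
  obtain ⟨t, hp, ht, hs⟩ := hf x
  obtain ⟨u, hr, hu, hs'⟩ := hg x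
  refine ⟨_, .pair hp hr, ?_, ?_⟩ <;>
  simp only [codeSize_prod, Polynomial.eval_add, Polynomial.eval_one] <;> lia

namespace PolyTime

theorem of_runs {f : α → β} (p : Program) (c : ℕ)
    (h : ∀ x, ∃ t ≤ c, p.Runs (code x) (code (f x)) t) (hs : ∀ x, codeSize (f x) ≤ codeSize x + c) :
    PolyTime f := by
  refine ⟨p, .X + .C c, fun x => ?_⟩
  obtain ⟨t, ht, hp⟩ := h x
  have := hs x
  refine ⟨t, hp, ?_, ?_⟩ <;>
  simp only [Polynomial.eval_add, Polynomial.eval_X, Polynomial.eval_C] <;> lia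

theorem of_code_eq {f : α → β} (h : ∀ x, code (f x) = code x) : PolyTime f :=
  .of_runs .id 1 (fun x => ⟨1, le_rfl, by rw [h]; exact .id _⟩) fun x => by simp [codeSize, h]

theorem congr_code {f : α → β} {g : α → γ} (hg : PolyTime g) (h : ∀ x, code (f x) = code (g x)) :
    PolyTime f := by
  obtain ⟨p, P, hg⟩ := hg
  exact ⟨p, P, fun x => by simpa only [codeSize, h] using hg x⟩

@[fun_prop]
theorem id : PolyTime fun x : α => x := of_code_eq fun _ => rfl

@[fun_prop]
theorem const (b : β) : PolyTime fun _ : α => b := by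
  obtain ⟨p, t, h⟩ := Program.exists_const (code b)
  exact ⟨p, .C (t + codeSize b), fun x => ⟨t, h _, by simp⟩⟩

@[fun_prop]
theorem comp {g : β → γ} {f : α → β} (hg : PolyTime g) (hf : PolyTime f) :
    PolyTime fun x => g (f x) :=
  hg.comp_polyTimeIn hf

@[fun_prop]
theorem prodMk {f : α → β} {g : α → γ} (hf : PolyTime f) (hg : PolyTime g) :
    PolyTime fun x => (f x, g x) :=
  PolyTimeIn.prodMk hf hg

@[fun_prop]
theorem fst {f : α → β × γ} (hf : PolyTime f) : PolyTime fun x => (f x).1 :=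
  (of_runs .fst 1 (fun _ => ⟨1, le_rfl, .fst _⟩) fun _ => by rw [codeSize_prod]; lia :
    PolyTime (Prod.fst : β × γ → β)).comp hf

@[fun_prop]
theorem snd {f : α → β × γ} (hf : PolyTime f) : PolyTime fun x => (f x).2 :=
  (of_runs .snd 1 (fun _ => ⟨1, le_rfl, .snd _⟩) fun _ => by rw [codeSize_prod]; lia :
    PolyTime (Prod.snd : β × γ → γ)).comp hf

@[fun_prop]
theorem add {f g : α → ℕ} (hf : PolyTime f) (hg : PolyTime g) : PolyTime fun x => f x + g x :=
  (of_runs .add 1 (fun _ => ⟨1, le_rfl, .add _⟩) fun _ => by rw [codeSize_nat]; lia :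
    PolyTime fun x : ℕ × ℕ => x.1 + x.2).comp (hf.prodMk hg)

@[fun_prop]
theorem sub {f g : α → ℕ} (hf : PolyTime f) (hg : PolyTime g) : PolyTime fun x => f x - g x :=
  (of_runs .sub 1 (fun _ => ⟨1, le_rfl, .sub _⟩) fun _ => by rw [codeSize_nat]; lia :
    PolyTime fun x : ℕ × ℕ => x.1 - x.2).comp (hf.prodMk hg)

@[fun_prop]
theorem cons {f : α → β} {l : α → List β} (hf : PolyTime f) (hl : PolyTime l) :
    PolyTime fun x => f x :: l x :=
  (of_code_eq fun _ => rfl : PolyTime fun x : β × List β => x.1 :: x.2).comp (hf.prodMk hl)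

@[fun_prop]
theorem ite {c : α → Prop} [DecidablePred c] {f g : α → β}
    (hc : PolyTime fun x => decide (c x)) (hf : PolyTime f) (hg : PolyTime g) :
    PolyTime fun x => if c x then f x else g x := by
  obtain ⟨o, O, hc⟩ := hc
  obtain ⟨p, P, hf⟩ := hf
  obtain ⟨r, Q, hg⟩ := hg
  refine ⟨.ite o p r, O + P + Q + 1, fun x => ?_⟩
  obtain ⟨s, ho, hs, -⟩ := hc x
  by_cases h : c x
  · obtain ⟨t, hp, ht, hsize⟩ := hf x
    refine ⟨_, .ite_pos (y := .num 1) (by simpa [code, h] using ho) (by simp)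
      (by simpa [h] using hp), ?_, ?_⟩ <;>
    simp only [Polynomial.eval_add, Polynomial.eval_one, h, if_true] <;> lia
  · obtain ⟨u, hr, hu, hsize⟩ := hg x
    refine ⟨_, .ite_neg (by simpa [code, h] using ho) (by simpa [h] using hr), ?_, ?_⟩ <;>
    simp only [Polynomial.eval_add, Polynomial.eval_one, h, if_false] <;> lia

theorem decide_eq_zero : PolyTime fun x : ℕ => decide (x = 0) := by
  refine of_runs (.ite .id (.const 0) (.const 1)) 3 (fun x => ⟨3, le_rfl, ?_⟩) fun x => by
    rw [codeSize_bool]; lia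
  by_cases h : x = 0
  · subst h
    exact .ite_neg (.id _) (.const _ _)
  · have hcode : code (decide (x = 0)) = .num 0 := by simp [code, h]
    rw [hcode]
    exact .ite_pos (y := code x) (.id _) (fun e => h (Data.num.inj e)) (.const _ _)

@[fun_prop]
theorem decide_le {f g : α → ℕ} (hf : PolyTime f) (hg : PolyTime g) :
    PolyTime fun x => decide (f x ≤ g x) :=
  (decide_eq_zero.comp (hf.sub hg)).of_eq fun x => by simp [Nat.sub_eq_zero_iff_le]

@[fun_prop]
theorem not {f : α → Bool} (hf : PolyTime f) : PolyTime fun x => !f x :=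
  (ite (c := fun x => f x = true) (by simpa using hf) (const false) (const true)).of_eq
    fun x => by cases f x <;> rfl

@[fun_prop]
theorem and {f g : α → Bool} (hf : PolyTime f) (hg : PolyTime g) : PolyTime fun x => f x && g x :=
  (ite (c := fun x => f x = true) (by simpa using hf) hg (const false)).of_eq
    fun x => by cases f x <;> rfl

theorem listCases {l : α → List β} {f : α → γ} {g : α → β → List β → γ} (hl : PolyTime l)
    (hf : PolyTime f) (hg : PolyTime fun x : α × β × List β => g x.1 x.2.1 x.2.2) :
    PolyTime fun x => match l x with | [] => f x | b :: l' => g x b l' := by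
  obtain ⟨o, O, hl⟩ := hl
  obtain ⟨p, P, hf⟩ := hf
  obtain ⟨r, Q, hg⟩ := hg
  refine ⟨.ite o (.seq (.pair .id o) r) p, O + P + Q.comp (O + .X + 1) + O + 6, fun x => ?_⟩
  obtain ⟨s, ho, hs, hsize⟩ := hl x
  rcases h : l x with _ | ⟨b, l'⟩
  · obtain ⟨t, hp, ht, hsize'⟩ := hf x
    rw [h] at ho
    simp only [h]
    refine ⟨_, .ite_neg ho hp, ?_, ?_⟩ <;>
    simp only [Polynomial.eval_add, Polynomial.eval_ofNat] <;> lia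
  · obtain ⟨u, hr, hu, hsize'⟩ := hg (x, b, l')
    rw [h] at ho hsize
    have harg : codeSize (x, b, l') ≤ (O + .X + 1).eval (codeSize x) := by
      simp only [Polynomial.eval_add, Polynomial.eval_one, Polynomial.eval_X, codeSize_prod,
        codeSize_cons] at hsize ⊢
      lia
    have hQ := eval_nat_mono Q harg
    simp only [h]
    refine ⟨_, .ite_pos ho (by simp [code, Data.ofList]) (.seq (.pair (.id _) ho) hr), ?_, ?_⟩ <;>
    simp only [Polynomial.eval_add, Polynomial.eval_comp, Polynomial.eval_ofNat] at hQ ⊢ <;> lia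

end PolyTime

/-- A loop that folds a list with the step program `p`. The state consists of the list, an
environment on which the step may depend, and the accumulator. -/
def Program.foldLoop (p : Program) : Program :=
  .loop .fst (.pair (.seq .fst .snd) (.pair (.seq .snd .fst)
    (.seq (.pair (.seq .snd .fst) (.pair (.seq .snd .snd) (.seq .fst .fst))) p)))

theorem Program.foldLoop_runs {p : Program} {s : γ → β → γ} {e : α} {T : ℕ} (l : List β) (i : γ)
    (h : ∀ l' b, l' ++ [b] <+: l → ∃ t ≤ T, p.Runs (code (e, l'.foldl s i, b))
      (code (s (l'.foldl s i) b)) t) :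
    ∃ t ≤ (l.length + 1) * (T + 30), p.foldLoop.Runs (code (l, e, i))
      (code (([] : List β), e, l.foldl s i)) t := by
  induction l generalizing i with
  | nil => exact ⟨1 + 1, by simp, .loop_done (.fst _)⟩
  | cons b l ih =>
    obtain ⟨t, ht, hp⟩ := h [] b ⟨l, by simp⟩
    obtain ⟨u, hu, hl⟩ := ih (s i b) fun l' b' ⟨r, hr⟩ => h (b :: l') b' ⟨r, by simp [← hr]⟩
    refine ⟨_, ?_, .loop_step (y := code (b :: l)) (.fst _) (by simp [code, Data.ofList])
      (.pair (.seq (.fst _) (.snd _)) (.pair (.seq (.snd _) (.fst _))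
      (.seq (.pair (.seq (.snd _) (.fst _)) (.pair (.seq (.snd _) (.snd _))
        (.seq (.fst _) (.fst _)))) hp))) hl⟩
    rw [List.length_cons, add_mul (l.length + 1)]
    lia

theorem PolyTimeIn.foldl_of_bounded {e : α → δ} {l : α → List β} {i : α → γ}
    {s : δ → γ → β → γ} (he : PolyTimeIn M e) (hl : PolyTimeIn M l) (hi : PolyTimeIn M i)
    (hs : PolyTime fun x : δ × γ × β => s x.1 x.2.1 x.2.2) (Q : Polynomial ℕ)
    (hQ : ∀ x l', l' <+: l x → codeSize (l'.foldl (s (e x)) (i x)) ≤ Q.eval (M x)) :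
    PolyTimeIn M fun x => (l x).foldl (s (e x)) (i x) := by
  obtain ⟨pe, E, he⟩ := he
  obtain ⟨pl, L, hl⟩ := hl
  obtain ⟨pi, I, hi⟩ := hi
  obtain ⟨p, P, hs⟩ := hs
  refine ⟨.seq (.pair pl (.pair pe pi)) (.seq p.foldLoop (.seq .snd .snd)),
    E + L + I + (L + 1) * (P.comp (E + Q + L + 2) + 30) + 20 + Q, fun x => ?_⟩
  obtain ⟨te, hpe, hte, hse⟩ := he x
  obtain ⟨tl, hpl, htl, hsl⟩ := hl x
  obtain ⟨ti, hpi, hti, -⟩ := hi x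
  obtain ⟨t, ht, hloop⟩ := Program.foldLoop_runs (p := p) (e := e x) (s := s (e x))
    (T := (P.comp (E + Q + L + 2)).eval (M x)) (l x) (i x) (by
      rintro l' b ⟨r, hr⟩
      obtain ⟨t, hp, ht, -⟩ := hs (e x, l'.foldl (s (e x)) (i x), b)
      refine ⟨t, ht.trans ?_, hp⟩
      rw [Polynomial.eval_comp]
      apply eval_nat_mono
      have hacc := hQ x l' ((List.prefix_append l' [b]).trans ⟨r, hr⟩)
      have hb : codeSize b < codeSize (l x) := codeSize_lt_of_mem (by simp [← hr])
      simp only [codeSize_prod, Polynomial.eval_add, Polynomial.eval_ofNat]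
      lia)
  refine ⟨_, .seq (.pair hpl (.pair hpe hpi)) (.seq hloop (.seq (.snd _) (.snd _))), ?_, ?_⟩
  · have hlength : (l x).length + 1 ≤ L.eval (M x) + 1 := by
      have := length_lt_codeSize (l x)
      lia
    have hbound := ht.trans (Nat.mul_le_mul_right _ hlength)
    simp only [Polynomial.eval_add, Polynomial.eval_ofNat, Polynomial.eval_mul,
      Polynomial.eval_one] at hbound ⊢
    lia
  · have := hQ x (l x) List.prefix_rfl
    simp only [Polynomial.eval_add]
    lia

theorem PolyTime.foldl {l : α → List β} {i : α → γ} {s : α → γ → β → γ} (hl : PolyTime l)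
    (hi : PolyTime i) (hs : PolyTime fun x : α × γ × β => s x.1 x.2.1 x.2.2) (Q : Polynomial ℕ)
    (hQ : ∀ x c b, codeSize (s x c b) ≤ codeSize c + Q.eval (codeSize x + codeSize b)) :
    PolyTime fun x => (l x).foldl (s x) (i x) := by
  obtain ⟨L, hL⟩ := hl.exists_codeSize_le
  obtain ⟨I, hI⟩ := hi.exists_codeSize_le
  refine PolyTimeIn.foldl_of_bounded id hl hi hs (I + L * Q.comp (.X + L)) fun x l' hl' => ?_
  have hfold := codeSize_foldl_le (s := s x) l' (i x)
    (c := Q.eval (codeSize x + L.eval (codeSize x))) fun a b hb => (hQ x a b).trans <| by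
      have := (codeSize_lt_of_mem (hl'.subset hb)).le.trans (hL x)
      gcongr
      exact eval_nat_mono Q (by lia)
  have hlength : l'.length ≤ L.eval (codeSize x) :=
    hl'.length_le.trans ((length_lt_codeSize _).le.trans (hL x))
  have := Nat.mul_le_mul_right (Q.eval (codeSize x + L.eval (codeSize x))) hlength
  have := hI x
  simp only [Polynomial.eval_add, Polynomial.eval_mul, Polynomial.eval_comp, Polynomial.eval_X]
  lia

namespace PolyTime

@[fun_prop]
theorem reverse {l : α → List β} (hl : PolyTime l) : PolyTime fun x => (l x).reverse :=
  (foldl (i := fun _ => ([] : List β)) (s := fun _ c b => b :: c) hl (by fun_prop) (by fun_prop)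
    (.X + 1) fun x c b => by
      simp only [codeSize_cons, Polynomial.eval_add, Polynomial.eval_X, Polynomial.eval_one]
      lia).of_eq fun x => by simp

theorem foldr {l : α → List β} {i : α → γ} {s : α → β → γ → γ} (hl : PolyTime l)
    (hi : PolyTime i) (hs : PolyTime fun x : α × γ × β => s x.1 x.2.2 x.2.1) (Q : Polynomial ℕ)
    (hQ : ∀ x c b, codeSize (s x b c) ≤ codeSize c + Q.eval (codeSize x + codeSize b)) :
    PolyTime fun x => (l x).foldr (s x) (i x) :=
  (foldl (s := fun x c b => s x b c) hl.reverse hi hs Q hQ).of_eq fun x => by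
    rw [List.foldl_reverse]

@[fun_prop]
theorem append {l l' : α → List β} (hl : PolyTime l) (hl' : PolyTime l') :
    PolyTime fun x => l x ++ l' x :=
  (foldr (s := fun _ => List.cons) hl hl' (by fun_prop) (.X + 1) fun x c b => by
    simp only [codeSize_cons, Polynomial.eval_add, Polynomial.eval_X, Polynomial.eval_one]
    lia).of_eq fun x => by simp

@[fun_prop]
theorem flatMap {l : α → List β} {f : α → β → List γ} (hl : PolyTime l)
    (hf : PolyTime fun x : α × β => f x.1 x.2) : PolyTime fun x => (l x).flatMap (f x) := by
  obtain ⟨P, hP⟩ := hf.exists_codeSize_le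
  have hstep : PolyTime fun x : α × List γ × β => f x.1 x.2.2 :=
    comp hf (by fun_prop : PolyTime fun x : α × List γ × β => (x.1, x.2.2))
  refine (foldr (i := fun _ => ([] : List γ)) (s := fun x b c => f x b ++ c) hl (by fun_prop)
    (hstep.append (by fun_prop)) (P.comp (.X + 1)) fun x c b => ?_).of_eq fun x => ?_
  · have hsize : codeSize (f x b) ≤ P.eval (codeSize x + codeSize b + 1) := hP (x, b)
    have := codeSize_append (f x b) c
    simp only [Polynomial.eval_add, Polynomial.eval_X, Polynomial.eval_one, Polynomial.eval_comp]
    lia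
  · rw [List.foldr_append_eq_append, List.append_nil, List.flatMap_def]

@[fun_prop]
theorem map {l : α → List β} {f : α → β → γ} (hl : PolyTime l)
    (hf : PolyTime fun x : α × β => f x.1 x.2) : PolyTime fun x => (l x).map (f x) :=
  (hl.flatMap (f := fun x b => [f x b]) (hf.cons (const []))).of_eq fun x => by
    rw [List.map_eq_flatMap]

@[fun_prop]
theorem flatten {l : α → List (List β)} (hl : PolyTime l) : PolyTime fun x => (l x).flatten :=
  (hl.flatMap (f := fun _ b => b) (by fun_prop)).of_eq fun x => by rw [List.flatMap_id']

@[fun_prop]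
theorem filter {l : α → List β} {p : α → β → Bool} (hl : PolyTime l)
    (hp : PolyTime fun x : α × β => p x.1 x.2) : PolyTime fun x => (l x).filter (p x) :=
  (hl.flatMap (f := fun x b => if p x b then [b] else [])
    (ite (c := fun x : α × β => p x.1 x.2 = true) (by simpa using hp) (by fun_prop)
      (by fun_prop))).of_eq fun x => by
    induction l x with
    | nil => rfl
    | cons b l ih => cases h : p x b <;> simp_all

@[fun_prop]
theorem any {l : α → List β} {p : α → β → Bool} (hl : PolyTime l)
    (hp : PolyTime fun x : α × β => p x.1 x.2) : PolyTime fun x => (l x).any (p x) :=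
  (listCases (f := fun _ => false) (g := fun _ _ _ => true) (hl.filter hp) (by fun_prop)
    (by fun_prop)).of_eq fun x => by
    induction l x with
    | nil => rfl
    | cons b l ih => cases h : p x b <;> simp_all

@[fun_prop]
theorem all {l : α → List β} {p : α → β → Bool} (hl : PolyTime l)
    (hp : PolyTime fun x : α × β => p x.1 x.2) : PolyTime fun x => (l x).all (p x) :=
  (hl.any (p := fun x b => !p x b) hp.not).not.of_eq fun x => by simp [List.not_any_eq_all_not]

@[fun_prop]
theorem length {l : α → List β} (hl : PolyTime l) : PolyTime fun x => (l x).length :=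
  (foldl (i := fun _ => 0) (s := fun _ c _ => c + 1) hl (by fun_prop) (by fun_prop) 1
    fun x c b => by simp [codeSize_nat]).of_eq fun x => by simp

end PolyTime

theorem Program.exists_range : ∃ p : Program, ∀ n : ℕ,
    p.Runs (.num n) (code (List.range n)) (n * 15 + 8) := by
  let dec : Program := .seq (.pair .fst (.const 1)) .sub
  have hdec (n : ℕ) (d : Data) : dec.Runs (.pair (.num n) d) (.num (n - 1)) 5 :=
    .seq (.pair (.fst _) (.const _ _)) (.sub _)
  have hloop (n : ℕ) (l : List ℕ) : (Program.loop .fst (.pair dec (.pair dec .snd))).Runs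
      (.pair (.num n) (code l)) (.pair (.num 0) (code (List.range n ++ l))) (n * 15 + 2) := by
    induction n generalizing l with
    | zero => exact .loop_done (.fst _)
    | succ n ih =>
      rw [List.range_succ, List.append_assoc, List.singleton_append, add_mul, one_mul,
        show n * 15 + 15 + 2 = 1 + (5 + (5 + 1 + 1) + 1) + (n * 15 + 2) + 1 by ring]
      exact .loop_step (.fst _) (by simp [Data.fst])
        (.pair (hdec (n + 1) (code l)) (.pair (hdec (n + 1) (code l)) (.snd _))) (ih (n :: l))
  refine ⟨.seq (.pair .id (.const 0)) (.seq (.loop .fst (.pair dec (.pair dec .snd))) .snd),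
    fun n => ?_⟩
  convert! Program.Runs.seq (.pair (.id _) (.const 0 _)) (.seq (hloop n []) (.snd _)) using 1
  · simp [Data.snd]
  · ring

theorem PolyTimeIn.range {f : α → ℕ} (hf : PolyTimeIn M f) (h : ∀ x, f x ≤ M x) :
    PolyTimeIn M fun x => List.range (f x) := by
  obtain ⟨p, P, hp⟩ := hf
  obtain ⟨r, hr⟩ := Program.exists_range
  refine ⟨.seq p r, P + 15 * .X + 9, fun x => ?_⟩
  obtain ⟨t, hrun, ht, -⟩ := hp x
  have := h x
  refine ⟨_, .seq hrun (hr (f x)), ?_, ?_⟩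
  · simp only [Polynomial.eval_add, Polynomial.eval_mul, Polynomial.eval_ofNat, Polynomial.eval_X]
    lia
  · have := codeSize_list_le (l := List.range (f x)) (c := 1) fun a _ => (codeSize_nat a).le
    simp only [Polynomial.eval_add, Polynomial.eval_mul, Polynomial.eval_ofNat, Polynomial.eval_X,
      List.length_range] at this ⊢
    lia

/-- Types whose equality is decided in polynomial time. -/
class PolyTimeEq (β : Type) [Coded β] [DecidableEq β] : Prop where
  decide_eq : PolyTime fun x : β × β => decide (x.1 = x.2)

namespace PolyTime

@[fun_prop]
theorem range_length {l : α → List β} (hl : PolyTime l) :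
    PolyTime fun x => List.range (l x).length :=
  have hrange : PolyTime fun l : List β => List.range l.length :=
    PolyTimeIn.range (PolyTime.id.length) fun l => (length_lt_codeSize l).le
  hrange.comp hl

@[fun_prop]
theorem zip {l : α → List β} {l' : α → List γ} (hl : PolyTime l) (hl' : PolyTime l') :
    PolyTime fun x => (l x).zip (l' x) := by
  let step (c : List γ × List (β × γ)) (b : β) : List γ × List (β × γ) :=
    match c.1 with
    | [] => c
    | a :: t => (t, (b, a) :: c.2)
  have hstep : PolyTime fun x : α × (List γ × List (β × γ)) × β => step x.2.1 x.2.2 :=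
    listCases (α := α × (List γ × List (β × γ)) × β) (l := fun x => x.2.1.1)
      (f := fun x => x.2.1) (g := fun x a t => (t, (x.2.2, a) :: x.2.1.2)) (by fun_prop)
      (by fun_prop) (by fun_prop)
  have hfold (l : List β) (r : List γ) (c : List (β × γ)) :
      (l.foldl step (r, c)).2.reverse = c.reverse ++ l.zip r := by
    induction l generalizing r c with
    | nil => simp
    | cons b l ih => cases r <;> simp [step, ih]
  refine (foldl (i := fun x => (l' x, ([] : List (β × γ)))) (s := fun _ => step) hl (by fun_prop)
    hstep (.X + 1) fun x c b => ?_).snd.reverse.of_eq fun x => by simpa using hfold (l x) (l' x) []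
  obtain ⟨_ | ⟨a, t⟩, c⟩ := c <;>
  simp only [step, codeSize_prod, codeSize_cons, Polynomial.eval_add, Polynomial.eval_X,
    Polynomial.eval_one] <;>
  lia

@[fun_prop]
theorem zipIdx {l : α → List β} (hl : PolyTime l) : PolyTime fun x => (l x).zipIdx :=
  (hl.zip hl.range_length).of_eq fun x => by rw [List.zipIdx_eq_zip_range', List.range_eq_range']

@[fun_prop]
theorem decide_eq [DecidableEq β] [PolyTimeEq β] {f g : α → β} (hf : PolyTime f)
    (hg : PolyTime g) : PolyTime fun x => decide (f x = g x) :=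
  PolyTimeEq.decide_eq.comp (hf.prodMk hg)

@[fun_prop]
theorem decide_mem [DecidableEq β] [PolyTimeEq β] {f : α → β} {l : α → List β}
    [DecidablePred fun x => f x ∈ l x] (hf : PolyTime f) (hl : PolyTime l) :
    PolyTime fun x => decide (f x ∈ l x) :=
  (hl.any (p := fun x b => decide (f x = b)) (by fun_prop)).of_eq fun x => by
    rw [Bool.eq_iff_iff]; simp

@[fun_prop]
theorem dedup [DecidableEq β] [PolyTimeEq β] {l : α → List β} (hl : PolyTime l) :
    PolyTime fun x => (l x).dedup := by
  have hfoldr (l : List β) :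
      l.foldr (fun b c => if b ∈ c then c else b :: c) [] = l.dedup := by
    induction l with
    | nil => simp
    | cons b l ih => rw [List.foldr_cons, ih, List.dedup_cons']
  refine (foldr (i := fun _ => []) (s := fun _ b c => if b ∈ c then c else b :: c) hl
    (by fun_prop) (by fun_prop) (.X + 1) fun x c b => ?_).of_eq fun x => hfoldr (l x)
  split <;> simp only [codeSize_cons, Polynomial.eval_add, Polynomial.eval_X,
    Polynomial.eval_one] <;> lia

end PolyTime

instance : PolyTimeEq ℕ where
  decide_eq := (PolyTime.decide_eq_zero.comp (f := fun x : ℕ × ℕ => (x.1 - x.2) + (x.2 - x.1))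
    (by fun_prop)).of_eq fun x => by rw [decide_eq_decide]; lia

theorem PolyTimeEq.of_injective [DecidableEq β] {f : β → ℕ} (hf : f.Injective)
    (hcode : ∀ b, code (f b) = code b) : PolyTimeEq β where
  decide_eq :=
    have : PolyTime f := .of_code_eq hcode
    (by fun_prop : PolyTime fun x : β × β => decide (f x.1 = f x.2)).of_eq fun x => by
      rw [decide_eq_decide, hf.eq_iff]

instance : PolyTimeEq Colour :=
  .of_injective (f := fun | .black => 1 | .white => 2) (by intro x y; cases x <;> cases y <;> simp)
    fun c => by cases c <;> rfl

instance : PolyTimeEq (Option Colour) :=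
  .of_injective (f := fun | none => 0 | some .black => 1 | some .white => 2)
    (by rintro (_ | _ | _) (_ | _ | _) <;> simp) fun c => by rcases c with _ | _ | _ <;> rfl

instance [DecidableEq β] [PolyTimeEq β] : PolyTimeEq (List β) where
  decide_eq := by
    refine (by fun_prop : PolyTime fun x : List β × List β => decide (x.1.length = x.2.length) &&
      (x.1.zip x.2).all fun y => decide (y.1 = y.2)).of_eq fun ⟨l, r⟩ => ?_
    induction l generalizing r with
    | nil => cases r <;> simp
    | cons a l ih =>
      cases r with
      | nil => simp
      | cons b r => grind

namespace PolyTime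

@[fun_prop]
theorem getD_nil {l : α → List (List β)} {j : α → ℕ} (hl : PolyTime l) (hj : PolyTime j) :
    PolyTime fun x => (l x).getD (j x) [] := by
  have hget (l : List (List β)) (i j : ℕ) :
      ((l.zipIdx i).filter fun y => decide (y.2 = i + j)).flatMap Prod.fst = l.getD j [] := by
    induction l generalizing i j with
    | nil => simp
    | cons a l ih =>
      have hnone : ((l.zipIdx (i + 1)).filter fun y => decide (y.2 = i)) = [] :=
        List.filter_eq_nil_iff.2 fun y hy => by
          have := List.le_snd_of_mem_zipIdx hy
          simp only [decide_eq_true_eq]; lia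
      cases j with
      | zero => simp [hnone]
      | succ j => simpa [add_assoc, add_comm 1 j] using ih (i + 1) j
  exact (by fun_prop : PolyTime fun x =>
    ((l x).zipIdx.filter fun y => decide (y.2 = j x)).flatMap fun y => y.1).of_eq fun x => by
      simpa using hget (l x) 0 (j x)

@[fun_prop]
theorem toList {f : α → Option Colour} (hf : PolyTime f) : PolyTime fun x => (f x).toList :=
  (by fun_prop : PolyTime fun x => if f x = some .black then [Colour.black]
    else if f x = some .white then [Colour.white] else []).of_eq fun x => by
      rcases f x with _ | _ | _ <;> rfl

end PolyTime

end PolyTime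

/-- The number that represents an extended natural number in memory. -/
noncomputable def enatCode (a : ℕ∞) : ℕ := if a = ⊤ then 0 else a.toNat + 1

theorem code_enatCode (a : ℕ∞) : code (enatCode a) = code a := by
  simp only [enatCode, code, HPInstance.codeValue]
  split <;> rfl

theorem enatCode_natCast (a : ℕ) : enatCode (a : ℕ∞) = a + 1 := by simp [enatCode]

theorem enatCode_top : enatCode ⊤ = 0 := by simp [enatCode]

namespace PolyTime
variable {α : Type} [Coded α]

@[fun_prop]
theorem enat_code {f : α → ℕ∞} (hf : PolyTime f) : PolyTime fun x => enatCode (f x) :=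
  (of_code_eq code_enatCode : PolyTime enatCode).comp hf

theorem of_enatCode {f : α → ℕ∞} {g : α → ℕ} (hg : PolyTime g)
    (h : ∀ x, enatCode (f x) = g x) : PolyTime f :=
  hg.congr_code fun x => by rw [← h, code_enatCode]

@[fun_prop]
theorem natCast {f : α → ℕ} (hf : PolyTime f) : PolyTime fun x => (f x : ℕ∞) :=
  of_enatCode (g := fun x => f x + 1) (by fun_prop) fun x => enatCode_natCast (f x)

@[fun_prop]
theorem enat_add {f g : α → ℕ∞} (hf : PolyTime f) (hg : PolyTime g) :
    PolyTime fun x => f x + g x := by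
  refine of_enatCode (g := fun x => if enatCode (f x) = 0 then 0 else
    if enatCode (g x) = 0 then 0 else
      enatCode (f x) + enatCode (g x) - 1) (by fun_prop) fun x => ?_
  induction f x with
  | top => simp [enatCode_top]
  | coe a =>
    induction g x with
    | top => simp [enatCode_top]
    | coe b =>
      rw [← Nat.cast_add]
      simp only [enatCode_natCast, Nat.add_one_ne_zero, if_false]
      lia

@[fun_prop]
theorem enat_decide_le {f g : α → ℕ∞} (hf : PolyTime f) (hg : PolyTime g) :
    PolyTime fun x => decide (f x ≤ g x) := by
  refine (by fun_prop : PolyTime fun x => if enatCode (g x) = 0 then true else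
    if enatCode (f x) = 0 then false else
      decide (enatCode (f x) ≤ enatCode (g x))).of_eq fun x => ?_
  induction g x with
  | top => simp [enatCode_top]
  | coe b => induction f x with
    | top => simp [enatCode_top, enatCode_natCast]
    | coe a => simp [enatCode_natCast]

@[fun_prop]
theorem enat_min {f g : α → ℕ∞} (hf : PolyTime f) (hg : PolyTime g) :
    PolyTime fun x => min (f x) (g x) := by
  simp only [min_def]
  fun_prop

end PolyTime

section codeSize
variable {α : Type} [Coded α]

theorem codeSize_filter_add_filter_not (p : α → Bool) (l : List α) :
    codeSize (l.filter p) + codeSize (l.filter fun a => !p a) = codeSize l + 1 := by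
  induction l with
  | nil => simp [codeSize_nil]
  | cons a l ih => cases h : p a <;> simp [h, codeSize_cons] <;> lia

theorem codeSize_filter_le (p : α → Bool) (l : List α) : codeSize (l.filter p) ≤ codeSize l := by
  have := codeSize_filter_add_filter_not p l
  have := codeSize_pos (l.filter fun a => !p a)
  lia

theorem codeSize_flatten_le (l : List (List α)) : codeSize l.flatten ≤ codeSize l := by
  induction l with
  | nil => simp [codeSize_nil]
  | cons a l ih =>
    have := codeSize_append a l.flatten
    simp only [List.flatten_cons, codeSize_cons]
    lia

end codeSize

/-! ## The algorithm -/

namespace Painting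

/-- A row of the table of a hyperedge: the function of the hyperedge has the given value at the
given colours and argument. -/
structure TableRow where
  colours : List Colour
  arg : ℕ
  value : ℕ

/-- A hyperedge as the algorithm sees it. -/
structure EdgeData where
  vertices : List ℕ
  table : List TableRow

/-- The decoded form of `HPInstance.input`. -/
structure Input where
  k : ℕ
  b : ℕ
  d : ℕ
  q : ℕ
  n : ℕ
  m : ℕ
  precolouring : List (Option Colour)
  edges : List EdgeData

instance : Coded TableRow := ⟨fun r => .ofList [code r.colours, code r.arg, code r.value]⟩

instance : Coded EdgeData := ⟨fun e => .ofList [code e.vertices, code e.table]⟩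

instance : Coded Input :=
  ⟨fun x => .ofList [code x.k, code x.b, code x.d, code x.q, code x.n, code x.m,
    code x.precolouring, code x.edges]⟩

/-- A partial guess of the bichromatic patterns of the hyperedges, one entry per hyperedge;
`[]` means that nothing is guessed. -/
abbrev Labelling := List (List Colour)

/-- A function `ℕ → ℕ∞`, represented by finitely many upper bounds for its values. -/
abbrev CostList := List (ℕ × ℕ∞)

/-- The value at `μ` of the function represented by `u`. -/
noncomputable def costValue (u : CostList) (μ : ℕ) : ℕ∞ :=
  u.foldl (fun a x => if x.1 = μ then min a x.2 else a) ⊤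

/-- Min-plus convolution, at the arguments in `R`. -/
noncomputable def conv (R : List ℕ) (u v : CostList) : CostList :=
  R.map fun μ => (μ, costValue (u.flatMap fun x => v.map fun y => (x.1 + y.1, x.2 + y.2)) μ)

/-- Min-plus convolution of a family, at the arguments in `R`. -/
noncomputable def convAll (R : List ℕ) (us : List CostList) : CostList :=
  us.foldl (conv R) [(0, 0)]

/-- The values of a table at given colours. -/
noncomputable def tableCosts (table : List TableRow) (c : List Colour) : CostList :=
  (table.filter fun r => decide (r.colours = c)).map fun r => (r.arg, (r.value : ℕ∞))

/-- The colouring with colour `s` on `X` and `t` elsewhere. -/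
def twoColouring (s t : Colour) (X : List ℕ) (v : ℕ) : Colour := if v ∈ X then s else t

/-- The total costs of the hyperedges `es` under `twoColouring s t X`. -/
noncomputable def setCosts (R : List ℕ) (s t : Colour) (es : List EdgeData) (X : List ℕ) :
    CostList :=
  convAll R (es.map fun e => tableCosts e.table (e.vertices.map (twoColouring s t X)))

/-- Whether the two sets have a common element. -/
def meets (X Y : List ℕ) : Bool := X.any fun v => decide (v ∈ Y)

/-- One step of `subsetCosts`: the state consists of the hyperedges that no set has met so far and
of the costs of the others. -/
noncomputable def subsetStep (R : List ℕ) (s t : Colour) (state : List EdgeData × CostList)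
    (X : List ℕ) : List EdgeData × CostList :=
  (state.1.filter fun e => !meets X e.vertices,
    conv R state.2 (setCosts R s t (state.1.filter fun e => meets X e.vertices) X ++
      setCosts R s t (state.1.filter fun e => meets X e.vertices) []))

/-- The best total costs if each of the sets `Xs` may get colour `s` independently, and all other
vertices get colour `t`. -/
noncomputable def subsetCosts (R : List ℕ) (s t : Colour) (Xs : List (List ℕ))
    (es : List EdgeData) : CostList :=
  conv R (Xs.foldl (subsetStep R s t) (es, [(0, 0)])).2
    (setCosts R s t (Xs.foldl (subsetStep R s t) (es, [(0, 0)])).1 [])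

/-- The vertices of a labelled hyperedge whose label says `s`. -/
def inPart (s : Colour) (x : EdgeData × List Colour) : List ℕ :=
  ((x.1.vertices.zip x.2).filter fun y => decide (y.2 = s)).map fun y => y.1

/-- The vertices of a labelled hyperedge whose label does not say `s`. -/
def outPart (s : Colour) (x : EdgeData × List Colour) : List ℕ :=
  x.1.vertices.filter fun v => !decide (v ∈ inPart s x)

/-- Unite all clusters that meet `S`. -/
def merge (cl : List (List ℕ)) (S : List ℕ) : List (List ℕ) :=
  (cl.filter fun X => meets S X).flatten :: cl.filter fun X => !meets S X

/-- The connected components with respect to the unlabelled hyperedges. -/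
def components (verts : List ℕ) (le : List (EdgeData × List Colour)) : List (List ℕ) :=
  ((le.filter fun x => decide (x.2 = [])).map fun x => x.1.vertices).foldl merge
    (verts.map fun v => [v])

/-- The labelled hyperedges that are not contained in a single component. -/
def hardEdges (verts : List ℕ) (le : List (EdgeData × List Colour)) :
    List (EdgeData × List Colour) :=
  le.filter fun x => !decide (x.2 = []) &&
    !(components verts le).any fun X => x.1.vertices.all fun v => decide (v ∈ X)

/-- The coarser partition obtained by uniting the `s`-parts of the labelled hyperedges. -/
def clusters (s : Colour) (verts : List ℕ) (le : List (EdgeData × List Colour)) :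
    List (List ℕ) :=
  ((hardEdges verts le).map fun x => inPart s x).foldl merge (components verts le)

/-- The vertices that some label forbids to have colour `s`. -/
def forbidden (s : Colour) (verts : List ℕ) (le : List (EdgeData × List Colour)) : List ℕ :=
  (hardEdges verts le).flatMap fun x => outPart s x

/-- The clusters that may get colour `s` independently of each other. -/
def freeClusters (s : Colour) (verts : List ℕ) (le : List (EdgeData × List Colour)) :
    List (List ℕ) :=
  (clusters s verts le).filter fun X => !meets (forbidden s verts le) X

/-- The best total costs over the colourings suggested by a labelling, when `s` is the rare
colour. -/
noncomputable def labellingCosts (R : List ℕ) (s t : Colour) (verts : List ℕ) (es : List EdgeData)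
    (lab : Labelling) : CostList :=
  subsetCosts R s t (freeClusters s verts (es.zip lab)) es

/-- Whether both colours occur. -/
def bichromatic (c : List Colour) : Bool :=
  (c.any fun x => decide (x = .black)) && c.any fun x => decide (x = .white)

/-- The bichromatic colourings that occur in the table of a hyperedge. -/
def candidates (e : EdgeData) : List (List Colour) :=
  ((e.table.map TableRow.colours).filter bichromatic).dedup

/-- A member of maximal length. -/
def longest (ls : List (List (List Colour))) : List (List Colour) :=
  ls.foldl (fun acc l => if acc.length ≤ l.length then l else acc) []

/-- The arithmetic progression `r, r + p, …` of the same length as `l`. -/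
def progression (p r : ℕ) (l : List (List (List Colour))) : List ℕ :=
  (l.foldl (fun (c : ℕ × List ℕ) _ => (c.1 + p, c.1 :: c.2)) (r, [])).2

/-- The labelling that gives all hyperedges in a residue class their candidate number `j`. -/
def residueMask (cands : List (List (List Colour))) (p r j : ℕ) : Labelling :=
  cands.zipIdx.map fun x => if x.2 ∈ progression p r cands then x.1.getD j [] else []

/-- The entries of `a`, with those of `b` where `a` guesses nothing. -/
def overlay (a b : Labelling) : Labelling :=
  (a.zip b).map fun x => if x.1 = [] then x.2 else x.1

/-- The residue masks for all residue classes modulo numbers below the length of `U`. -/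
def residueMasks (cands : List (List (List Colour))) (U : List ℕ) : List Labelling :=
  (List.range U.length).flatMap fun p => (List.range U.length).flatMap fun r =>
    (List.range (longest cands).length).map fun j => residueMask cands p r j

/-- A list whose length is about the logarithm of the length of `l`. -/
def logList (l : List (List (List Colour))) : List ℕ :=
  (l.foldl (fun (c : ℕ × List ℕ) _ => if l.length ≤ c.1 then c else (c.1 + c.1, 0 :: c.2))
    (1, [])).2

/-- A list whose length bounds the moduli to be tried. Numbers are represented by the lengths of
lists because the machine cannot multiply. -/
def modulusList (K Q : List ℕ) (cands : List (List (List Colour))) : List ℕ :=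
  0 :: (((0 :: (K ++ Q)).flatMap fun _ => 0 :: logList cands) ++
    ((0 :: (K ++ Q)).flatMap fun _ => 0 :: logList cands))

/-- Add to `ms` the overlays of its members with those of `O`. -/
def extendMasks (O ms : List Labelling) : List Labelling :=
  ms ++ O.flatMap fun o => ms.map fun a => overlay o a

/-- The best total costs over all colourings suggested by the labellings `ms`. -/
noncomputable def bestCosts (R verts : List ℕ) (es : List EdgeData) (ms : List Labelling) :
    CostList :=
  ms.flatMap fun lab =>
    labellingCosts R .black .white verts es lab ++ labellingCosts R .white .black verts es lab

/-- A number, replaced by `∞` if it exceeds `k`. -/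
noncomputable def cap (k : ℕ) (a : ℕ∞) : ℕ∞ := if a ≤ k then a else ⊤

/-- A precoloured vertex is represented by an additional hyperedge. -/
def precolourEdges (col₀ : List (Option Colour)) : List EdgeData :=
  col₀.zipIdx.flatMap fun x => x.1.toList.map fun c => ⟨[x.2], [⟨[c], 0, 0⟩]⟩

namespace Input

/-- The hyperedges, including those that represent precoloured vertices. -/
def allEdges (x : Input) : List EdgeData := x.edges ++ precolourEdges x.precolouring

/-- The candidates for the labels of the hyperedges. -/
def cands (x : Input) : List (List (List Colour)) := x.allEdges.map candidates

/-- The number of residue masks to be overlaid. -/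
def depth (x : Input) : ℕ := if longest x.cands = [] then 0 else x.k

/-- The residue masks used for the labellings. -/
def basicMasks (x : Input) : List Labelling :=
  residueMasks x.cands (modulusList (List.range x.depth) (List.range x.q) x.cands)

/-- The labellings to be tried. -/
def masks (x : Input) : List Labelling :=
  (extendMasks x.basicMasks)^[x.depth] [x.cands.map fun _ => []]

/-- The values `w_0, …, w_b`. -/
noncomputable def algorithm (x : Input) : List ℕ∞ :=
  (List.range (x.b + 1)).map fun μ => cap x.k (costValue (bestCosts (List.range (x.b + 1))
    (List.range x.precolouring.length) x.allEdges x.masks) μ)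

end Input

/-! ## Running time in terms of the number of labellings -/

section PolyTime
variable {α : Type} [Coded α]

theorem polyTime_tableRow : PolyTime fun r : TableRow => (r.colours, r.arg, r.value, 0) :=
  .of_code_eq fun _ => rfl

@[fun_prop]
theorem polyTime_tableRow_colours : PolyTime TableRow.colours := polyTime_tableRow.fst

@[fun_prop]
theorem polyTime_tableRow_arg : PolyTime TableRow.arg := polyTime_tableRow.snd.fst

@[fun_prop]
theorem polyTime_tableRow_value : PolyTime TableRow.value := polyTime_tableRow.snd.snd.fst

theorem polyTime_edgeData : PolyTime fun e : EdgeData => (e.vertices, e.table, 0) :=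
  .of_code_eq fun _ => rfl

@[fun_prop]
theorem polyTime_edgeData_vertices : PolyTime EdgeData.vertices := polyTime_edgeData.fst

@[fun_prop]
theorem polyTime_edgeData_table : PolyTime EdgeData.table := polyTime_edgeData.snd.fst

@[fun_prop]
theorem polyTime_edgeData_mk {vs : α → List ℕ} {table : α → List TableRow} (hvs : PolyTime vs)
    (htable : PolyTime table) : PolyTime fun x => EdgeData.mk (vs x) (table x) :=
  (by fun_prop : PolyTime fun x => (vs x, table x, 0)).congr_code fun _ => rfl

@[fun_prop]
theorem polyTime_tableRow_mk {c : α → List Colour} {μ a : α → ℕ} (hc : PolyTime c)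
    (hμ : PolyTime μ) (ha : PolyTime a) : PolyTime fun x => TableRow.mk (c x) (μ x) (a x) :=
  (by fun_prop : PolyTime fun x => (c x, μ x, a x, 0)).congr_code fun _ => rfl

theorem polyTime_input : PolyTime fun x : Input =>
    (x.k, x.b, x.d, x.q, x.n, x.m, x.precolouring, x.edges, 0) :=
  .of_code_eq fun _ => rfl

@[fun_prop]
theorem polyTime_input_k : PolyTime Input.k := polyTime_input.fst

@[fun_prop]
theorem polyTime_input_b : PolyTime Input.b := polyTime_input.snd.fst

@[fun_prop]
theorem polyTime_input_q : PolyTime Input.q := polyTime_input.snd.snd.snd.fst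

@[fun_prop]
theorem polyTime_input_precolouring : PolyTime Input.precolouring :=
  polyTime_input.snd.snd.snd.snd.snd.snd.fst

@[fun_prop]
theorem polyTime_input_edges : PolyTime Input.edges :=
  polyTime_input.snd.snd.snd.snd.snd.snd.snd.fst

@[fun_prop]
theorem polyTime_costValue {u : α → CostList} {μ : α → ℕ} (hu : PolyTime u) (hμ : PolyTime μ) :
    PolyTime fun x => costValue (u x) (μ x) := by
  unfold costValue
  refine .foldl (i := fun _ => ⊤) (s := fun x a y => if y.1 = μ x then min a y.2 else a) hu
    (by fun_prop)
    (by fun_prop) 1 fun x c b => ?_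
  simp [codeSize_enat]

@[fun_prop]
theorem polyTime_conv {R : α → List ℕ} {u v : α → CostList} (hR : PolyTime R) (hu : PolyTime u)
    (hv : PolyTime v) : PolyTime fun x => conv (R x) (u x) (v x) := by
  unfold conv
  fun_prop

theorem codeSize_conv_le (R : List ℕ) (u v : CostList) :
    codeSize (conv R u v) ≤ 4 * codeSize R := by
  have hsize := codeSize_list_le (l := conv R u v) (c := 3) fun x _ => by
    rw [codeSize_prod, codeSize_nat, codeSize_enat]
  have hlength : (conv R u v).length = R.length := List.length_map _
  have := length_lt_codeSize R
  lia

@[fun_prop]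
theorem polyTime_convAll {R : α → List ℕ} {us : α → List CostList} (hR : PolyTime R)
    (hus : PolyTime us) : PolyTime fun x => convAll (R x) (us x) := by
  obtain ⟨Q, hQ⟩ := hR.exists_codeSize_le
  unfold convAll
  refine .foldl (s := fun x => conv (R x)) hus (by fun_prop) (by fun_prop) (4 * Q)
    fun x c b => ?_
  have := codeSize_conv_le (R x) c b
  have := (hQ x).trans (eval_nat_mono Q (Nat.le_add_right _ (codeSize b)))
  simp only [Polynomial.eval_mul, Polynomial.eval_ofNat]
  lia

@[fun_prop]
theorem polyTime_tableCosts {table : α → List TableRow} {c : α → List Colour}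
    (htable : PolyTime table) (hc : PolyTime c) : PolyTime fun x => tableCosts (table x) (c x) := by
  unfold tableCosts
  fun_prop

@[fun_prop]
theorem polyTime_twoColouring {s t : α → Colour} {X : α → List ℕ} {v : α → ℕ} (hs : PolyTime s)
    (ht : PolyTime t) (hX : PolyTime X) (hv : PolyTime v) :
    PolyTime fun x => twoColouring (s x) (t x) (X x) (v x) := by
  unfold twoColouring
  fun_prop

@[fun_prop]
theorem polyTime_setCosts {R : α → List ℕ} {s t : α → Colour} {es : α → List EdgeData}
    {X : α → List ℕ} (hR : PolyTime R) (hs : PolyTime s) (ht : PolyTime t) (hes : PolyTime es)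
    (hX : PolyTime X) : PolyTime fun x => setCosts (R x) (s x) (t x) (es x) (X x) := by
  unfold setCosts
  fun_prop

@[fun_prop]
theorem polyTime_meets {X Y : α → List ℕ} (hX : PolyTime X) (hY : PolyTime Y) :
    PolyTime fun x => meets (X x) (Y x) := by
  unfold meets
  fun_prop

@[fun_prop]
theorem polyTime_subsetStep {R : α → List ℕ} {s t : α → Colour}
    {state : α → List EdgeData × CostList} {X : α → List ℕ} (hR : PolyTime R) (hs : PolyTime s)
    (ht : PolyTime t) (hstate : PolyTime state) (hX : PolyTime X) :
    PolyTime fun x => subsetStep (R x) (s x) (t x) (state x) (X x) := by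
  unfold subsetStep
  fun_prop

theorem codeSize_subsetStep_le (R : List ℕ) (s t : Colour) (state : List EdgeData × CostList)
    (X : List ℕ) : codeSize (subsetStep R s t state X) ≤ codeSize state + 4 * codeSize R := by
  have := codeSize_filter_le (fun e : EdgeData => !meets X e.vertices) state.1
  have := codeSize_conv_le R state.2 (setCosts R s t (state.1.filter fun e => meets X e.vertices) X
    ++ setCosts R s t (state.1.filter fun e => meets X e.vertices) [])
  rw [subsetStep, codeSize_prod, codeSize_prod]
  lia

@[fun_prop]
theorem polyTime_subsetCosts {R : α → List ℕ} {s t : α → Colour} {Xs : α → List (List ℕ)}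
    {es : α → List EdgeData} (hR : PolyTime R) (hs : PolyTime s) (ht : PolyTime t)
    (hXs : PolyTime Xs) (hes : PolyTime es) :
    PolyTime fun x => subsetCosts (R x) (s x) (t x) (Xs x) (es x) := by
  obtain ⟨Q, hQ⟩ := hR.exists_codeSize_le
  have hfold : PolyTime fun x => (Xs x).foldl (subsetStep (R x) (s x) (t x)) (es x, [(0, 0)]) := by
    refine .foldl (s := fun x => subsetStep (R x) (s x) (t x)) hXs (by fun_prop) (by fun_prop)
      (4 * Q) fun x c b => (codeSize_subsetStep_le ..).trans ?_
    have := (hQ x).trans (eval_nat_mono Q (Nat.le_add_right _ (codeSize b)))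
    simp only [Polynomial.eval_mul, Polynomial.eval_ofNat]
    lia
  unfold subsetCosts
  fun_prop

@[fun_prop]
theorem polyTime_inPart {s : α → Colour} {y : α → EdgeData × List Colour} (hs : PolyTime s)
    (hy : PolyTime y) : PolyTime fun x => inPart (s x) (y x) := by
  unfold inPart
  fun_prop

@[fun_prop]
theorem polyTime_outPart {s : α → Colour} {y : α → EdgeData × List Colour} (hs : PolyTime s)
    (hy : PolyTime y) : PolyTime fun x => outPart (s x) (y x) := by
  unfold outPart
  fun_prop

theorem codeSize_merge_le (cl : List (List ℕ)) (S : List ℕ) :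
    codeSize (merge cl S) ≤ codeSize cl + 2 := by
  have := codeSize_filter_add_filter_not (fun X => meets S X) cl
  have := codeSize_flatten_le (cl.filter fun X => meets S X)
  rw [merge, codeSize_cons]
  lia

@[fun_prop]
theorem polyTime_foldl_merge {Ss cl : α → List (List ℕ)} (hSs : PolyTime Ss) (hcl : PolyTime cl) :
    PolyTime fun x => (Ss x).foldl merge (cl x) := by
  refine .foldl (s := fun _ => merge) hSs hcl ?_ 2 fun x c b => by simpa using codeSize_merge_le c b
  unfold merge
  fun_prop

@[fun_prop]
theorem polyTime_components {verts : α → List ℕ} {le : α → List (EdgeData × List Colour)}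
    (hverts : PolyTime verts) (hle : PolyTime le) :
    PolyTime fun x => components (verts x) (le x) := by
  unfold components
  fun_prop

@[fun_prop]
theorem polyTime_hardEdges {verts : α → List ℕ} {le : α → List (EdgeData × List Colour)}
    (hverts : PolyTime verts) (hle : PolyTime le) :
    PolyTime fun x => hardEdges (verts x) (le x) := by
  unfold hardEdges
  fun_prop

@[fun_prop]
theorem polyTime_freeClusters {s : α → Colour} {verts : α → List ℕ}
    {le : α → List (EdgeData × List Colour)} (hs : PolyTime s) (hverts : PolyTime verts)
    (hle : PolyTime le) : PolyTime fun x => freeClusters (s x) (verts x) (le x) := by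
  unfold freeClusters clusters forbidden
  fun_prop

@[fun_prop]
theorem polyTime_bestCosts {R verts : α → List ℕ} {es : α → List EdgeData}
    {ms : α → List Labelling} (hR : PolyTime R) (hverts : PolyTime verts) (hes : PolyTime es)
    (hms : PolyTime ms) : PolyTime fun x => bestCosts (R x) (verts x) (es x) (ms x) := by
  unfold bestCosts labellingCosts
  fun_prop

@[fun_prop]
theorem polyTime_bichromatic {c : α → List Colour} (hc : PolyTime c) :
    PolyTime fun x => bichromatic (c x) := by
  unfold bichromatic
  fun_prop

@[fun_prop]
theorem polyTime_candidates : PolyTime candidates := by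
  unfold candidates
  fun_prop

@[fun_prop]
theorem polyTime_longest {ls : α → List (List (List Colour))} (hls : PolyTime ls) :
    PolyTime fun x => longest (ls x) :=
  .foldl (i := fun _ => []) (s := fun _ (acc l : List (List Colour)) =>
    if acc.length ≤ l.length then l else acc) hls (by fun_prop) (by fun_prop) .X fun x c b => by
    split <;> simp only [Polynomial.eval_X] <;> lia

@[fun_prop]
theorem polyTime_progression {p r : α → ℕ} {l : α → List (List (List Colour))} (hp : PolyTime p)
    (hr : PolyTime r) (hl : PolyTime l) : PolyTime fun x => progression (p x) (r x) (l x) :=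
  .snd <| .foldl (i := fun x => (r x, []))
    (s := fun x (c : ℕ × List ℕ) _ => (c.1 + p x, c.1 :: c.2)) hl (by fun_prop) (by fun_prop)
    2 fun x c b => by
    simp only [codeSize_prod, codeSize_cons, codeSize_nat, Polynomial.eval_ofNat]
    lia

@[fun_prop]
theorem polyTime_residueMasks {cands : α → List (List (List Colour))} {U : α → List ℕ}
    (hcands : PolyTime cands) (hU : PolyTime U) :
    PolyTime fun x => residueMasks (cands x) (U x) := by
  unfold residueMasks residueMask
  fun_prop

@[fun_prop]
theorem polyTime_logList {l : α → List (List (List Colour))} (hl : PolyTime l) :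
    PolyTime fun x => logList (l x) :=
  .snd <| .foldl (i := fun _ => (1, [])) (s := fun x (c : ℕ × List ℕ) _ =>
    if (l x).length ≤ c.1 then c else (c.1 + c.1, 0 :: c.2)) hl (by fun_prop) (by fun_prop) 2
    fun x c b => by
    split <;> simp only [codeSize_prod, codeSize_cons, codeSize_nat, Polynomial.eval_ofNat] <;> lia

@[fun_prop]
theorem polyTime_modulusList {K Q : α → List ℕ} {cands : α → List (List (List Colour))}
    (hK : PolyTime K) (hQ : PolyTime Q) (hcands : PolyTime cands) :
    PolyTime fun x => modulusList (K x) (Q x) (cands x) := by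
  unfold modulusList
  fun_prop

@[fun_prop]
theorem polyTime_extendMasks {O ms : α → List Labelling} (hO : PolyTime O) (hms : PolyTime ms) :
    PolyTime fun x => extendMasks (O x) (ms x) := by
  unfold extendMasks overlay
  fun_prop

@[fun_prop]
theorem polyTime_cap {k : α → ℕ} {a : α → ℕ∞} (hk : PolyTime k) (ha : PolyTime a) :
    PolyTime fun x => cap (k x) (a x) := by
  unfold cap
  fun_prop

@[fun_prop]
theorem polyTime_allEdges : PolyTime Input.allEdges := by
  unfold Input.allEdges precolourEdges
  fun_prop

@[fun_prop]
theorem polyTime_cands : PolyTime Input.cands := by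
  unfold Input.cands
  fun_prop

@[fun_prop]
theorem polyTime_depth : PolyTime Input.depth := by
  unfold Input.depth
  fun_prop

end PolyTime

namespace Input

/-- A bound for the running time of the algorithm, up to a polynomial. -/
noncomputable def runningTime (x : Input) : ℕ :=
  codeSize x + (x.b + 1) + x.depth + x.q + codeSize x.masks

theorem polyTimeIn_runningTime {β : Type} [Coded β] {f : Input → β}
    (hf : PolyTime f) : PolyTimeIn runningTime f :=
  PolyTimeIn.mono hf fun x => by unfold runningTime; lia

theorem codeSize_le_codeSize_iterate_extendMasks (O ms : List Labelling) (N : ℕ) :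
    codeSize ms ≤ codeSize ((extendMasks O)^[N] ms) := by
  induction N generalizing ms with
  | zero => rfl
  | succ N ih =>
    refine le_trans ?_ (ih _)
    have := codeSize_append ms (O.flatMap fun o => ms.map fun a => overlay o a)
    have := codeSize_pos (O.flatMap fun o => ms.map fun a => overlay o a)
    simp only [extendMasks]
    lia

theorem polyTimeIn_range_depth : PolyTimeIn runningTime fun x : Input => List.range x.depth :=
  .range (polyTimeIn_runningTime polyTime_depth) fun x => by unfold runningTime; lia

theorem polyTimeIn_basicMasks : PolyTimeIn runningTime basicMasks := by
  have hq : PolyTimeIn runningTime fun x : Input => List.range x.q :=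
    .range (polyTimeIn_runningTime polyTime_input_q) fun x => by unfold runningTime; lia
  have hmasks : PolyTime fun x : (List ℕ × List ℕ) × List (List (List Colour)) =>
    residueMasks x.2 (modulusList x.1.1 x.1.2 x.2) := by fun_prop
  exact hmasks.comp_polyTimeIn
    ((polyTimeIn_range_depth.prodMk hq).prodMk (polyTimeIn_runningTime polyTime_cands))

theorem polyTimeIn_masks : PolyTimeIn runningTime masks := by
  have hfoldl : PolyTimeIn runningTime fun x : Input => (List.range x.depth).foldl
      (fun ms _ => extendMasks x.basicMasks ms) [x.cands.map fun _ => []] := by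
    refine .foldl_of_bounded (s := fun O ms _ => extendMasks O ms) polyTimeIn_basicMasks
      polyTimeIn_range_depth (polyTimeIn_runningTime (by fun_prop)) (by fun_prop) .X
      fun x l hl => ?_
    have hlength : l.length ≤ x.depth := by simpa using hl.length_le
    rw [List.foldl_const, Polynomial.eval_X, runningTime, masks, ← Nat.sub_add_cancel hlength,
      Function.iterate_add_apply]
    have := codeSize_le_codeSize_iterate_extendMasks x.basicMasks
      ((extendMasks x.basicMasks)^[l.length] [x.cands.map fun _ => []]) (x.depth - l.length)
    lia
  exact hfoldl.of_eq fun x => by rw [List.foldl_const, List.length_range, masks]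

theorem polyTimeIn_algorithm : PolyTimeIn runningTime algorithm := by
  have hR : PolyTimeIn runningTime fun x : Input => List.range (x.b + 1) :=
    .range (polyTimeIn_runningTime (by fun_prop)) fun x => by unfold runningTime; lia
  have hcosts : PolyTime fun x : Input × List ℕ × List Labelling => x.2.1.map fun μ =>
      cap x.1.k (costValue (bestCosts x.2.1 (List.range x.1.precolouring.length) x.1.allEdges x.2.2)
        μ) := by
    fun_prop
  exact (hcosts.comp_polyTimeIn
    ((polyTimeIn_runningTime .id).prodMk (hR.prodMk polyTimeIn_masks)) :)

end Input
/-! ## Min-plus power series and correctness of the dynamic programme -/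

open Tropical

/-- Formal power series over the min-plus semiring; multiplication is min-plus convolution. -/
abbrev Series := PowerSeries (Tropical ℕ∞)

/-- The generating series of a cost list. -/
noncomputable def costSeries (u : CostList) : Series :=
  (u.map fun x => PowerSeries.monomial x.1 (trop x.2)).sum

theorem costSeries_cons (x : ℕ × ℕ∞) (u : CostList) :
    costSeries (x :: u) = PowerSeries.monomial x.1 (trop x.2) + costSeries u := rfl

theorem costSeries_append (u v : CostList) :
    costSeries (u ++ v) = costSeries u + costSeries v := by
  simp [costSeries]

theorem costValue_cons (x : ℕ × ℕ∞) (u : CostList) (μ : ℕ) :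
    costValue (x :: u) μ = min (if x.1 = μ then x.2 else ⊤) (costValue u μ) := by
  have hfold (u : CostList) (a : ℕ∞) :
      u.foldl (fun a x => if x.1 = μ then min a x.2 else a) a = min a (costValue u μ) := by
    unfold costValue
    induction u generalizing a with
    | nil => simp
    | cons x u ih =>
      rw [List.foldl_cons, List.foldl_cons, ih, ih (if x.1 = μ then min ⊤ x.2 else ⊤)]
      split <;> simp [min_assoc]
  rw [costValue, List.foldl_cons, hfold]
  split <;> simp

theorem coeff_costSeries (u : CostList) (μ : ℕ) :
    (costSeries u).coeff μ = trop (costValue u μ) := by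
  induction u with
  | nil => simp [costSeries, costValue]
  | cons x u ih =>
    rw [costSeries_cons, costValue_cons, map_add, PowerSeries.coeff_monomial, ih, trop_min]
    rcases eq_or_ne x.1 μ with h | h
    · simp [h]
    · simp [h, h.symm]

theorem costValue_eq (u : CostList) (μ : ℕ) :
    costValue u μ = untrop ((costSeries u).coeff μ) := by
  rw [coeff_costSeries, untrop_trop]

theorem costValue_append (u v : CostList) (μ : ℕ) :
    costValue (u ++ v) μ = min (costValue u μ) (costValue v μ) := by
  rw [costValue_eq, costSeries_append, map_add, costValue_eq, costValue_eq, untrop_add]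

theorem costSeries_flatMap_add (u v : CostList) :
    costSeries (u.flatMap fun x => v.map fun y => (x.1 + y.1, x.2 + y.2)) =
      costSeries u * costSeries v := by
  have hmap (x : ℕ × ℕ∞) (v : CostList) : costSeries (v.map fun y => (x.1 + y.1, x.2 + y.2)) =
      PowerSeries.monomial x.1 (trop x.2) * costSeries v := by
    induction v with
    | nil => simp [costSeries]
    | cons y v ih =>
      rw [List.map_cons, costSeries_cons, ih, costSeries_cons, mul_add,
        PowerSeries.monomial_mul_monomial, trop_add]
  induction u with
  | nil => simp [costSeries]
  | cons x u ih => rw [List.flatMap_cons, costSeries_append, ih, hmap, costSeries_cons, add_mul]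

theorem costSeries_unit : costSeries [(0, 0)] = 1 := by
  rw [costSeries_cons, PowerSeries.monomial_zero_eq_C_apply,
    show trop (0 : ℕ∞) = 1 from rfl, map_one]
  exact add_zero _

/-- Equality of the coefficients up to `b`. -/
def Agree (b : ℕ) (f g : Series) : Prop := ∀ μ ≤ b, f.coeff μ = g.coeff μ

namespace Agree
variable {b : ℕ} {f g h f' g' : Series}

theorem of_eq (h : f = g) : Agree b f g := fun _ _ => by rw [h]

theorem refl (b : ℕ) (f : Series) : Agree b f f := .of_eq rfl

theorem trans (hfg : Agree b f g) (hgh : Agree b g h) : Agree b f h :=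
  fun μ hμ => (hfg μ hμ).trans (hgh μ hμ)

theorem mul (hf : Agree b f f') (hg : Agree b g g') : Agree b (f * g) (f' * g') := fun μ hμ => by
  rw [PowerSeries.coeff_mul, PowerSeries.coeff_mul]
  refine Finset.sum_congr rfl fun x hx => ?_
  rw [Finset.HasAntidiagonal.mem_antidiagonal] at hx
  rw [hf _ (by lia), hg _ (by lia)]

theorem add (hf : Agree b f f') (hg : Agree b g g') : Agree b (f + g) (f' + g') := fun μ hμ => by
  rw [map_add, map_add, hf μ hμ, hg μ hμ]

end Agree

theorem agree_conv (b : ℕ) (u v : CostList) :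
    Agree b (costSeries (conv (List.range (b + 1)) u v)) (costSeries u * costSeries v) := by
  intro μ hμ
  have hvalue (R : List ℕ) (w : CostList) : costValue (R.map fun μ => (μ, costValue w μ)) μ =
      if μ ∈ R then costValue w μ else ⊤ := by
    induction R with
    | nil => rfl
    | cons a R ih =>
      rw [List.map_cons, costValue_cons, ih]
      rcases eq_or_ne a μ with rfl | h
      · by_cases h' : a ∈ R <;> simp [h']
      · by_cases h' : μ ∈ R <;> simp [h, h', h.symm]
  rw [← costSeries_flatMap_add, coeff_costSeries, coeff_costSeries, conv, hvalue,
    if_pos (List.mem_range.2 (Nat.lt_succ_of_le hμ))]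

theorem agree_convAll (b : ℕ) (us : List CostList) :
    Agree b (costSeries (convAll (List.range (b + 1)) us)) (us.map costSeries).prod := by
  have hfold (us : List CostList) (u : CostList) :
      Agree b (costSeries (us.foldl (conv (List.range (b + 1))) u))
        (costSeries u * (us.map costSeries).prod) := by
    induction us generalizing u with
    | nil => simpa using Agree.refl b _
    | cons v us ih =>
      rw [List.foldl_cons, List.map_cons, List.prod_cons, ← mul_assoc]
      exact (ih _).trans ((agree_conv b u v).mul (.refl b _))
  refine (hfold us _).trans (.of_eq ?_)
  rw [costSeries_unit, one_mul]

/-- The costs of a hyperedge at given colours. -/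
noncomputable def edgeSeries (e : EdgeData) (c : List Colour) : Series :=
  costSeries (tableCosts e.table c)

/-- The total costs of a colouring. -/
noncomputable def totalSeries (es : List EdgeData) (col : ℕ → Colour) : Series :=
  (es.map fun e => edgeSeries e (e.vertices.map col)).prod

theorem agree_setCosts (b : ℕ) (s t : Colour) (es : List EdgeData) (X : List ℕ) :
    Agree b (costSeries (setCosts (List.range (b + 1)) s t es X))
      (totalSeries es (twoColouring s t X)) := by
  refine (agree_convAll b _).trans (.of_eq ?_)
  rw [List.map_map]
  rfl

theorem totalSeries_congr {es : List EdgeData} {c₁ c₂ : ℕ → Colour}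
    (h : ∀ e ∈ es, ∀ v ∈ e.vertices, c₁ v = c₂ v) : totalSeries es c₁ = totalSeries es c₂ :=
  congrArg List.prod (List.map_congr_left fun e he => by rw [List.map_congr_left (h e he)])

theorem totalSeries_filter_mul (p : EdgeData → Bool) {es : List EdgeData} {c₁ c₂ c : ℕ → Colour}
    (h₁ : ∀ e ∈ es, p e = true → ∀ v ∈ e.vertices, c₁ v = c v)
    (h₂ : ∀ e ∈ es, p e = false → ∀ v ∈ e.vertices, c₂ v = c v) :
    totalSeries (es.filter p) c₁ * totalSeries (es.filter fun e => !p e) c₂ =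
      totalSeries es c := by
  have hcons (e : EdgeData) (l : List EdgeData) (c : ℕ → Colour) :
      totalSeries (e :: l) c = edgeSeries e (e.vertices.map c) * totalSeries l c := by
    simp [totalSeries]
  induction es with
  | nil => simp [totalSeries]
  | cons e es ih =>
    rw [List.forall_mem_cons] at h₁ h₂
    rw [hcons, ← ih h₁.2 h₂.2]
    cases hp : p e
    · simp only [List.filter_cons, hp, Bool.not_false, if_true, Bool.false_eq_true, if_false,
        hcons, List.map_congr_left (h₂.1 hp)]
      ring
    · simp only [List.filter_cons, hp, Bool.not_true, if_true, Bool.false_eq_true, if_false,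
        hcons, List.map_congr_left (h₁.1 hp)]
      ring

theorem meets_iff {X Y : List ℕ} : meets X Y = true ↔ ∃ v ∈ X, v ∈ Y := by simp [meets]

/-- No hyperedge meets two different sets of the family. -/
def Separated (Xs : List (List ℕ)) (es : List EdgeData) : Prop :=
  Xs.Pairwise fun X Y => ∀ e ∈ es, ¬(meets X e.vertices = true ∧ meets Y e.vertices = true)

theorem totalSeries_twoColouring_mul (s t : Colour) {X T : List ℕ} {es : List EdgeData}
    (h : ∀ e ∈ es, meets X e.vertices = true → ∀ v ∈ e.vertices, v ∉ T) :
    (totalSeries (es.filter fun e => meets X e.vertices) (twoColouring s t X) +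
        totalSeries (es.filter fun e => meets X e.vertices) (twoColouring s t [])) *
      totalSeries (es.filter fun e => !meets X e.vertices) (twoColouring s t T) =
      totalSeries es (twoColouring s t (X ++ T)) + totalSeries es (twoColouring s t T) := by
  rw [add_mul]
  congr 1
  · refine totalSeries_filter_mul _ (fun e he hX v hv => ?_) fun e _ hX v hv => ?_
    · simp [twoColouring, h e he hX v hv]
    · have hvX : v ∉ X := fun hvX => by simp [meets_iff.2 ⟨v, hvX, hv⟩] at hX
      simp [twoColouring, hvX]
  · refine totalSeries_filter_mul _ (fun e he hX v hv => ?_) fun _ _ _ _ _ => rfl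
    simp [twoColouring, h e he hX v hv]

theorem agree_foldl_subsetStep (b : ℕ) (s t : Colour) {Xs : List (List ℕ)} {es : List EdgeData}
    (u : CostList) (h : Separated Xs es) :
    Agree b (costSeries (conv (List.range (b + 1))
        (Xs.foldl (subsetStep (List.range (b + 1)) s t) (es, u)).2
        (setCosts (List.range (b + 1)) s t
          (Xs.foldl (subsetStep (List.range (b + 1)) s t) (es, u)).1 [])))
      (costSeries u *
        (Xs.sublists'.map fun T => totalSeries es (twoColouring s t T.flatten)).sum) := by
  induction Xs generalizing es u with
  | nil => simpa using (agree_conv b u _).trans ((Agree.refl b _).mul (agree_setCosts b s t es []))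
  | cons X Xs ih =>
    obtain ⟨hX, hXs⟩ := List.pairwise_cons.1 h
    have hstep (S : List EdgeData) : Agree b (costSeries (conv (List.range (b + 1)) u
        (setCosts (List.range (b + 1)) s t S X ++ setCosts (List.range (b + 1)) s t S [])))
        (costSeries u * (totalSeries S (twoColouring s t X) +
          totalSeries S (twoColouring s t []))) :=
      (agree_conv b _ _).trans <| (Agree.refl b _).mul <|
        (Agree.of_eq (costSeries_append _ _)).trans
          ((agree_setCosts b s t _ _).add (agree_setCosts b s t _ _))
    refine (ih _ (hXs.imp fun h e he => h e (List.mem_of_mem_filter he))).trans <|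
      ((hstep _).mul (.refl b _)).trans (.of_eq ?_)
    rw [mul_assoc, ← List.sum_map_mul_left, List.sublists'_cons, List.map_append, List.sum_append,
      List.map_map, add_comm (List.sum _), ← List.sum_map_add]
    congr 2
    refine List.map_congr_left fun T hT => totalSeries_twoColouring_mul s t
      fun e he hXe v hv hvT => ?_
    obtain ⟨Y, hY, hvY⟩ := List.mem_flatten.1 hvT
    exact hX Y ((List.mem_sublists'.1 hT).subset hY) e he ⟨hXe, meets_iff.2 ⟨v, hvY, hv⟩⟩

theorem agree_subsetCosts (b : ℕ) (s t : Colour) {Xs : List (List ℕ)} {es : List EdgeData}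
    (h : Separated Xs es) : Agree b (costSeries (subsetCosts (List.range (b + 1)) s t Xs es))
      (Xs.sublists'.map fun T => totalSeries es (twoColouring s t T.flatten)).sum := by
  refine (agree_foldl_subsetStep b s t [(0, 0)] h).trans (.of_eq ?_)
  rw [costSeries_unit, one_mul]

theorem untrop_coeff_sum_le {ι : Type} {l : List ι} (f : ι → Series) (μ : ℕ) {i : ι} (hi : i ∈ l) :
    untrop ((l.map f).sum.coeff μ) ≤ untrop ((f i).coeff μ) := by
  induction l with
  | nil => simp at hi
  | cons a l ih =>
    rw [List.map_cons, List.sum_cons, map_add, untrop_add]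
    rcases List.mem_cons.1 hi with rfl | hi
    · exact min_le_left _ _
    · exact (min_le_right _ _).trans (ih hi)

theorem exists_untrop_coeff_sum {ι : Type} {l : List ι} (f : ι → Series) (μ : ℕ) (hl : l ≠ []) :
    ∃ i ∈ l, untrop ((l.map f).sum.coeff μ) = untrop ((f i).coeff μ) := by
  induction l with
  | nil => exact absurd rfl hl
  | cons a l ih =>
    rw [List.map_cons, List.sum_cons, map_add, untrop_add]
    rcases eq_or_ne l [] with rfl | h
    · exact ⟨a, by simp, by simp⟩
    · obtain ⟨i, hi, h⟩ := ih h
      rcases min_choice (untrop ((f a).coeff μ)) (untrop ((l.map f).sum.coeff μ)) with h' | h'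
      · exact ⟨a, by simp, h'⟩
      · exact ⟨i, by simp [hi], h'.trans h⟩

/-- The total cost of a colouring at argument `μ`. -/
noncomputable def costAt (es : List EdgeData) (col : ℕ → Colour) (μ : ℕ) : ℕ∞ :=
  untrop ((totalSeries es col).coeff μ)

section subsetCosts
variable {b μ : ℕ} {s t : Colour} {Xs T : List (List ℕ)} {es : List EdgeData}

theorem exists_costAt_eq_subsetCosts (h : Separated Xs es) (hμ : μ ≤ b) :
    ∃ col, costValue (subsetCosts (List.range (b + 1)) s t Xs es) μ = costAt es col μ := by
  obtain ⟨T, -, hT⟩ := exists_untrop_coeff_sum (l := Xs.sublists')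
    (fun T => totalSeries es (twoColouring s t T.flatten)) μ
    (List.ne_nil_of_mem (List.mem_sublists'.2 (List.nil_sublist Xs)))
  refine ⟨twoColouring s t T.flatten, ?_⟩
  rw [costValue_eq, agree_subsetCosts b s t h μ hμ, hT, costAt]

theorem subsetCosts_le_costAt (h : Separated Xs es) (hμ : μ ≤ b) (hT : T.Sublist Xs) :
    costValue (subsetCosts (List.range (b + 1)) s t Xs es) μ ≤
      costAt es (twoColouring s t T.flatten) μ := by
  rw [costValue_eq, agree_subsetCosts b s t h μ hμ, costAt]
  exact untrop_coeff_sum_le (l := Xs.sublists')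
    (fun T => totalSeries es (twoColouring s t T.flatten)) μ (List.mem_sublists'.2 hT)

end subsetCosts

/-! ## Clusters -/

/-- Some set of the family contains `v`. -/
def Covers (cl : List (List ℕ)) (v : ℕ) : Prop := ∃ X ∈ cl, v ∈ X

/-- The colouring is constant on the set. -/
def Monochromatic (col : ℕ → Colour) (X : List ℕ) : Prop := ∀ u ∈ X, ∀ v ∈ X, col u = col v

section merge
variable {cl Ss : List (List ℕ)} {S X Y : List ℕ} {v : ℕ} {col : ℕ → Colour}

theorem eq_of_mem_of_mem_disjoint (h : cl.Pairwise List.Disjoint) (hX : X ∈ cl) (hY : Y ∈ cl)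
    (hvX : v ∈ X) (hvY : v ∈ Y) : X = Y := by
  by_contra hne
  have : Std.Symm (List.Disjoint (α := ℕ)) := ⟨fun _ _ => List.Disjoint.symm⟩
  exact h.forall hX hY hne hvX hvY

theorem exists_mem_merge_superset (S : List ℕ) (hX : X ∈ cl) : ∃ Y ∈ merge cl S, X ⊆ Y := by
  by_cases h : meets S X = true
  · exact ⟨_, List.mem_cons_self, fun v hv =>
      List.mem_flatten.2 ⟨X, List.mem_filter.2 ⟨hX, h⟩, hv⟩⟩
  · exact ⟨X, List.mem_cons_of_mem _ (List.mem_filter.2 ⟨hX, by simpa using h⟩), fun _ h => h⟩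

theorem exists_mem_merge_of_covers (hS : ∀ v ∈ S, Covers cl v) : ∃ Y ∈ merge cl S, S ⊆ Y := by
  refine ⟨_, List.mem_cons_self, fun v hv => ?_⟩
  obtain ⟨X, hX, hvX⟩ := hS v hv
  exact List.mem_flatten.2 ⟨X, List.mem_filter.2 ⟨hX, meets_iff.2 ⟨v, hv, hvX⟩⟩, hvX⟩

theorem pairwise_disjoint_merge (h : cl.Pairwise List.Disjoint) (S : List ℕ) :
    (merge cl S).Pairwise List.Disjoint := by
  refine List.pairwise_cons.2 ⟨fun Y hY v hv hvY => ?_, h.filter _⟩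
  obtain ⟨X, hX, hvX⟩ := List.mem_flatten.1 hv
  rw [List.mem_filter] at hX hY
  obtain rfl := eq_of_mem_of_mem_disjoint h hX.1 hY.1 hvX hvY
  simp [hX.2] at hY

theorem monochromatic_merge (h : ∀ X ∈ cl, Monochromatic col X) (hS : Monochromatic col S) :
    ∀ X ∈ merge cl S, Monochromatic col X := by
  intro X hX
  rcases List.mem_cons.1 hX with rfl | hX
  · have exists_mem_eq (u) (hu : u ∈ (cl.filter fun X => meets S X).flatten) :
        ∃ w ∈ S, col u = col w := by
      obtain ⟨Y, hY, huY⟩ := List.mem_flatten.1 hu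
      rw [List.mem_filter, meets_iff] at hY
      obtain ⟨hY, w, hw, hwY⟩ := hY
      exact ⟨w, hw, h Y hY u huY w hwY⟩
    intro u hu v hv
    obtain ⟨w, hw, huw⟩ := exists_mem_eq u hu
    obtain ⟨w', hw', hvw'⟩ := exists_mem_eq v hv
    rw [huw, hvw', hS w hw w' hw']
  · exact h X (List.mem_of_mem_filter hX)

theorem exists_mem_foldl_merge_superset (Ss : List (List ℕ)) (hX : X ∈ cl) :
    ∃ Y ∈ Ss.foldl merge cl, X ⊆ Y := by
  induction Ss generalizing cl X with
  | nil => exact ⟨X, hX, fun _ h => h⟩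
  | cons S Ss ih =>
    obtain ⟨Y, hY, hXY⟩ := exists_mem_merge_superset S hX
    obtain ⟨Z, hZ, hYZ⟩ := ih hY
    exact ⟨Z, hZ, fun v hv => hYZ (hXY hv)⟩

theorem Covers.foldl_merge (h : Covers cl v) (Ss : List (List ℕ)) :
    Covers (Ss.foldl Painting.merge cl) v := by
  obtain ⟨X, hX, hv⟩ := h
  obtain ⟨Y, hY, hXY⟩ := exists_mem_foldl_merge_superset Ss hX
  exact ⟨Y, hY, hXY hv⟩

theorem exists_mem_foldl_merge_of_covers (h : S ∈ Ss) (hS : ∀ v ∈ S, Covers cl v) :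
    ∃ Y ∈ Ss.foldl merge cl, S ⊆ Y := by
  induction Ss generalizing cl with
  | nil => simp at h
  | cons S' Ss ih =>
    rcases List.mem_cons.1 h with rfl | h
    · obtain ⟨Y, hY, hSY⟩ := exists_mem_merge_of_covers hS
      obtain ⟨Z, hZ, hYZ⟩ := exists_mem_foldl_merge_superset Ss hY
      exact ⟨Z, hZ, fun v hv => hYZ (hSY hv)⟩
    · exact ih h fun v hv => (hS v hv).foldl_merge [S']

theorem pairwise_disjoint_foldl_merge (Ss : List (List ℕ)) (h : cl.Pairwise List.Disjoint) :
    (Ss.foldl merge cl).Pairwise List.Disjoint := by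
  induction Ss generalizing cl with
  | nil => exact h
  | cons S _ ih => exact ih (pairwise_disjoint_merge h S)

theorem monochromatic_foldl_merge (h : ∀ X ∈ cl, Monochromatic col X)
    (hS : ∀ S ∈ Ss, Monochromatic col S) : ∀ X ∈ Ss.foldl merge cl, Monochromatic col X := by
  induction Ss generalizing cl with
  | nil => exact h
  | cons S Ss ih =>
    rw [List.forall_mem_cons] at hS
    exact ih (monochromatic_merge h hS.1) hS.2

end merge

section clusters
variable {verts : List ℕ} {s t : Colour} {le : List (EdgeData × List Colour)}
  {x : EdgeData × List Colour} {col : ℕ → Colour} {v : ℕ}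

theorem pairwise_disjoint_components (hverts : verts.Nodup) :
    (components verts le).Pairwise List.Disjoint :=
  pairwise_disjoint_foldl_merge _ (List.pairwise_map.2 (hverts.imp fun h => by simpa using h.symm))

theorem pairwise_disjoint_clusters (hverts : verts.Nodup) :
    (clusters s verts le).Pairwise List.Disjoint :=
  pairwise_disjoint_foldl_merge _ (pairwise_disjoint_components hverts)

theorem covers_singletons (hv : v ∈ verts) : Covers (verts.map fun v => [v]) v :=
  ⟨[v], List.mem_map.2 ⟨v, hv, rfl⟩, List.mem_singleton.2 rfl⟩

theorem covers_components (hv : v ∈ verts) : Covers (components verts le) v :=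
  (covers_singletons hv).foldl_merge _

theorem covers_clusters (hv : v ∈ verts) : Covers (clusters s verts le) v :=
  (covers_components hv).foldl_merge _

theorem exists_mem_components_of_unlabelled (hx : x ∈ le) (hverts : x.1.vertices ⊆ verts)
    (h : x.2 = []) : ∃ X ∈ components verts le, x.1.vertices ⊆ X :=
  exists_mem_foldl_merge_of_covers
    (List.mem_map.2 ⟨x, List.mem_filter.2 ⟨hx, by simpa using h⟩, rfl⟩)
    fun _ hv => covers_singletons (hverts hv)

theorem exists_mem_components_of_notMem_hardEdges (hx : x ∈ le) (hverts : x.1.vertices ⊆ verts)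
    (h : x ∉ hardEdges verts le) : ∃ X ∈ components verts le, x.1.vertices ⊆ X := by
  by_cases h0 : x.2 = []
  · exact exists_mem_components_of_unlabelled hx hverts h0
  · by_contra! hnot
    refine h (List.mem_filter.2 ⟨hx, ?_⟩)
    simpa [h0, List.subset_def] using hnot

theorem mem_vertices_of_mem_inPart (h : v ∈ inPart s x) : v ∈ x.1.vertices := by
  obtain ⟨y, hy, rfl⟩ := List.mem_map.1 h
  exact (List.of_mem_zip (List.mem_of_mem_filter hy)).1

theorem exists_mem_clusters (hx : x ∈ le) (hverts : x.1.vertices ⊆ verts) :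
    ∃ Y ∈ clusters s verts le, ∀ v ∈ x.1.vertices, v ∈ Y ∨ v ∈ forbidden s verts le := by
  by_cases h : x ∈ hardEdges verts le
  · obtain ⟨Y, hY, hxY⟩ := exists_mem_foldl_merge_of_covers (S := inPart s x)
      (List.mem_map.2 ⟨x, h, rfl⟩) fun v hv =>
        covers_components (le := le) (hverts (mem_vertices_of_mem_inPart hv))
    refine ⟨Y, hY, fun v hv => ?_⟩
    by_cases hvs : v ∈ inPart s x
    · exact .inl (hxY hvs)
    · exact .inr (List.mem_flatMap.2 ⟨x, h, List.mem_filter.2 ⟨hv, by simpa using hvs⟩⟩)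
  · obtain ⟨X, hX, hxX⟩ := exists_mem_components_of_notMem_hardEdges hx hverts h
    obtain ⟨Y, hY, hXY⟩ := exists_mem_foldl_merge_superset
      ((hardEdges verts le).map fun x => inPart s x) hX
    exact ⟨Y, hY, fun v hv => .inl (hXY (hxX hv))⟩

theorem mem_freeClusters {X : List ℕ} : X ∈ freeClusters s verts le ↔
    X ∈ clusters s verts le ∧ ∀ v ∈ forbidden s verts le, v ∉ X := by
  simp [freeClusters, meets]

theorem separated_freeClusters {es : List EdgeData} {lab : Labelling}
    (hlab : lab.length = es.length) (hverts : verts.Nodup)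
    (hes : ∀ e ∈ es, e.vertices ⊆ verts) :
    Separated (freeClusters s verts (es.zip lab)) es := by
  have hdisj : (clusters s verts (es.zip lab)).Pairwise List.Disjoint :=
    pairwise_disjoint_clusters hverts
  refine (hdisj.filter _).imp_of_mem fun {X Y} hX hY hXY e he ⟨hXe, hYe⟩ => ?_
  obtain ⟨i, hi, rfl⟩ := List.mem_iff_getElem.1 he
  have hx : (es[i], lab[i]'(by lia)) ∈ es.zip lab :=
    List.mem_iff_getElem.2 ⟨i, by simp; lia, by simp⟩
  obtain ⟨Z, hZ, hcover⟩ := exists_mem_clusters (s := s) hx (hes _ he)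
  have eq_cluster (X) (hX : X ∈ freeClusters s verts (es.zip lab))
      (hXe : meets X es[i].vertices = true) : X = Z := by
    obtain ⟨hX, hfree⟩ := mem_freeClusters.1 hX
    obtain ⟨v, hvX, hv⟩ := meets_iff.1 hXe
    exact eq_of_mem_of_mem_disjoint hdisj hX hZ hvX
      ((hcover v hv).resolve_right fun h => hfree v h hvX)
  obtain ⟨v, hv, -⟩ := meets_iff.1 hXe
  exact hXY hv (by rwa [eq_cluster Y hY hYe, ← eq_cluster X hX hXe])

/-- The labels describe the colouring `col`, with rare colour `s`: unlabelled hyperedges are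
monochromatic, and a relevant label is correct unless `s` does not occur. -/
structure Describes (s : Colour) (verts : List ℕ) (le : List (EdgeData × List Colour))
    (col : ℕ → Colour) : Prop where
  unlabelled : ∀ x ∈ le, x.2 = [] → Monochromatic col x.1.vertices
  labelled : ∀ x ∈ hardEdges verts le,
    x.2 = x.1.vertices.map col ∨ ∀ v ∈ x.1.vertices, col v ≠ s

theorem mem_inPart_iff (hx : x.2 = x.1.vertices.map col) :
    v ∈ inPart s x ↔ v ∈ x.1.vertices ∧ col v = s := by
  have hzip (l : List ℕ) : l.zip (l.map col) = l.map fun v => (v, col v) := by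
    simpa using List.zip_map' (f := id) (g := col) (l := l)
  rw [inPart, hx, hzip]
  simp [List.filter_map]

theorem Describes.monochromatic_of_mem_clusters (h : Describes s verts le col)
    (hst : ∀ c, c ≠ s ↔ c = t) : ∀ X ∈ clusters s verts le, Monochromatic col X := by
  refine monochromatic_foldl_merge (monochromatic_foldl_merge ?_ ?_) ?_
  · intro X hX
    obtain ⟨w, -, rfl⟩ := List.mem_map.1 hX
    intro u hu v hv
    rw [List.mem_singleton.1 hu, List.mem_singleton.1 hv]
  · intro X hX
    obtain ⟨x, hx, rfl⟩ := List.mem_map.1 hX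
    rw [List.mem_filter] at hx
    exact h.unlabelled x hx.1 (by simpa using hx.2)
  · intro X hX u hu v hv
    obtain ⟨x, hx, rfl⟩ := List.mem_map.1 hX
    rcases h.labelled x hx with h | h
    · rw [((mem_inPart_iff h).1 hu).2, ((mem_inPart_iff h).1 hv).2]
    · rw [(hst _).1 (h u (mem_vertices_of_mem_inPart hu)),
        (hst _).1 (h v (mem_vertices_of_mem_inPart hv))]

theorem Describes.ne_of_mem_forbidden (h : Describes s verts le col)
    (hv : v ∈ forbidden s verts le) : col v ≠ s := by
  obtain ⟨x, hx, hv⟩ := List.mem_flatMap.1 hv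
  obtain ⟨hv, hv'⟩ := List.mem_filter.1 hv
  rcases h.labelled x hx with h | h
  · rintro hs
    simp [(mem_inPart_iff h).2 ⟨hv, hs⟩] at hv'
  · exact h v hv

theorem Describes.exists_sublist_freeClusters (h : Describes s verts le col)
    (hst : ∀ c, c ≠ s ↔ c = t) :
    ∃ T : List (List ℕ), T.Sublist (freeClusters s verts le) ∧
      ∀ v ∈ verts, twoColouring s t T.flatten v = col v := by
  have hmono := h.monochromatic_of_mem_clusters hst
  refine ⟨(freeClusters s verts le).filter fun X => X.all fun v => decide (col v = s),
    List.filter_sublist, fun v hv => ?_⟩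
  rw [twoColouring]
  split_ifs with hT
  · obtain ⟨X, hX, hvX⟩ := List.mem_flatten.1 hT
    exact (of_decide_eq_true (List.all_eq_true.1 (List.mem_filter.1 hX).2 v hvX)).symm
  · refine ((hst _).1 fun hvs => hT ?_).symm
    obtain ⟨Y, hY, hvY⟩ := covers_clusters (s := s) (le := le) hv
    have hYs : ∀ u ∈ Y, col u = s := fun u hu => (hmono Y hY u hu v hvY).trans hvs
    refine List.mem_flatten.2 ⟨Y, List.mem_filter.2 ⟨mem_freeClusters.2 ⟨hY, fun u hu huY =>
      h.ne_of_mem_forbidden hu (hYs u huY)⟩, ?_⟩, hvY⟩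
    exact List.all_eq_true.2 fun u hu => decide_eq_true (hYs u hu)

end clusters

/-! ## Spanning subfamilies -/

theorem exists_subset_card_le_finrank_sup {ι K V : Type*} [DivisionRing K]
    [AddCommGroup V] [Module K V] (M : Finset ι) (U : ι → Submodule K V)
    [∀ i, FiniteDimensional K (U i)] :
    ∃ S ⊆ M, S.card ≤ Module.finrank K (S.sup U : Submodule K V) ∧ S.sup U = M.sup U := by
  classical
  induction M using Finset.induction_on with
  | empty => exact ⟨∅, by simp⟩
  | insert a M _ ih =>
    obtain ⟨S, hSM, hcard, hsup⟩ := ih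
    by_cases h : U a ≤ S.sup U
    · exact ⟨S, hSM.trans (Finset.subset_insert _ _), hcard, by
        rw [Finset.sup_insert, ← hsup, sup_eq_right.2 h]⟩
    · refine ⟨insert a S, Finset.insert_subset_insert a hSM, ?_, by
        rw [Finset.sup_insert, Finset.sup_insert, hsup]⟩
      have hlt : S.sup U < (insert a S).sup U := by
        rw [Finset.sup_insert]
        exact right_lt_sup.2 h
      have := Submodule.finrank_lt_finrank_of_lt hlt
      have := Finset.card_insert_le a S
      lia

/-- The space spanned by the differences of the elements of a set. A function is constant on the
set if and only if its linear extension vanishes there. -/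
noncomputable def differenceSpan (X : List ℕ) : Submodule ℚ (ℕ →₀ ℚ) :=
  Submodule.span ℚ (Set.image2 (fun u v => Finsupp.single u 1 - Finsupp.single v 1)
    {v | v ∈ X} {v | v ∈ X})

instance (X : List ℕ) : FiniteDimensional ℚ (differenceSpan X) :=
  .span_of_finite ℚ (X.finite_toSet.image2 _ X.finite_toSet)

theorem differenceSpan_le_span {X : List ℕ} {B : Finset ℕ} (h : ∀ v ∈ X, v ∈ B) :
    differenceSpan X ≤
      Submodule.span ℚ (B.image fun v => (Finsupp.single v 1 : ℕ →₀ ℚ)) := by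
  refine Submodule.span_le.2 ?_
  rintro _ ⟨u, hu, v, hv, rfl⟩
  exact sub_mem (Submodule.subset_span (by simpa using ⟨u, h u hu, rfl⟩))
    (Submodule.subset_span (by simpa using ⟨v, h v hv, rfl⟩))

theorem differenceSpan_le_ker_iff {X : List ℕ} {f : ℕ → ℚ} :
    differenceSpan X ≤ LinearMap.ker (Finsupp.linearCombination ℚ f) ↔
      ∀ u ∈ X, ∀ v ∈ X, f u = f v := by
  simp [differenceSpan, Submodule.span_le, Set.image2_subset_iff, sub_eq_zero]

theorem exists_spanning_subset {ι : Type*} (M : Finset ι) (vs : ι → List ℕ)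
    (B : Finset ℕ) (hB : ∀ i ∈ M, ∀ v ∈ vs i, v ∈ B) :
    ∃ S ⊆ M, S.card ≤ B.card ∧ ∀ f : ℕ → ℚ, (∀ i ∈ S, ∀ u ∈ vs i, ∀ v ∈ vs i, f u = f v) →
      ∀ i ∈ M, ∀ u ∈ vs i, ∀ v ∈ vs i, f u = f v := by
  obtain ⟨S, hSM, hcard, hsup⟩ := exists_subset_card_le_finrank_sup M fun i => differenceSpan (vs i)
  refine ⟨S, hSM, ?_, fun f hf i hi => ?_⟩
  · calc S.card ≤ _ := hcard
      _ ≤ _ := Submodule.finrank_mono (Finset.sup_le fun i hi =>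
        differenceSpan_le_span (hB i (hSM hi)))
      _ ≤ (B.image _).card := finrank_span_finset_le_card _
      _ ≤ B.card := Finset.card_image_le
  · rw [← differenceSpan_le_ker_iff]
    calc differenceSpan (vs i) ≤ M.sup fun i => differenceSpan (vs i) :=
          Finset.le_sup (f := fun i => differenceSpan (vs i)) hi
      _ = S.sup fun i => differenceSpan (vs i) := hsup.symm
      _ ≤ LinearMap.ker (Finsupp.linearCombination ℚ f) :=
        Finset.sup_le fun i hi => differenceSpan_le_ker_iff.2 (hf i hi)

/-! ## Separating moduli and labellings -/

theorem two_pow_le_centralBinom {t : ℕ} (ht : 0 < t) : 2 ^ t ≤ t.centralBinom := by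
  have htwo : 2 * t ≤ 2 ^ t := by
    obtain ⟨s, rfl⟩ : ∃ s, t = s + 1 := ⟨t - 1, by lia⟩
    have := Nat.lt_two_pow_self (n := s)
    rw [pow_succ]
    lia
  have hmul : 2 ^ t * 2 ^ t ≤ 2 ^ t * t.centralBinom :=
    calc 2 ^ t * 2 ^ t = 4 ^ t := by rw [← mul_pow]; norm_num
      _ ≤ 2 * t * t.centralBinom := Nat.four_pow_le_two_mul_self_mul_centralBinom t ht
      _ ≤ 2 ^ t * t.centralBinom := Nat.mul_le_mul_right _ htwo
  exact Nat.le_of_mul_le_mul_left hmul (by positivity)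

theorem exists_le_forall_not_dvd {D : Finset ℕ} {L t : ℕ} (hD : ∀ δ ∈ D, 0 < δ ∧ δ < 2 ^ L)
    (ht : D.card * L < t) : ∃ p, 1 ≤ p ∧ p ≤ 2 * t ∧ ∀ δ ∈ D, ¬p ∣ δ := by
  -- Otherwise every prime power dividing `t.centralBinom`, being at most `2 * t`, divides `∏ δ`.
  by_contra! h
  have hprod : ∏ δ ∈ D, δ ≠ 0 := Finset.prod_ne_zero_iff.2 fun δ hδ => (hD δ hδ).1.ne'
  have hdvd : t.centralBinom ∣ ∏ δ ∈ D, δ := by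
    rw [← Nat.factorization_prime_le_iff_dvd (Nat.centralBinom_ne_zero t) hprod]
    intro p hp
    obtain ⟨δ, hδ, hpδ⟩ := h (p ^ t.centralBinom.factorization p) (Nat.pow_pos hp.pos) (by
      rw [Nat.centralBinom_eq_two_mul_choose]
      exact Nat.pow_factorization_choose_le (by lia))
    exact (hp.pow_dvd_iff_le_factorization hprod).1 (hpδ.trans (Finset.dvd_prod_of_mem _ hδ))
  have hpow : 2 ^ t ≤ 2 ^ (D.card * L) :=
    calc 2 ^ t ≤ t.centralBinom := two_pow_le_centralBinom (by lia)
      _ ≤ ∏ δ ∈ D, δ := Nat.le_of_dvd (Nat.pos_of_ne_zero hprod) hdvd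
      _ ≤ ∏ _ ∈ D, 2 ^ L := Finset.prod_le_prod' fun _ hδ => (hD _ hδ).2.le
      _ = 2 ^ (D.card * L) := by rw [Finset.prod_const, ← pow_mul, mul_comm]
  have := (Nat.pow_le_pow_iff_right one_lt_two).1 hpow
  lia

theorem exists_separating_modulus {Z : Finset ℕ} {L N a : ℕ} (hZ : ∀ z ∈ Z, z < 2 ^ L)
    (hcard : Z.card ≤ N) (ha : a ∈ Z) :
    ∃ p, 1 ≤ p ∧ p ≤ 2 * ((N + 1) * (L + 1)) ∧ ∀ z ∈ Z, z ≠ a → z % p ≠ a % p := by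
  set D := (Z.erase a).image fun z : ℕ => (a - z : ℤ).natAbs
  have hDpos : ∀ δ ∈ D, 0 < δ ∧ δ < 2 ^ L := fun δ hδ => by
    obtain ⟨z, hz, rfl⟩ := Finset.mem_image.1 hδ
    rw [Finset.mem_erase] at hz
    have := hZ z hz.2
    have := hZ a ha
    lia
  have hDcard : D.card * L < (N + 1) * (L + 1) :=
    calc D.card * L ≤ N * L := Nat.mul_le_mul_right L
          (Finset.card_image_le.trans (Finset.card_erase_le.trans hcard))
      _ < (N + 1) * (L + 1) := by lia
  obtain ⟨p, hp1, hp, hdvd⟩ := exists_le_forall_not_dvd hDpos hDcard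
  exact ⟨p, hp1, hp, fun z hz hza h => hdvd _ (Finset.mem_image.2
    ⟨z, Finset.mem_erase.2 ⟨hza, hz⟩, rfl⟩) (Int.natCast_dvd.1 (Nat.modEq_iff_dvd.1 h))⟩

theorem mem_progression {p r x : ℕ} {l : List (List (List Colour))} :
    x ∈ progression p r l ↔ ∃ i < l.length, x = r + i * p := by
  have hfold (l : List (List (List Colour))) (c : ℕ) (acc : List ℕ) :
      x ∈ (l.foldl (fun (c : ℕ × List ℕ) _ => (c.1 + p, c.1 :: c.2)) (c, acc)).2 ↔
        x ∈ acc ∨ ∃ i < l.length, x = c + i * p := by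
    induction l generalizing c acc with
    | nil => simp
    | cons a l ih =>
      rw [List.foldl_cons, ih, List.mem_cons, List.length_cons, or_comm (a := x = c), or_assoc,
        Nat.exists_lt_succ_left]
      simp [add_mul, add_assoc, add_comm p]
  exact (hfold l r []).trans (by simp)

theorem mem_progression_iff_mod_eq {p r x : ℕ} {l : List (List (List Colour))} (hr : r < p)
    (hx : x < l.length) : x ∈ progression p r l ↔ x % p = r := by
  rw [mem_progression]
  constructor
  · rintro ⟨i, -, rfl⟩
    rw [Nat.add_mul_mod_self_right, Nat.mod_eq_of_lt hr]
  · rintro rfl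
    exact ⟨x / p, (Nat.div_le_self x p).trans_lt hx, by rw [mul_comm, Nat.mod_add_div]⟩

theorem length_residueMask (l : List (List (List Colour))) (p r j : ℕ) :
    (residueMask l p r j).length = l.length := by simp [residueMask]

theorem getD_residueMask {l : List (List (List Colour))} {p r x : ℕ} (j : ℕ) (hr : r < p)
    (hx : x < l.length) : (residueMask l p r j).getD x [] =
      if x % p = r then (l.getD x []).getD j [] else [] := by
  simp [residueMask, hx, mem_progression_iff_mod_eq hr]

theorem length_overlay {a b : Labelling} (h : a.length = b.length) :
    (overlay a b).length = b.length := by simp [overlay, h]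

theorem getD_overlay {a b : Labelling} (h : a.length = b.length) (x : ℕ) :
    (overlay a b).getD x [] = if a.getD x [] = [] then b.getD x [] else a.getD x [] := by
  by_cases hx : x < b.length
  · simp [overlay, hx, h]
  · simp [overlay, hx, h]

theorem mem_candidates {e : EdgeData} {c : List Colour} :
    c ∈ candidates e ↔ bichromatic c = true ∧ ∃ r ∈ e.table, r.colours = c := by
  simp [candidates, and_comm]

theorem nodup_candidates (e : EdgeData) : (candidates e).Nodup := List.nodup_dedup _

theorem length_le_length_longest {ls : List (List (List Colour))} {l : List (List Colour)}
    (hl : l ∈ ls) : l.length ≤ (longest ls).length := by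
  have hfold (ls : List (List (List Colour))) (a : List (List Colour)) : ∀ l ∈ a :: ls,
      l.length ≤ (ls.foldl (fun acc l => if acc.length ≤ l.length then l else acc) a).length := by
    induction ls generalizing a with
    | nil => simp
    | cons b ls ih =>
      have := ih (if a.length ≤ b.length then b else a)
      simp only [List.forall_mem_cons, List.foldl_cons] at this ⊢
      exact ⟨le_trans (by split <;> lia) this.1, le_trans (by split <;> lia) this.1, this.2⟩
  exact hfold ls [] l (List.mem_cons_of_mem _ hl)

theorem longest_eq_nil_or_mem (ls : List (List (List Colour))) :
    longest ls = [] ∨ longest ls ∈ ls :=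
  List.foldlRecOn (motive := fun l => l = [] ∨ l ∈ ls) ls _ (.inl rfl) fun l hl l' hl' => by
    split
    exacts [.inr hl', hl]

theorem two_pow_length_logList (l : List (List (List Colour))) :
    l.length ≤ 2 ^ (logList l).length ∧ 2 ^ (logList l).length ≤ 2 * l.length + 1 := by
  set N := l.length with hN
  have hfold (l : List (List (List Colour))) :
      let r := l.foldl (fun (c : ℕ × List ℕ) _ => if N ≤ c.1 then c else (c.1 + c.1, 0 :: c.2))
        (1, ([] : List ℕ))
      r.1 = 2 ^ r.2.length ∧ r.1 ≤ 2 * N + 1 ∧ (l.length < r.1 ∨ N ≤ r.1) := by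
    induction l using List.reverseRecOn with
    | nil => simp
    | append_singleton l b ih =>
      simp only [List.foldl_append, List.foldl_cons, List.foldl_nil, List.length_append,
        List.length_singleton] at ih ⊢
      have := Nat.one_le_two_pow (n := (l.foldl (fun (c : ℕ × List ℕ) _ =>
        if N ≤ c.1 then c else (c.1 + c.1, 0 :: c.2)) (1, [])).2.length)
      split
      · exact ⟨ih.1, ih.2.1, by lia⟩
      · dsimp only
        rw [List.length_cons, pow_succ]
        lia
  obtain ⟨hpow, hle, hge⟩ := hfold l
  rw [logList, ← hN, ← hpow]
  lia

theorem length_modulusList (K Q : List ℕ) (l : List (List (List Colour))) :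
    (modulusList K Q l).length =
      2 * ((K.length + Q.length + 1) * ((logList l).length + 1)) + 1 := by
  simp only [modulusList, List.length_cons, List.length_append, List.length_flatMap,
    List.map_const', List.sum_replicate, smul_eq_mul]
  ring

theorem mem_residueMasks {l : List (List (List Colour))} {U : List ℕ} {o : Labelling} :
    o ∈ residueMasks l U ↔ ∃ p < U.length, ∃ r < U.length, ∃ j < (longest l).length,
      residueMask l p r j = o := by
  simp [residueMasks]

theorem exists_mem_residueMasks {l : List (List (List Colour))} {K Q : List ℕ} {Z : Finset ℕ}
    (hZ : ∀ z ∈ Z, z < l.length) (hcard : Z.card ≤ K.length + Q.length) {a : ℕ} (ha : a ∈ Z)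
    {c : List Colour} (hc : c ∈ l.getD a []) :
    ∃ o ∈ residueMasks l (modulusList K Q l), o.length = l.length ∧ o.getD a [] = c ∧
      ∀ z ∈ Z, z ≠ a → o.getD z [] = [] := by
  obtain ⟨j, hj, rfl⟩ := List.mem_iff_getElem.1 hc
  obtain ⟨p, hp, hpL, hsep⟩ := exists_separating_modulus (L := (logList l).length)
    (fun z hz => (hZ z hz).trans_le (two_pow_length_logList l).1) hcard ha
  have hU := length_modulusList K Q l
  have hr : a % p < p := Nat.mod_lt a hp
  refine ⟨residueMask l p (a % p) j, mem_residueMasks.2 ⟨p, by lia, a % p, by lia, j, ?_, rfl⟩,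
    length_residueMask _ _ _ _, ?_, fun z hz hza => ?_⟩
  · rw [List.getD_eq_getElem _ _ (hZ a ha)] at hj
    exact hj.trans_le (length_le_length_longest (List.getElem_mem _))
  · rw [getD_residueMask j hr (hZ a ha), if_pos rfl, List.getD_eq_getElem _ _ hj]
  · rw [getD_residueMask j hr (hZ z hz), if_neg (hsep z hz hza)]

theorem length_of_mem_iterate_extendMasks {O ms : List Labelling} {m N : ℕ} {lab : Labelling}
    (hO : ∀ o ∈ O, o.length = m) (hms : ∀ a ∈ ms, a.length = m)
    (hlab : lab ∈ (extendMasks O)^[N] ms) : lab.length = m := by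
  induction N generalizing ms with
  | zero => exact hms lab hlab
  | succ N ih =>
    refine ih (fun a ha => ?_) hlab
    rcases List.mem_append.1 ha with ha | ha
    · exact hms a ha
    · obtain ⟨o, ho, ha⟩ := List.mem_flatMap.1 ha
      obtain ⟨a', ha', rfl⟩ := List.mem_map.1 ha
      rw [length_overlay (by rw [hO o ho, hms a' ha']), hms a' ha']

theorem exists_mem_iterate_extendMasks {O ms : List Labelling} {m N : ℕ} {A Z : Finset ℕ}
    {g : ℕ → List Colour} {lab : Labelling} (hA : A.card ≤ N)
    (hO : ∀ a ∈ A, g a ≠ [] ∧ ∃ o ∈ O, o.length = m ∧ o.getD a [] = g a ∧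
      ∀ z ∈ Z, z ≠ a → o.getD z [] = [])
    (hlab : lab ∈ ms) (hm : lab.length = m) (hg : ∀ z ∈ Z, z ∉ A → lab.getD z [] = g z) :
    ∃ lab' ∈ (extendMasks O)^[N] ms, ∀ z ∈ Z, lab'.getD z [] = g z := by
  induction N generalizing A ms lab with
  | zero =>
    rw [Nat.le_zero, Finset.card_eq_zero] at hA
    subst hA
    exact ⟨lab, hlab, fun z hz => hg z hz (by simp)⟩
  | succ N ih =>
    rw [Function.iterate_succ_apply]
    rcases A.eq_empty_or_nonempty with rfl | ⟨a, ha⟩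
    · exact ih (by simp) hO (List.mem_append_left _ hlab) hm hg
    · obtain ⟨hga, o, ho, hom, hoa, hoz⟩ := hO a ha
      have hlength : o.length = lab.length := by rw [hom, hm]
      refine ih (A := A.erase a) (lab := overlay o lab) ?_
        (fun a' ha' => hO a' (Finset.mem_of_mem_erase ha')) (List.mem_append_right _
          (List.mem_flatMap.2 ⟨o, ho, List.mem_map.2 ⟨lab, hlab, rfl⟩⟩)) ?_ fun z hz hzA => ?_
      · rw [Finset.card_erase_of_mem ha]
        lia
      · rw [length_overlay hlength, hm]
      · rw [getD_overlay hlength]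
        rcases eq_or_ne z a with rfl | hza
        · rw [hoa, if_neg hga]
        · rw [hoz z hz hza, if_pos rfl]
          exact hg z hz fun h => hzA (Finset.mem_erase.2 ⟨hza, h⟩)

namespace Input
variable {x : Input}

theorem length_cands (x : Input) : x.cands.length = x.allEdges.length := by
  rw [cands, List.length_map]

theorem length_of_mem_masks {lab : Labelling} (h : lab ∈ x.masks) :
    lab.length = x.allEdges.length := by
  refine length_of_mem_iterate_extendMasks (fun o ho => ?_) (fun a ha => ?_) h
  · obtain ⟨p, -, r, -, j, -, rfl⟩ := mem_residueMasks.1 ho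
    rw [length_residueMask, length_cands]
  · rw [List.mem_singleton.1 ha, List.length_map, length_cands]

theorem card_le_depth {A : Finset ℕ} {g : ℕ → List Colour} (hA : A.card ≤ x.k)
    (hg : ∀ a ∈ A, g a ∈ x.cands.getD a []) : A.card ≤ x.depth := by
  rw [depth]
  split_ifs with hlongest
  · rw [Nat.le_zero, Finset.card_eq_zero, Finset.eq_empty_iff_forall_notMem]
    intro a ha
    have hmem := hg a ha
    rw [List.getD_eq_getElem?_getD] at hmem
    have hnil (l : List (List Colour)) (hl : l ∈ x.cands) : l = [] := by
      simpa [hlongest] using length_le_length_longest hl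
    cases hget : x.cands[a]? with
    | none => simp [hget] at hmem
    | some l => simp [hget, hnil l (List.mem_of_getElem? hget)] at hmem
  · exact hA

theorem exists_mem_masks {A S : Finset ℕ} {g : ℕ → List Colour}
    (hAm : ∀ a ∈ A, a < x.allEdges.length) (hSm : ∀ a ∈ S, a < x.allEdges.length)
    (hA : A.card ≤ x.k) (hS : S.card ≤ x.q) (hg : ∀ a ∈ A, g a ∈ x.cands.getD a [])
    (hgA : ∀ a ∈ A, g a ≠ []) (hgS : ∀ a ∈ S, a ∉ A → g a = []) :
    ∃ lab ∈ x.masks, ∀ z ∈ A ∪ S, lab.getD z [] = g z := by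
  have hdepth : A.card ≤ x.depth := card_le_depth hA hg
  have hZ : ∀ z ∈ A ∪ S, z < x.cands.length := fun z hz =>
    x.length_cands.symm ▸ (Finset.mem_union.1 hz).elim (hAm z) (hSm z)
  refine exists_mem_iterate_extendMasks (A := A) (m := x.cands.length) hdepth
    (fun a ha => ⟨hgA a ha, exists_mem_residueMasks hZ ?_ (Finset.mem_union_left _ ha) (hg a ha)⟩)
    (List.mem_singleton_self _) (List.length_map ..) fun z hz hzA => ?_
  · rw [List.length_range, List.length_range]
    exact (Finset.card_union_le _ _).trans (Nat.add_le_add hdepth hS)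
  · rw [hgS z ((Finset.mem_union.1 hz).resolve_left hzA) hzA]
    simp [hZ z hz]

end Input
/-! ## Correctness -/

section bichromatic
variable {s : Colour} {col : ℕ → Colour} {X : List ℕ}

theorem bichromatic_map_iff :
    bichromatic (X.map col) = true ↔ ∀ c, ∃ v ∈ X, col v = c := by
  simp only [bichromatic, Bool.and_eq_true, List.any_eq_true, List.mem_map, decide_eq_true_eq,
    exists_exists_and_eq_and]
  exact ⟨fun h c => c.casesOn h.1 h.2, fun h => ⟨h _, h _⟩⟩

theorem not_bichromatic_iff : ¬bichromatic (X.map col) = true ↔ Monochromatic col X := by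
  rw [bichromatic_map_iff]
  constructor
  · intro h u hu v hv
    by_contra hne
    refine h fun c => ?_
    cases hcu : col u <;> cases hcv : col v <;> cases c <;> grind
  · intro h hall
    obtain ⟨u, hu, hcu⟩ := hall .black
    obtain ⟨v, hv, hcv⟩ := hall .white
    simpa [hcu, hcv] using h u hu v hv

end bichromatic

section describes
variable {s : Colour} {verts : List ℕ} {es : List EdgeData} {lab : Labelling} {col : ℕ → Colour}

theorem mem_hardEdges {le : List (EdgeData × List Colour)} {x : EdgeData × List Colour} :
    x ∈ hardEdges verts le ↔
      x ∈ le ∧ x.2 ≠ [] ∧ ¬∃ X ∈ components verts le, x.1.vertices ⊆ X := by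
  simp [hardEdges, List.subset_def]

theorem exists_mem_components_of_spanned {le : List (EdgeData × List Colour)} {X : List ℕ} {v : ℕ}
    (hverts : verts.Nodup) (hle : ∀ x ∈ le, x.1.vertices ⊆ verts) (hv : v ∈ X) (hvv : v ∈ verts)
    (h : ∀ f : ℕ → ℚ, (∀ x ∈ le, x.2 = [] →
        ∀ u ∈ x.1.vertices, ∀ w ∈ x.1.vertices, f u = f w) →
      ∀ u ∈ X, ∀ w ∈ X, f u = f w) :
    ∃ Y ∈ components verts le, X ⊆ Y := by
  obtain ⟨Y, hY, hvY⟩ := covers_components (le := le) hvv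
  refine ⟨Y, hY, fun u hu => ?_⟩
  have hconst := h (fun u => if u ∈ Y then 1 else 0) (fun x hx hx0 u hu w hw => ?_) u hu v hv
  · simpa [hvY] using hconst
  · obtain ⟨Z, hZ, hxZ⟩ := exists_mem_components_of_unlabelled hx (hle x hx) hx0
    have hmem (u) (hu : u ∈ x.1.vertices) : u ∈ Y ↔ Y = Z :=
      ⟨fun h => eq_of_mem_of_mem_disjoint (pairwise_disjoint_components hverts) hY hZ h (hxZ hu),
        fun h => h ▸ hxZ hu⟩
    simp only [hmem u hu, hmem w hw]

/-- The vertices of the hyperedge number `i`. -/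
def verticesAt (es : List EdgeData) (i : ℕ) : List ℕ := (es.map EdgeData.vertices).getD i []

theorem verticesAt_eq {i : ℕ} (hi : i < es.length) : verticesAt es i = es[i].vertices := by
  simp [verticesAt, hi]

/-- The indices of the bichromatic hyperedges. -/
def bichromaticIndices (es : List EdgeData) (col : ℕ → Colour) : Finset ℕ :=
  (Finset.range es.length).filter fun i => bichromatic ((verticesAt es i).map col) = true

theorem mem_bichromaticIndices {i : ℕ} (hi : i < es.length) :
    i ∈ bichromaticIndices es col ↔ bichromatic (es[i].vertices.map col) = true := by
  simp [bichromaticIndices, hi, verticesAt_eq]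

theorem lt_length_of_mem_bichromaticIndices {i : ℕ} (h : i ∈ bichromaticIndices es col) :
    i < es.length :=
  Finset.mem_range.1 (Finset.mem_filter.1 h).1

theorem exists_getElem_of_mem_zip (hlab : lab.length = es.length) {x : EdgeData × List Colour}
    (hx : x ∈ es.zip lab) : ∃ i, ∃ hi : i < es.length, x = (es[i], lab.getD i []) := by
  obtain ⟨i, hi, rfl⟩ := List.mem_iff_getElem.1 hx
  rw [List.length_zip] at hi
  exact ⟨i, by lia, by rw [List.getElem_zip, List.getD_eq_getElem]⟩

theorem getElem_mem_zip (hlab : lab.length = es.length) {i : ℕ} (hi : i < es.length) :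
    (es[i], lab.getD i []) ∈ es.zip lab :=
  List.mem_iff_getElem.2 ⟨i, by simpa [hlab] using hi, by
    rw [List.getElem_zip, List.getD_eq_getElem _ _ (by lia)]⟩

theorem describes_of_spanning (hverts : verts.Nodup) (hes : ∀ e ∈ es, e.vertices ⊆ verts)
    (hlab : lab.length = es.length)
    (hA : ∀ i ∈ bichromaticIndices es col, lab.getD i [] = (verticesAt es i).map col)
    {S : Finset ℕ} (hSlt : ∀ i ∈ S, i < es.length) (hS0 : ∀ i ∈ S, lab.getD i [] = [])
    (hS : ∀ f : ℕ → ℚ,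
      (∀ i ∈ S, ∀ u ∈ verticesAt es i, ∀ v ∈ verticesAt es i, f u = f v) →
      ∀ i < es.length, (∀ v ∈ verticesAt es i, col v = s) →
        ∀ u ∈ verticesAt es i, ∀ v ∈ verticesAt es i, f u = f v) :
    Describes s verts (es.zip lab) col where
  unlabelled x hx hx0 := by
    obtain ⟨i, hi, rfl⟩ := exists_getElem_of_mem_zip hlab hx
    refine not_bichromatic_iff.1 fun hb => ?_
    have hlabel := hA i ((mem_bichromaticIndices hi).2 hb)
    rw [verticesAt_eq hi, show lab.getD i [] = [] from hx0] at hlabel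
    simp [← hlabel, bichromatic] at hb
  labelled x hx := by
    obtain ⟨hx, -, hhard⟩ := mem_hardEdges.1 hx
    obtain ⟨i, hi, rfl⟩ := exists_getElem_of_mem_zip hlab hx
    by_cases hb : bichromatic (es[i].vertices.map col) = true
    · left
      rw [hA i ((mem_bichromaticIndices hi).2 hb), verticesAt_eq hi]
    right
    intro v hv hvs
    have hmono := not_bichromatic_iff.1 hb
    refine hhard (exists_mem_components_of_spanned hverts (fun x hx => ?_) hv
      (hes _ (List.getElem_mem hi) hv) fun f hf => ?_)
    · exact hes _ (List.of_mem_zip hx).1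
    · rw [← verticesAt_eq hi]
      refine hS f (fun j hj => ?_) i hi fun u hu => ?_
      · rw [verticesAt_eq (hSlt j hj)]
        exact hf _ (getElem_mem_zip hlab (hSlt j hj)) (hS0 j hj)
      · rw [verticesAt_eq hi] at hu
        exact (hmono u hu v hv).trans hvs

theorem exists_mem_masks_of_bichromaticIndices {x : Input} {S : Finset ℕ}
    (hA : (bichromaticIndices x.allEdges col).card ≤ x.k)
    (hc : ∀ e ∈ x.allEdges, bichromatic (e.vertices.map col) = true →
      e.vertices.map col ∈ candidates e)
    (hSlt : ∀ i ∈ S, i < x.allEdges.length) (hS : S.card ≤ x.q)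
    (hSA : ∀ i ∈ S, i ∉ bichromaticIndices x.allEdges col) :
    ∃ lab ∈ x.masks,
      (∀ i ∈ bichromaticIndices x.allEdges col,
        lab.getD i [] = (verticesAt x.allEdges i).map col) ∧ ∀ i ∈ S, lab.getD i [] = [] := by
  have hlt (i) (hi : i ∈ bichromaticIndices x.allEdges col) : i < x.allEdges.length :=
    lt_length_of_mem_bichromaticIndices hi
  have hb (i) (hi : i ∈ bichromaticIndices x.allEdges col) :
      bichromatic ((verticesAt x.allEdges i).map col) = true := (Finset.mem_filter.1 hi).2
  set g : ℕ → List Colour := fun i => if i ∈ bichromaticIndices x.allEdges col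
    then (verticesAt x.allEdges i).map col else []
  have hgA (i) (hi : i ∈ bichromaticIndices x.allEdges col) :
      g i = (verticesAt x.allEdges i).map col := if_pos hi
  have hgcands (i) (hi : i ∈ bichromaticIndices x.allEdges col) : g i ∈ x.cands.getD i [] := by
    have hlt' : i < x.cands.length := by
      rw [Input.length_cands]
      exact hlt i hi
    have hbi := hb i hi
    rw [verticesAt_eq (hlt i hi)] at hbi
    rw [hgA i hi, verticesAt_eq (hlt i hi), List.getD_eq_getElem _ _ hlt']
    simpa [Input.cands] using hc _ (List.getElem_mem (hlt i hi)) hbi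
  have hgne (i) (hi : i ∈ bichromaticIndices x.allEdges col) : g i ≠ [] := fun h => by
    have hbi := hb i hi
    rw [← hgA i hi, h] at hbi
    simp [bichromatic] at hbi
  obtain ⟨lab, hlab, hlabg⟩ := Input.exists_mem_masks hlt hSlt hA hS hgcands hgne
    fun i _ hi => if_neg hi
  exact ⟨lab, hlab, fun i hi => (hlabg i (Finset.mem_union_left _ hi)).trans (hgA i hi),
    fun i hi => (hlabg i (Finset.mem_union_right _ hi)).trans (if_neg (hSA i hi))⟩

theorem exists_describes {x : Input} (hverts : verts.Nodup)
    (hes : ∀ e ∈ x.allEdges, e.vertices ⊆ verts)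
    (hA : (bichromaticIndices x.allEdges col).card ≤ x.k)
    (hB : (verts.toFinset.filter fun v => col v = s).card ≤ x.q)
    (hc : ∀ e ∈ x.allEdges, bichromatic (e.vertices.map col) = true →
      e.vertices.map col ∈ candidates e) :
    ∃ lab ∈ x.masks, Describes s verts (x.allEdges.zip lab) col := by
  set M := (Finset.range x.allEdges.length).filter fun i => ∀ v ∈ verticesAt x.allEdges i, col v = s
  have hM {i} : i ∈ M ↔ i < x.allEdges.length ∧ ∀ v ∈ verticesAt x.allEdges i, col v = s := by
    simp [M]
  obtain ⟨S, hSM, hcard, hS⟩ := exists_spanning_subset M (verticesAt x.allEdges)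
    (verts.toFinset.filter fun v => col v = s) fun i hi v hv => by
      obtain ⟨hlt, hs⟩ := hM.1 hi
      refine Finset.mem_filter.2 ⟨List.mem_toFinset.2 (hes _ (List.getElem_mem hlt) ?_), hs v hv⟩
      rwa [← verticesAt_eq hlt]
  have hSlt (i) (hi : i ∈ S) : i < x.allEdges.length := (hM.1 (hSM hi)).1
  obtain ⟨lab, hlab, hlabA, hlabS⟩ := exists_mem_masks_of_bichromaticIndices hA hc hSlt
    (hcard.trans hB) fun i hi hiA => by
      have hs := (hM.1 (hSM hi)).2
      rw [verticesAt_eq (hSlt i hi)] at hs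
      exact not_bichromatic_iff.2 (fun u hu v hv => (hs u hu).trans (hs v hv).symm)
        ((mem_bichromaticIndices (hSlt i hi)).1 hiA)
  exact ⟨lab, hlab, describes_of_spanning hverts hes (Input.length_of_mem_masks hlab) hlabA hSlt
    hlabS fun f hf i hi hs => hS f hf i (hM.2 ⟨hi, hs⟩)⟩

end describes

section bestCosts
variable {b μ : ℕ} {s t : Colour} {verts : List ℕ} {es : List EdgeData} {ms : List Labelling}
  {lab : Labelling} {col : ℕ → Colour}

theorem costValue_flatMap_le {α : Type} {l : List α} (f : α → CostList) (μ : ℕ) {a : α}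
    (ha : a ∈ l) : costValue (l.flatMap f) μ ≤ costValue (f a) μ := by
  induction l with
  | nil => simp at ha
  | cons b l ih =>
    rw [List.flatMap_cons, costValue_append]
    rcases List.mem_cons.1 ha with rfl | ha
    · exact min_le_left _ _
    · exact (min_le_right _ _).trans (ih ha)

theorem exists_costValue_flatMap {α : Type} {l : List α} (f : α → CostList) {μ : ℕ}
    (h : costValue (l.flatMap f) μ ≠ ⊤) :
    ∃ a ∈ l, costValue (l.flatMap f) μ = costValue (f a) μ := by
  induction l with
  | nil => simp [costValue] at h
  | cons b l ih =>
    rw [List.flatMap_cons, costValue_append] at h ⊢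
    rcases min_choice (costValue (f b) μ) (costValue (l.flatMap f) μ) with hmin | hmin <;>
      rw [hmin] at h ⊢
    · exact ⟨b, by simp, rfl⟩
    · obtain ⟨a, ha, heq⟩ := ih h
      exact ⟨a, by simp [ha], heq⟩

theorem exists_costAt_eq_bestCosts (hμ : μ ≤ b) (hverts : verts.Nodup)
    (hes : ∀ e ∈ es, e.vertices ⊆ verts) (hms : ∀ lab ∈ ms, lab.length = es.length)
    (h : costValue (bestCosts (List.range (b + 1)) verts es ms) μ ≠ ⊤) :
    ∃ col, costValue (bestCosts (List.range (b + 1)) verts es ms) μ = costAt es col μ := by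
  obtain ⟨lab, hlab, hbest⟩ := exists_costValue_flatMap _ h
  have hsep (s : Colour) := separated_freeClusters (s := s) (hms lab hlab) hverts hes
  rw [bestCosts, hbest, costValue_append]
  rcases min_choice (costValue (labellingCosts (List.range (b + 1)) .black .white verts es lab) μ)
    (costValue (labellingCosts (List.range (b + 1)) .white .black verts es lab) μ) with
    hmin | hmin <;> rw [hmin]
  · exact exists_costAt_eq_subsetCosts (hsep _) hμ
  · exact exists_costAt_eq_subsetCosts (hsep _) hμ

theorem bestCosts_le_costAt (hst : ∀ c, c ≠ s ↔ c = t) (hμ : μ ≤ b) (hverts : verts.Nodup)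
    (hes : ∀ e ∈ es, e.vertices ⊆ verts) (hlab : lab ∈ ms) (hlength : lab.length = es.length)
    (h : Describes s verts (es.zip lab) col) :
    costValue (bestCosts (List.range (b + 1)) verts es ms) μ ≤ costAt es col μ := by
  obtain ⟨T, hT, hcol⟩ := h.exists_sublist_freeClusters hst
  have hlabelling : costValue (labellingCosts (List.range (b + 1)) s t verts es lab) μ ≤
      costAt es col μ :=
    calc _ ≤ costAt es (twoColouring s t T.flatten) μ :=
          subsetCosts_le_costAt (separated_freeClusters hlength hverts hes) hμ hT
      _ = costAt es col μ := by
          rw [costAt, costAt, totalSeries_congr fun e he v hv => hcol v (hes e he hv)]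
  refine (costValue_flatMap_le _ μ hlab).trans (le_trans ?_ hlabelling)
  rw [costValue_append]
  cases s
  · obtain rfl : Colour.white = t := (hst _).1 (by simp)
    exact min_le_left _ _
  · obtain rfl : Colour.black = t := (hst _).1 (by simp)
    exact min_le_right _ _

end bestCosts

section costValue
variable {u : CostList} {μ : ℕ}

theorem costValue_le {x : ℕ × ℕ∞} (hx : x ∈ u) : costValue u x.1 ≤ x.2 := by
  induction u with
  | nil => simp at hx
  | cons y u ih =>
    rw [costValue_cons]
    rcases List.mem_cons.1 hx with rfl | hx
    · simp
    · exact (min_le_right _ _).trans (ih hx)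

theorem exists_of_costValue_ne_top (h : costValue u μ ≠ ⊤) :
    ∃ x ∈ u, x.1 = μ ∧ x.2 = costValue u μ := by
  induction u with
  | nil => simp [costValue] at h
  | cons y u ih =>
    rw [costValue_cons] at h ⊢
    rcases min_choice (if y.1 = μ then y.2 else ⊤) (costValue u μ) with hmin | hmin <;>
      rw [hmin] at h ⊢
    · split at h
      case isTrue hy => exact ⟨y, by simp, hy, by rw [if_pos hy]⟩
      case isFalse => simp at h
    · obtain ⟨x, hx, heq⟩ := ih h
      exact ⟨x, by simp [hx], heq⟩

theorem costValue_eq_of_forall {a : ℕ∞} (hu : ∀ x ∈ u, x.1 = μ → x.2 = a)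
    (ha : a ≠ ⊤ → (μ, a) ∈ u) : costValue u μ = a := by
  by_cases htop : costValue u μ = ⊤
  · by_contra hne
    have hle := costValue_le (ha fun h => hne (htop.trans h.symm))
    rw [htop, top_le_iff] at hle
    exact hne (htop.trans hle.symm)
  · obtain ⟨x, hx, hxμ, hxv⟩ := exists_of_costValue_ne_top htop
    rw [← hxv, hu x hx hxμ]

end costValue

section prod
variable {m μ : ℕ} (f : Fin m → Series)

theorem untrop_coeff_prod_le {a : Fin m → ℕ} (ha : ∑ e, a e = μ) :
    untrop ((∏ e, f e).coeff μ) ≤ ∑ e, untrop ((f e).coeff (a e)) := by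
  rw [PowerSeries.coeff_prod, Finset.untrop_sum']
  refine (Finset.inf_le (b := Finsupp.equivFunOnFinite.symm a) (by simp [ha])).trans ?_
  simp [untrop_prod]

theorem exists_untrop_coeff_prod (h : untrop ((∏ e, f e).coeff μ) ≠ ⊤) :
    ∃ a : Fin m → ℕ, ∑ e, a e = μ ∧
      untrop ((∏ e, f e).coeff μ) = ∑ e, untrop ((f e).coeff (a e)) := by
  rw [PowerSeries.coeff_prod, Finset.untrop_sum'] at h ⊢
  rcases (Finset.finsuppAntidiag (Finset.univ : Finset (Fin m)) μ).eq_empty_or_nonempty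
    with hempty | hne
  · simp [hempty] at h
  · obtain ⟨l, hl, heq⟩ := Finset.exists_mem_eq_inf _ hne
      (untrop ∘ fun l : Fin m →₀ ℕ => ∏ i, (f i).coeff (l i))
    exact ⟨l, by simpa using hl, heq.trans (by simp [untrop_prod])⟩

end prod

section precolourEdges
variable {col₀ : List (Option Colour)} {col : ℕ → Colour}

theorem mem_precolourEdges {e : EdgeData} : e ∈ precolourEdges col₀ ↔
    ∃ (v : ℕ) (c : Colour), col₀[v]? = some (some c) ∧ e = ⟨[v], [⟨[c], 0, 0⟩]⟩ := by
  simp only [precolourEdges, List.mem_flatMap, List.mem_map, Option.mem_toList, Prod.exists,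
    List.mk_mem_zipIdx_iff_getElem?]
  grind

theorem edgeSeries_precolour (v : ℕ) (c c' : Colour) :
    edgeSeries ⟨[v], [⟨[c], 0, 0⟩]⟩ [c'] = if c' = c then 1 else 0 := by
  unfold edgeSeries tableCosts
  by_cases h : c' = c
  · subst h
    simpa using costSeries_unit
  · simp [h, Ne.symm h, costSeries]

theorem totalSeries_precolourEdges_of_extends
    (h : ∀ v c, col₀[v]? = some (some c) → col v = c) :
    totalSeries (precolourEdges col₀) col = 1 := by
  refine List.prod_eq_one fun x hx => ?_
  obtain ⟨e, he, rfl⟩ := List.mem_map.1 hx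
  obtain ⟨v, c, hv, rfl⟩ := mem_precolourEdges.1 he
  rw [List.map_singleton, edgeSeries_precolour, if_pos (h v c hv)]

theorem totalSeries_precolourEdges_of_ne {v : ℕ} {c : Colour} (hv : col₀[v]? = some (some c))
    (hc : col v ≠ c) : totalSeries (precolourEdges col₀) col = 0 := by
  refine List.prod_eq_zero (List.mem_map.2 ⟨_, mem_precolourEdges.2 ⟨v, c, hv, rfl⟩, ?_⟩)
  rw [List.map_singleton, edgeSeries_precolour, if_neg hc]

end precolourEdges

section presentation
variable {I : HPInstance} (P : I.Presentation)

/-- A hyperedge as it is stored in memory. -/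
def edgeData (e : Fin I.m) : EdgeData where
  vertices := List.ofFn fun i => (P.order e i).1.1
  table := (P.table e).map fun r => ⟨List.ofFn fun i => r.1 (P.order e i), r.2.1, r.2.2⟩

/-- The instance as it is stored in memory. -/
def inputData : Input where
  k := I.k
  b := I.b
  d := I.d
  q := I.q
  n := I.n
  m := I.m
  precolouring := List.ofFn I.col₀
  edges := List.ofFn (edgeData P)

theorem code_edgeData (e : Fin I.m) : code (edgeData P e) = HPInstance.codeEdge P e := by
  have hvertices : code (edgeData P e).vertices =
      .ofList (List.ofFn fun i => .num (P.order e i).1) :=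
    congrArg Data.ofList List.map_ofFn
  have hrow (r) : code (TableRow.mk (List.ofFn fun i => r.1 (P.order e i)) r.2.1 r.2.2) =
      HPInstance.codeEntry P e r :=
    congrArg (fun l => Data.ofList [.ofList l, .num r.2.1, .num r.2.2]) List.map_ofFn
  have htable : code (edgeData P e).table = .ofList ((P.table e).map (HPInstance.codeEntry P e)) :=
    congrArg Data.ofList (List.map_map.trans (List.map_congr_left fun r _ => hrow r))
  exact congrArg₂ (fun a b => Data.ofList [a, b]) hvertices htable

theorem code_inputData : code (inputData P) = I.input P := by
  have hcol₀ : code (inputData P).precolouring =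
      .ofList (List.ofFn fun v => HPInstance.codeOptColour (I.col₀ v)) :=
    congrArg Data.ofList List.map_ofFn
  have hedges : code (inputData P).edges = .ofList (List.ofFn fun e => HPInstance.codeEdge P e) :=
    congrArg Data.ofList (List.map_ofFn.trans (congrArg List.ofFn (funext (code_edgeData P))))
  exact congrArg₂ (fun a b => Data.ofList
    [.num I.k, .num I.b, .num I.d, .num I.q, .num I.n, .num I.m, a, b]) hcol₀ hedges

theorem map_vertices_edgeData (e : Fin I.m) (col : ℕ → Colour) :
    (edgeData P e).vertices.map col = List.ofFn fun i => col (P.order e i).1.1 :=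
  List.map_ofFn

theorem eq_of_ofFn_eq_map_vertices {e : Fin I.m} {c : {v // v ∈ I.edge e} → Colour}
    {col : ℕ → Colour}
    (h : (List.ofFn fun i => c (P.order e i)) = (edgeData P e).vertices.map col) :
    c = fun v => col v.1.1 := by
  rw [map_vertices_edgeData] at h
  funext v
  obtain ⟨i, rfl⟩ := (P.order e).surjective v
  exact congrFun (List.ofFn_injective h) i

theorem mem_tableCosts_edgeData {e : Fin I.m} {col : ℕ → Colour} {μ : ℕ} {a : ℕ∞} :
    (μ, a) ∈ tableCosts (edgeData P e).table ((edgeData P e).vertices.map col) ↔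
      a ≠ ⊤ ∧ ∃ h : μ < I.b + 1, I.cost e (fun v => col v.1.1) ⟨μ, h⟩ = a := by
  constructor
  · intro hx
    obtain ⟨r, hr, heq⟩ := List.mem_map.1 hx
    obtain ⟨hr, hcol⟩ := List.mem_filter.1 hr
    obtain ⟨⟨c, ν, z⟩, hrow, rfl⟩ := List.mem_map.1 hr
    obtain ⟨rfl, rfl⟩ := Prod.mk.inj heq
    obtain rfl := eq_of_ofFn_eq_map_vertices P (of_decide_eq_true hcol)
    exact ⟨ENat.natCast_ne_top z, ν.2, (P.mem_table e _ ν z).1 hrow⟩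
  · rintro ⟨ha, hμ, hcost⟩
    obtain ⟨z, rfl⟩ := ENat.ne_top_iff_exists.1 ha
    have hrow := (P.mem_table e _ _ z).2 hcost
    exact List.mem_map.2 ⟨_, List.mem_filter.2 ⟨List.mem_map.2 ⟨_, hrow, rfl⟩,
      decide_eq_true (map_vertices_edgeData P e col).symm⟩, rfl⟩

theorem coeff_edgeSeries (e : Fin I.m) (col : ℕ → Colour) (μ : ℕ) :
    untrop ((edgeSeries (edgeData P e) ((edgeData P e).vertices.map col)).coeff μ) =
      if h : μ < I.b + 1 then I.cost e (fun v => col v.1.1) ⟨μ, h⟩ else ⊤ := by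
  rw [edgeSeries, ← costValue_eq]
  refine costValue_eq_of_forall ?_ fun ha => (mem_tableCosts_edgeData P).2 ⟨ha, ?_⟩
  · rintro ⟨ν, a⟩ hx rfl
    obtain ⟨-, h, hcost⟩ := (mem_tableCosts_edgeData P).1 hx
    rw [dif_pos h, hcost]
  · by_cases h : μ < I.b + 1
    · exact ⟨h, by rw [dif_pos h]⟩
    · exact absurd (dif_neg h) ha

theorem allEdges_inputData :
    (inputData P).allEdges = List.ofFn (edgeData P) ++ precolourEdges (List.ofFn I.col₀) := rfl

theorem totalSeries_inputData (col : ℕ → Colour) :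
    totalSeries (inputData P).allEdges col =
      (∏ e, edgeSeries (edgeData P e) ((edgeData P e).vertices.map col)) *
        totalSeries (precolourEdges (List.ofFn I.col₀)) col := by
  rw [allEdges_inputData, totalSeries, List.map_append, List.prod_append, List.map_ofFn,
    List.prod_ofFn]
  rfl

theorem extends_iff_getElem? {col : ℕ → Colour} : (I.Extends fun v => col v) ↔
    ∀ v c, (List.ofFn I.col₀)[v]? = some (some c) → col v = c := by
  constructor
  · intro h v c hv
    obtain ⟨hlt, hc⟩ := List.getElem?_eq_some_iff.1 hv
    rw [List.length_ofFn] at hlt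
    rw [List.getElem_ofFn] at hc
    exact h ⟨v, hlt⟩ c hc
  · intro h v c hv
    exact h v c (by simp [hv])

theorem costAt_le {col : ℕ → Colour} (hcol : I.Extends fun v => col v)
    {a : Fin I.m → Fin (I.b + 1)} {μ : ℕ} (ha : ∑ e, (a e : ℕ) = μ) :
    costAt (inputData P).allEdges col μ ≤ ∑ e, I.cost e (fun v => col v.1.1) (a e) := by
  rw [costAt, totalSeries_inputData,
    totalSeries_precolourEdges_of_extends (extends_iff_getElem?.1 hcol), mul_one]
  refine (untrop_coeff_prod_le _ ha).trans (Finset.sum_le_sum fun e _ => ?_)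
  rw [coeff_edgeSeries, dif_pos (a e).2]

theorem extends_of_costAt_ne_top {col : ℕ → Colour} {μ : ℕ}
    (h : costAt (inputData P).allEdges col μ ≠ ⊤) : I.Extends fun v => col v := by
  refine extends_iff_getElem?.2 fun v c hv => by_contra fun hc => h ?_
  rw [costAt, totalSeries_inputData, totalSeries_precolourEdges_of_ne hv hc, mul_zero, map_zero]
  rfl

theorem exists_of_costAt_ne_top {col : ℕ → Colour} {μ : ℕ}
    (h : costAt (inputData P).allEdges col μ ≠ ⊤) :
    ∃ a : Fin I.m → Fin (I.b + 1), ∑ e, (a e : ℕ) = μ ∧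
      costAt (inputData P).allEdges col μ = ∑ e, I.cost e (fun v => col v.1.1) (a e) := by
  have hcol := extends_iff_getElem?.1 (extends_of_costAt_ne_top P h)
  rw [costAt, totalSeries_inputData, totalSeries_precolourEdges_of_extends hcol, mul_one] at h ⊢
  obtain ⟨a, ha, hsum⟩ := exists_untrop_coeff_prod _ h
  have hb (e) : a e < I.b + 1 := by
    by_contra hb
    rw [hsum] at h
    refine h (WithTop.sum_eq_top.2 ⟨e, Finset.mem_univ _, ?_⟩)
    rw [coeff_edgeSeries, dif_neg hb]
    rfl
  refine ⟨fun e => ⟨a e, hb e⟩, ha, hsum.trans (Finset.sum_congr rfl fun e _ => ?_)⟩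
  rw [coeff_edgeSeries, dif_pos (hb e)]

theorem vertices_subset_range {e : EdgeData} (he : e ∈ (inputData P).allEdges) :
    e.vertices ⊆ List.range I.n := by
  intro v hv
  rw [List.mem_range]
  rcases List.mem_append.1 he with he | he
  · obtain ⟨e, rfl⟩ := (List.mem_ofFn' _ _).1 he
    obtain ⟨i, rfl⟩ := (List.mem_ofFn' _ _).1 hv
    exact (P.order e i).1.2
  · obtain ⟨w, c, hw, rfl⟩ := mem_precolourEdges.1 he
    rw [List.mem_singleton.1 hv]
    simpa [inputData] using (List.getElem?_eq_some_iff.1 hw).1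

theorem colourCount_pos_of_bichromatic {e : Fin I.m} {col : ℕ → Colour}
    (h : bichromatic ((edgeData P e).vertices.map col) = true) (c : Colour) :
    0 < HPInstance.colourCount (fun v : {v // v ∈ I.edge e} => col v.1.1) c := by
  obtain ⟨v, hv, hvc⟩ := bichromatic_map_iff.1 h c
  obtain ⟨i, rfl⟩ := (List.mem_ofFn' _ _).1 hv
  exact Finset.card_pos.2 ⟨P.order e i, by simpa using hvc⟩

theorem exists_edge_of_bichromatic {col : ℕ → Colour} {i : ℕ}
    (hi : i < (inputData P).allEdges.length)
    (h : bichromatic (((inputData P).allEdges[i]).vertices.map col) = true) :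
    ∃ e : Fin I.m, e.1 = i ∧ (inputData P).allEdges[i] = edgeData P e := by
  simp only [allEdges_inputData] at h ⊢
  by_cases him : i < I.m
  · refine ⟨⟨i, him⟩, rfl, ?_⟩
    rw [List.getElem_append_left (by simpa using him), List.getElem_ofFn]
  · exfalso
    rw [List.getElem_append_right (by simpa using him)] at h
    have hi' : i - (List.ofFn (edgeData P)).length <
        (precolourEdges (List.ofFn I.col₀)).length := by
      rw [allEdges_inputData, List.length_append] at hi
      rw [List.length_ofFn] at hi ⊢
      lia
    obtain ⟨v, c, -, hv⟩ := mem_precolourEdges.1 (List.getElem_mem hi')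
    rw [hv] at h
    cases hc : col v <;> simp [bichromatic, hc] at h

theorem mem_candidates_of_cost_ne_top {e : Fin I.m} {col : ℕ → Colour} {a : Fin (I.b + 1)}
    (hcost : I.cost e (fun v => col v.1.1) a ≠ ⊤)
    (h : bichromatic ((edgeData P e).vertices.map col) = true) :
    (edgeData P e).vertices.map col ∈ candidates (edgeData P e) := by
  obtain ⟨z, hz⟩ := ENat.ne_top_iff_exists.1 hcost
  exact mem_candidates.2 ⟨h, _, List.mem_map.2 ⟨_, (P.mem_table e _ _ z).2 hz.symm, rfl⟩,
    (map_vertices_edgeData P e col).symm⟩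

theorem card_bichromaticIndices_le (hI : I.ConnectedCosts) {col : ℕ → Colour}
    {a : Fin I.m → Fin (I.b + 1)}
    (hk : ∑ e, I.cost e (fun v => col v.1.1) (a e) ≤ (I.k : ℕ∞)) :
    (bichromaticIndices (inputData P).allEdges col).card ≤ I.k := by
  set A := Finset.univ.filter fun e => 1 ≤ I.cost e (fun v => col v.1.1) (a e)
  have hA : (A.card : ℕ∞) ≤ I.k := by
    rw [Finset.cast_card]
    calc ∑ _ ∈ A, (1 : ℕ∞) ≤ ∑ e ∈ A, I.cost e (fun v => col v.1.1) (a e) :=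
          Finset.sum_le_sum fun e he => (Finset.mem_filter.1 he).2
      _ ≤ ∑ e, I.cost e (fun v => col v.1.1) (a e) :=
          Finset.sum_le_sum_of_subset (Finset.subset_univ _)
      _ ≤ I.k := hk
  have hsub : bichromaticIndices (inputData P).allEdges col ⊆ A.image Fin.val := fun i hi => by
    have hlt := lt_length_of_mem_bichromaticIndices hi
    have hb := (mem_bichromaticIndices hlt).1 hi
    obtain ⟨e, rfl, he⟩ := exists_edge_of_bichromatic P hlt hb
    rw [he] at hb
    refine Finset.mem_image.2 ⟨e, Finset.mem_filter.2 ⟨Finset.mem_univ _, ?_⟩, rfl⟩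
    exact Order.one_le_iff_ne_zero.2 (hI e _ (colourCount_pos_of_bichromatic P hb _)
      (colourCount_pos_of_bichromatic P hb _) _)
  exact ((Finset.card_le_card hsub).trans Finset.card_image_le).trans (Nat.cast_le.1 hA)

theorem card_filter_colour_le_colourCount {n : ℕ} (col : ℕ → Colour) (s : Colour) :
    ((List.range n).toFinset.filter fun v => col v = s).card ≤
      HPInstance.colourCount (fun v : Fin n => col v) s := by
  refine (Finset.card_le_card (t := (Finset.univ.filter fun v : Fin n => col v = s).image Fin.val)
    fun v hv => ?_).trans Finset.card_image_le
  simp only [List.toFinset_range, Finset.mem_filter, Finset.mem_range] at hv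
  exact Finset.mem_image.2 ⟨⟨v, hv.1⟩, by simpa using hv.2, rfl⟩

theorem exists_rare_colour {V : Type} [Fintype V] {col : V → Colour} {q : ℕ}
    (h : min (HPInstance.colourCount col .black) (HPInstance.colourCount col .white) ≤ q) :
    ∃ s t : Colour, (∀ c, c ≠ s ↔ c = t) ∧ HPInstance.colourCount col s ≤ q := by
  rcases min_le_iff.1 h with h | h
  · exact ⟨.black, .white, fun c => by cases c <;> simp, h⟩
  · exact ⟨.white, .black, fun c => by cases c <;> simp, h⟩

/-- The value at `μ` that the algorithm computes before it replaces values above `k` by `∞`. -/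
noncomputable def bestValue (μ : ℕ) : ℕ∞ :=
  costValue (bestCosts (List.range (I.b + 1)) (List.range I.n) (inputData P).allEdges
    (inputData P).masks) μ

theorem bestValue_le (hI : I.ConnectedCosts) {col : ℕ → Colour} (hcol : I.Extends fun v => col v)
    (hq : min (HPInstance.colourCount (fun v : Fin I.n => col v) .black)
      (HPInstance.colourCount (fun v : Fin I.n => col v) .white) ≤ I.q)
    {a : Fin I.m → Fin (I.b + 1)} {μ : ℕ} (hμ : μ ≤ I.b) (ha : ∑ e, (a e : ℕ) = μ)
    (hk : ∑ e, I.cost e (fun v => col v.1.1) (a e) ≤ (I.k : ℕ∞)) :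
    bestValue P μ ≤ ∑ e, I.cost e (fun v => col v.1.1) (a e) := by
  obtain ⟨s, t, hst, hs⟩ := exists_rare_colour hq
  have hcands : ∀ e ∈ (inputData P).allEdges, bichromatic (e.vertices.map col) = true →
      e.vertices.map col ∈ candidates e := by
    intro e he hb
    obtain ⟨i, hi, rfl⟩ := List.mem_iff_getElem.1 he
    obtain ⟨e, rfl, he⟩ := exists_edge_of_bichromatic P hi hb
    rw [he] at hb ⊢
    exact mem_candidates_of_cost_ne_top P (a := a e) (fun htop => (ENat.natCast_lt_top I.k).not_ge
      (hk.trans' (WithTop.sum_eq_top.2 ⟨e, Finset.mem_univ _, htop⟩).ge)) hb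
  obtain ⟨lab, hlab, hdescribes⟩ := exists_describes (s := s) List.nodup_range
    (fun _ he => vertices_subset_range P he) (card_bichromaticIndices_le P hI hk)
    ((card_filter_colour_le_colourCount col s).trans hs) hcands
  calc bestValue P μ ≤ costAt (inputData P).allEdges col μ :=
        bestCosts_le_costAt hst hμ List.nodup_range (fun _ he => vertices_subset_range P he) hlab
          (Input.length_of_mem_masks hlab) hdescribes
    _ ≤ _ := costAt_le P hcol ha

theorem cap_bestValue_le (hI : I.IsProper) (μ : Fin (I.b + 1)) :
    cap I.k (bestValue P μ) ≤ I.w μ := by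
  rcases eq_or_ne (I.w μ) ⊤ with htop | htop
  · exact htop ▸ le_top
  obtain ⟨col, ⟨hcol, a, ha, hw⟩, hq⟩ := hI.2.2 μ htop.lt_top
  obtain ⟨col, rfl⟩ : ∃ col' : ℕ → Colour, (fun v : Fin I.n => col' v) = col :=
    ⟨fun v => if h : v < I.n then col ⟨v, h⟩ else .white, by simp⟩
  rw [HPInstance.totalCost] at hw
  split at hw
  case isTrue hk =>
    have hle := bestValue_le P hI.2.1 hcol hq (Nat.lt_succ_iff.1 μ.2) ha hk
    rw [cap, if_pos (hle.trans hk), ← hw]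
    exact hle
  case isFalse => exact absurd hw.symm htop

theorem w_le_cap_bestValue (μ : Fin (I.b + 1)) : I.w μ ≤ cap I.k (bestValue P μ) := by
  rw [cap]
  split
  case isTrue hk =>
    have hne : bestValue P μ ≠ ⊤ := (hk.trans_lt (ENat.natCast_lt_top _)).ne
    obtain ⟨col, hcost⟩ := exists_costAt_eq_bestCosts (Nat.lt_succ_iff.1 μ.2) List.nodup_range
      (fun _ he => vertices_subset_range P he) (fun _ h => Input.length_of_mem_masks h) hne
    rw [bestValue, hcost] at hk hne ⊢
    have hcol := extends_of_costAt_ne_top P hne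
    obtain ⟨a, ha, hsum⟩ := exists_of_costAt_ne_top P hne
    rw [hsum] at hk ⊢
    refine (iInf₂_le (fun v => col v.1) hcol).trans ((iInf₂_le a ha).trans ?_)
    rw [HPInstance.totalCost, if_pos hk]
  case isFalse => exact le_top

theorem code_algorithm (hI : I.IsProper) : code (inputData P).algorithm = I.solution := by
  have hw : (inputData P).algorithm = List.ofFn fun μ => I.w μ := by
    refine List.ext_getElem (by simp [Input.algorithm, inputData]) fun i h₁ h₂ => ?_
    rw [List.getElem_ofFn, ← (cap_bestValue_le P hI _).antisymm (w_le_cap_bestValue P _)]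
    simp [Input.algorithm, bestValue, inputData]
  rw [hw, HPInstance.solution]
  exact congrArg Data.ofList List.map_ofFn

end presentation

/-! ## Size of the input and number of the labellings -/

theorem length_le_ncard_of_nodup {α : Type*} {l : List α} {S : Set α} (hl : l.Nodup)
    (hS : S.Finite) (h : ∀ a ∈ l, a ∈ S) : l.length ≤ S.ncard := by
  classical
  rw [← List.toFinset_card_of_nodup hl, ← Set.ncard_coe_finset]
  exact Set.ncard_le_ncard (fun a ha => h a (by simpa using ha)) hS

theorem succ_pow_le_factorial_mul (L j : ℕ) : (L + 1) ^ j ≤ j.factorial * 2 ^ (L + j) := by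
  refine (Nat.pow_succ_le_ascFactorial (L + 1) j).trans ?_
  rw [Nat.ascFactorial_eq_factorial_mul_choose]
  exact Nat.mul_le_mul_left _ (Nat.choose_le_two_pow _ _)

theorem exists_eval_le_mul_pow (Q : Polynomial ℕ) : ∃ C, ∀ x, 0 < x → Q.eval x ≤ C * x ^ C := by
  refine ⟨Q.natDegree + ∑ i ∈ Finset.range (Q.natDegree + 1), Q.coeff i, fun x hx => ?_⟩
  rw [Polynomial.eval_eq_sum_range]
  calc ∑ i ∈ Finset.range (Q.natDegree + 1), Q.coeff i * x ^ i
      ≤ ∑ i ∈ Finset.range (Q.natDegree + 1), Q.coeff i * x ^ Q.natDegree := by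
        gcongr with i hi
        exact Nat.lt_succ_iff.1 (Finset.mem_range.1 hi)
    _ = (∑ i ∈ Finset.range (Q.natDegree + 1), Q.coeff i) * x ^ Q.natDegree :=
        (Finset.sum_mul ..).symm
    _ ≤ _ := Nat.mul_le_mul (Nat.le_add_left _ _)
        (Nat.pow_le_pow_right hx (Nat.le_add_right _ _))

theorem ncard_colourCount_le (F : Type) [Fintype F] (x : Colour) (s : ℕ) :
    {c : F → Colour | HPInstance.colourCount c x ≤ s}.ncard ≤ (Fintype.card F + 1) ^ s := by
  classical
  obtain ⟨y, hy⟩ : ∃ y : Colour, ∀ c, c ≠ x ↔ c = y := by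
    cases x
    · exact ⟨.white, fun c => by cases c <;> simp⟩
    · exact ⟨.black, fun c => by cases c <;> simp⟩
  let colouring (g : Fin s → Option F) (v : F) : Colour := if ∃ i, g i = some v then x else y
  have hsurj : {c : F → Colour | HPInstance.colourCount c x ≤ s} ⊆ colouring '' Set.univ := by
    intro c hc
    set l := (Finset.univ.filter fun v => c v = x).toList
    have hlength : l.length ≤ s := (Finset.length_toList _).trans_le hc
    refine ⟨fun i => l[i.1]?, Set.mem_univ _, funext fun v => ?_⟩
    have hmem : (∃ i : Fin s, l[i.1]? = some v) ↔ c v = x := by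
      rw [← (by simp [l] : v ∈ l ↔ c v = x), List.mem_iff_getElem?]
      exact ⟨fun ⟨i, hi⟩ => ⟨i, hi⟩, fun ⟨i, hi⟩ =>
        ⟨⟨i, (List.getElem?_eq_some_iff.1 hi).1.trans_le hlength⟩, hi⟩⟩
    simp only [colouring, hmem]
    split_ifs with hv
    · exact hv.symm
    · exact ((hy _).1 hv).symm
  calc _ ≤ (colouring '' Set.univ).ncard := Set.ncard_le_ncard hsurj
    _ ≤ (Set.univ : Set (Fin s → Option F)).ncard := Set.ncard_image_le
    _ = _ := by simp [Set.ncard_univ]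

section mainTerm
variable (I : HPInstance)

/-- The claimed running time, without the constants: the running time will be bounded by a
polynomial in this number. -/
def mainTerm : ℕ := I.q ^ I.k * I.d ^ I.k ^ 2 * (I.n + I.m + I.b)

theorem size_le_mainTerm : I.n + I.m + I.b ≤ mainTerm I :=
  Nat.le_mul_of_pos_left _ (Nat.mul_pos (Nat.pow_pos I.q_pos) (Nat.pow_pos I.d_pos))

theorem mainTerm_pos : 0 < mainTerm I :=
  (Nat.add_pos_right _ I.b_pos).trans_le (size_le_mainTerm I)

theorem q_pow_mul_d_pow_le_mainTerm : I.q ^ I.k * I.d ^ I.k ^ 2 ≤ mainTerm I :=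
  Nat.le_mul_of_pos_right _ (Nat.add_pos_right _ I.b_pos)

theorem d_pow_le_mainTerm : I.d ^ I.k ^ 2 ≤ mainTerm I :=
  (Nat.le_mul_of_pos_left _ (Nat.pow_pos I.q_pos)).trans (q_pow_mul_d_pow_le_mainTerm I)

theorem q_pow_le_mainTerm : I.q ^ I.k ≤ mainTerm I :=
  (Nat.le_mul_of_pos_right _ (Nat.pow_pos I.d_pos)).trans (q_pow_mul_d_pow_le_mainTerm I)

theorem q_le_mainTerm : I.q ≤ mainTerm I :=
  (Nat.le_self_pow I.k_pos.ne' _).trans (q_pow_le_mainTerm I)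

variable {I}

theorem two_pow_sq_le_mainTerm (hd : 2 ≤ I.d) : 2 ^ I.k ^ 2 ≤ mainTerm I :=
  (Nat.pow_le_pow_left hd _).trans (d_pow_le_mainTerm I)

theorem two_pow_le_mainTerm (hd : 2 ≤ I.d) : 2 ^ I.k ≤ mainTerm I :=
  (Nat.pow_le_pow_right two_pos (Nat.le_self_pow two_ne_zero _)).trans (two_pow_sq_le_mainTerm hd)

theorem k_le_mainTerm (hd : 2 ≤ I.d) : I.k ≤ mainTerm I :=
  Nat.lt_two_pow_self.le.trans (two_pow_le_mainTerm hd)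

theorem k_pow_le_mainTerm (hd : 2 ≤ I.d) : I.k ^ I.k ≤ mainTerm I :=
  calc I.k ^ I.k ≤ (2 ^ I.k) ^ I.k := Nat.pow_le_pow_left Nat.lt_two_pow_self.le _
    _ = 2 ^ I.k ^ 2 := by rw [← pow_mul, sq]
    _ ≤ mainTerm I := two_pow_sq_le_mainTerm hd

end mainTerm

section finiteColourings
variable {I : HPInstance}

/-- The colourings of a hyperedge at which its function takes some finite value. -/
def finiteColourings (I : HPInstance) (e : Fin I.m) : Set ({v // v ∈ I.edge e} → Colour) :=
  {c | ∃ μ, I.cost e c μ ≠ ⊤}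

/-- A bound for the number of colourings of a hyperedge with finite cost. -/
def colouringBound (I : HPInstance) : ℕ := 2 * I.d ^ (6 * I.k)

theorem colouringBound_le (I : HPInstance) : colouringBound I ≤ 2 * mainTerm I ^ 6 := by
  have hk : I.k ≤ I.k ^ 2 := Nat.le_self_pow two_ne_zero _
  calc 2 * I.d ^ (6 * I.k) ≤ 2 * I.d ^ (I.k ^ 2 * 6) :=
        Nat.mul_le_mul_left _ (Nat.pow_le_pow_right I.d_pos (by lia))
    _ = 2 * (I.d ^ I.k ^ 2) ^ 6 := by rw [pow_mul]
    _ ≤ 2 * mainTerm I ^ 6 := by gcongr; exact d_pow_le_mainTerm I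

theorem ncard_finiteColourings_le (hI : I.LocallyUnbreakable) (e : Fin I.m) :
    (finiteColourings I e).ncard ≤ colouringBound I := by
  have hF : Fintype.card {v // v ∈ I.edge e} ≤ I.d := by simpa using I.edge_card_le e
  by_cases hd : 2 ≤ I.d
  · have hfew (x : Colour) : {c : {v // v ∈ I.edge e} → Colour |
        HPInstance.colourCount c x ≤ 3 * I.k}.ncard ≤ I.d ^ (6 * I.k) :=
      calc _ ≤ (Fintype.card {v // v ∈ I.edge e} + 1) ^ (3 * I.k) := ncard_colourCount_le ..
        _ ≤ (I.d ^ 2) ^ (3 * I.k) := Nat.pow_le_pow_left (by nlinarith) _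
        _ = I.d ^ (6 * I.k) := by rw [← pow_mul]; ring_nf
    have hsub : finiteColourings I e ⊆ {c | HPInstance.colourCount c .black ≤ 3 * I.k} ∪
        {c | HPInstance.colourCount c .white ≤ 3 * I.k} := by
      rintro c ⟨μ, hμ⟩
      by_contra! h
      simp only [Set.mem_union, Set.mem_ofPred_eq, not_or, not_le] at h
      exact hμ (hI e c h.1 h.2 μ)
    calc _ ≤ _ := Set.ncard_le_ncard hsub
      _ ≤ _ := Set.ncard_union_le _ _
      _ ≤ I.d ^ (6 * I.k) + I.d ^ (6 * I.k) := Nat.add_le_add (hfew _) (hfew _)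
      _ = colouringBound I := (two_mul _).symm
  · calc _ ≤ Nat.card ({v // v ∈ I.edge e} → Colour) := Set.ncard_le_card _
      _ = 2 ^ Fintype.card {v // v ∈ I.edge e} := by
        rw [Nat.card_eq_fintype_card, Fintype.card_fun]; rfl
      _ ≤ 2 ^ 1 := Nat.pow_le_pow_right two_pos (by lia)
      _ ≤ colouringBound I := Nat.le_mul_of_pos_right _ (Nat.pow_pos I.d_pos)

theorem card_edge_le (e : Fin I.m) : (I.edge e).card ≤ I.n := by
  simpa using Finset.card_le_univ (I.edge e)

end finiteColourings

section codeSize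
variable {I : HPInstance} (P : I.Presentation)

theorem mem_finiteColourings_of_mem_table {e : Fin I.m}
    {r : ({v // v ∈ I.edge e} → Colour) × Fin (I.b + 1) × ℕ} (hr : r ∈ P.table e) :
    r.1 ∈ finiteColourings I e :=
  ⟨r.2.1, by simp [(P.mem_table e r.1 r.2.1 r.2.2).1 hr]⟩

theorem length_table_le (hI : I.LocallyUnbreakable) (e : Fin I.m) :
    (P.table e).length ≤ colouringBound I * (I.b + 1) := by
  have hnodup : ((P.table e).map fun r => (r.1, r.2.1)).Nodup := by
    refine (P.table_nodup e).map_on ?_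
    rintro ⟨c, μ, a⟩ hr ⟨c', μ', a'⟩ hr' h
    obtain ⟨rfl, rfl⟩ := Prod.mk.inj h
    have haa' := ((P.mem_table ..).1 hr).symm.trans ((P.mem_table ..).1 hr')
    rw [Nat.cast_inj.1 haa']
  have hmem : ∀ x ∈ (P.table e).map fun r => (r.1, r.2.1),
      x ∈ finiteColourings I e ×ˢ (Set.univ : Set (Fin (I.b + 1))) := by
    intro x hx
    obtain ⟨r, hr, rfl⟩ := List.mem_map.1 hx
    exact ⟨mem_finiteColourings_of_mem_table P hr, Set.mem_univ _⟩
  have hlength := length_le_ncard_of_nodup hnodup (Set.toFinite _) hmem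
  rw [List.length_map, Set.ncard_prod, Set.ncard_univ, Nat.card_fin] at hlength
  exact hlength.trans (Nat.mul_le_mul_right _ (ncard_finiteColourings_le hI e))

theorem codeSize_edgeData_le (hI : I.LocallyUnbreakable) (e : Fin I.m) :
    codeSize (edgeData P e) ≤ colouringBound I * (I.b + 1) * (2 * I.n + 8) + 2 * I.n + 5 := by
  have hn := card_edge_le e
  have hvertices : codeSize (edgeData P e).vertices ≤ 2 * I.n + 1 := by
    refine (codeSize_list_le (c := 1) fun a _ => (codeSize_nat a).le).trans ?_
    rw [edgeData, List.length_ofFn]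
    lia
  have hrow : ∀ r ∈ (edgeData P e).table, codeSize r ≤ 2 * I.n + 7 := by
    intro r hr
    obtain ⟨r, -, rfl⟩ := List.mem_map.1 hr
    have hcolours := codeSize_list_le (l := List.ofFn fun i => r.1 (P.order e i)) (c := 1)
      fun a _ => (codeSize_colour a).le
    rw [List.length_ofFn] at hcolours
    change codeSize (List.ofFn fun i => r.1 (P.order e i), (r.2.1 : ℕ), r.2.2, 0) ≤ _
    simp only [codeSize_prod, codeSize_nat]
    lia
  have htable : codeSize (edgeData P e).table ≤
      colouringBound I * (I.b + 1) * (2 * I.n + 8) + 1 := by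
    refine (codeSize_list_le hrow).trans ?_
    rw [edgeData, List.length_map]
    gcongr
    exact length_table_le P hI e
  change codeSize ((edgeData P e).vertices, (edgeData P e).table, 0) ≤ _
  simp only [codeSize_prod, codeSize_nat]
  lia

theorem codeSize_inputData_le (hI : I.LocallyUnbreakable) : codeSize (inputData P) ≤
    I.m * (colouringBound I * (I.b + 1) * (2 * I.n + 8) + 2 * I.n + 6) + 2 * I.n + 17 := by
  have hcol₀ := codeSize_list_le (l := List.ofFn I.col₀) (c := 1)
    fun a _ => (codeSize_optionColour a).le
  have hedges := codeSize_list_le (l := List.ofFn (edgeData P)) fun e he => by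
    obtain ⟨e, rfl⟩ := (List.mem_ofFn' _ _).1 he
    exact codeSize_edgeData_le P hI e
  rw [List.length_ofFn] at hcol₀ hedges
  change codeSize (I.k, I.b, I.d, I.q, I.n, I.m, List.ofFn I.col₀, List.ofFn (edgeData P), 0) ≤ _
  simp only [codeSize_prod, codeSize_nat]
  lia

end codeSize

section candidates
variable {I : HPInstance} (P : I.Presentation)

theorem length_precolourEdges_le (col₀ : List (Option Colour)) :
    (precolourEdges col₀).length ≤ col₀.length := by
  rw [precolourEdges, List.length_flatMap]
  refine (List.sum_le_card_nsmul _ 1 ?_).trans (by simp)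
  simp only [List.forall_mem_map, List.length_map]
  rintro ⟨_ | _, _⟩ - <;> simp

theorem length_allEdges_le : (inputData P).allEdges.length ≤ I.m + I.n := by
  rw [allEdges_inputData, List.length_append, List.length_ofFn]
  exact Nat.add_le_add_left ((length_precolourEdges_le _).trans_eq List.length_ofFn) _

theorem exists_of_mem_candidates_edgeData {e : Fin I.m} {c : List Colour}
    (hc : c ∈ candidates (edgeData P e)) :
    ∃ f ∈ finiteColourings I e, (List.ofFn fun i => f (P.order e i)) = c := by
  obtain ⟨-, r, hr, rfl⟩ := mem_candidates.1 hc
  obtain ⟨s, hs, rfl⟩ := List.mem_map.1 hr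
  exact ⟨s.1, mem_finiteColourings_of_mem_table P hs, rfl⟩

theorem exists_eq_edgeData_of_mem_candidates {e : EdgeData} (he : e ∈ (inputData P).allEdges)
    {c : List Colour} (hc : c ∈ candidates e) : ∃ e', e = edgeData P e' := by
  rcases List.mem_append.1 he with he | he
  · obtain ⟨e', rfl⟩ := (List.mem_ofFn' _ _).1 he
    exact ⟨e', rfl⟩
  · obtain ⟨v, c, -, rfl⟩ := mem_precolourEdges.1 he
    obtain ⟨hb, r, hr, rfl⟩ := mem_candidates.1 hc
    rw [List.mem_singleton.1 hr] at hb
    cases c <;> simp [bichromatic] at hb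

theorem length_candidates_le (hI : I.LocallyUnbreakable) {e : EdgeData}
    (he : e ∈ (inputData P).allEdges) : (candidates e).length ≤ colouringBound I := by
  rcases (candidates e).eq_nil_or_concat with h | ⟨l, c, h⟩
  · simp [h]
  · obtain ⟨e', rfl⟩ := exists_eq_edgeData_of_mem_candidates P he (c := c) (by simp [h])
    calc _ ≤ ((fun f => List.ofFn fun i => f (P.order e' i)) '' finiteColourings I e').ncard :=
          length_le_ncard_of_nodup (nodup_candidates _) (Set.toFinite _)
            fun _ hc => exists_of_mem_candidates_edgeData P hc
      _ ≤ (finiteColourings I e').ncard := Set.ncard_image_le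
      _ ≤ colouringBound I := ncard_finiteColourings_le hI e'

theorem length_le_of_mem_candidates {e : EdgeData} (he : e ∈ (inputData P).allEdges)
    {c : List Colour} (hc : c ∈ candidates e) : c.length ≤ I.n := by
  obtain ⟨e', rfl⟩ := exists_eq_edgeData_of_mem_candidates P he hc
  obtain ⟨f, -, rfl⟩ := exists_of_mem_candidates_edgeData P hc
  exact List.length_ofFn.trans_le (card_edge_le e')

theorem length_longest_cands_le (hI : I.LocallyUnbreakable) :
    (longest (inputData P).cands).length ≤ colouringBound I := by
  rcases longest_eq_nil_or_mem (inputData P).cands with h | h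
  · simp [h]
  · obtain ⟨e, he, heq⟩ := List.mem_map.1 h
    exact heq ▸ length_candidates_le P hI he

theorem two_le_length_of_bichromatic {c : List Colour} (hc : bichromatic c = true) :
    2 ≤ c.length := by
  rcases c with _ | ⟨a, _ | ⟨b, c⟩⟩
  · simp [bichromatic] at hc
  · cases a <;> simp [bichromatic] at hc
  · simp

theorem two_le_d (h : longest (inputData P).cands ≠ []) : 2 ≤ I.d := by
  obtain ⟨e, he, heq⟩ := List.mem_map.1 ((longest_eq_nil_or_mem _).resolve_left h)
  obtain ⟨c, hc⟩ := List.exists_mem_of_ne_nil _ (heq ▸ h)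
  obtain ⟨e', rfl⟩ := exists_eq_edgeData_of_mem_candidates P he hc
  obtain ⟨f, -, hf⟩ := exists_of_mem_candidates_edgeData P hc
  calc 2 ≤ c.length := two_le_length_of_bichromatic (mem_candidates.1 hc).1
    _ = (I.edge e').card := by rw [← hf, List.length_ofFn]
    _ ≤ I.d := I.edge_card_le e'

theorem depth_le_mainTerm : (inputData P).depth ≤ mainTerm I := by
  rw [Input.depth]
  split
  case isTrue => exact Nat.zero_le _
  case isFalse h => exact k_le_mainTerm (two_le_d P h)

end candidates

section masks

theorem length_iterate_extendMasks (O ms : List Labelling) (N : ℕ) :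
    ((extendMasks O)^[N] ms).length = (1 + O.length) ^ N * ms.length := by
  induction N with
  | zero => simp
  | succ N ih =>
    rw [Function.iterate_succ_apply', extendMasks]
    simp only [List.length_append, List.length_flatMap, List.length_map, List.map_const',
      List.sum_replicate, smul_eq_mul, ih]
    ring

theorem length_residueMasks (l : List (List (List Colour))) (U : List ℕ) :
    (residueMasks l U).length = U.length * (U.length * (longest l).length) := by
  simp [residueMasks, List.length_flatMap]

theorem mem_or_mem_of_mem_overlay {a b : Labelling} {c : List Colour} (h : c ∈ overlay a b) :
    c ∈ a ∨ c ∈ b := by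
  obtain ⟨x, hx, rfl⟩ := List.mem_map.1 h
  have hmem := List.of_mem_zip (a := x.1) (b := x.2) hx
  split
  exacts [.inr hmem.2, .inl hmem.1]

theorem forall_mem_of_mem_iterate_extendMasks {p : List Colour → Prop} {O ms : List Labelling}
    (hO : ∀ o ∈ O, ∀ c ∈ o, p c) (hms : ∀ a ∈ ms, ∀ c ∈ a, p c) (N : ℕ) :
    ∀ lab ∈ (extendMasks O)^[N] ms, ∀ c ∈ lab, p c := by
  induction N with
  | zero => exact hms
  | succ N ih =>
    intro lab hlab c hc
    rw [Function.iterate_succ_apply'] at hlab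
    rcases List.mem_append.1 hlab with hlab | hlab
    · exact ih lab hlab c hc
    · obtain ⟨o, ho, hlab⟩ := List.mem_flatMap.1 hlab
      obtain ⟨a, ha, rfl⟩ := List.mem_map.1 hlab
      exact (mem_or_mem_of_mem_overlay hc).elim (hO o ho c) (ih a ha c)

theorem exists_mem_of_mem_residueMask {l : List (List (List Colour))} {p r j : ℕ}
    {c : List Colour} (hc : c ∈ residueMask l p r j) (hne : c ≠ []) : ∃ l' ∈ l, c ∈ l' := by
  obtain ⟨⟨l', i⟩, hl', rfl⟩ := List.mem_map.1 hc
  rw [ite_ne_right_iff] at hne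
  rw [if_pos hne.1]
  refine ⟨l', List.fst_mem_of_mem_zipIdx hl', ?_⟩
  by_cases hj : j < l'.length
  · rw [List.getD_eq_getElem _ _ hj]
    exact List.getElem_mem hj
  · exact absurd (List.getD_eq_default _ _ (not_lt.1 hj)) hne.2

theorem exists_mem_candidates_of_mem_masks {x : Input} {lab : Labelling} (hlab : lab ∈ x.masks)
    {c : List Colour} (hc : c ∈ lab) (hne : c ≠ []) : ∃ e ∈ x.allEdges, c ∈ candidates e := by
  refine forall_mem_of_mem_iterate_extendMasks (p := fun c => c ≠ [] → ∃ e ∈ x.allEdges,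
    c ∈ candidates e) (fun o ho c hc hne => ?_) (fun o ho c hc hne => ?_) _ lab hlab c hc hne
  · obtain ⟨p, -, r, -, j, -, rfl⟩ := mem_residueMasks.1 ho
    obtain ⟨l, hl, hcl⟩ := exists_mem_of_mem_residueMask hc hne
    obtain ⟨e, he, rfl⟩ := List.mem_map.1 hl
    exact ⟨e, he, hcl⟩
  · rw [List.mem_singleton.1 ho] at hc
    obtain ⟨l, -, rfl⟩ := List.mem_map.1 hc
    exact absurd rfl hne

variable {I : HPInstance} (P : I.Presentation)

theorem codeSize_masks_le : codeSize (inputData P).masks ≤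
    (1 + (inputData P).basicMasks.length) ^ (inputData P).depth *
      ((I.m + I.n) * (2 * I.n + 2) + 2) + 1 := by
  have hlabel : ∀ lab ∈ (inputData P).masks, ∀ c ∈ lab, codeSize c ≤ 2 * I.n + 1 := by
    intro lab hlab c hc
    rcases eq_or_ne c [] with rfl | hne
    · rw [codeSize_nil]
      lia
    · obtain ⟨e, he, hce⟩ := exists_mem_candidates_of_mem_masks hlab hc hne
      have hsize := codeSize_list_le (l := c) (c := 1) fun a _ => (codeSize_colour a).le
      have hlength := length_le_of_mem_candidates P he hce
      lia
  have hlabelling : ∀ lab ∈ (inputData P).masks,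
      codeSize lab ≤ (I.m + I.n) * (2 * I.n + 2) + 1 := fun lab hlab =>
    (codeSize_list_le (hlabel lab hlab)).trans <| Nat.add_le_add_right (Nat.mul_le_mul_right _ <|
      (Input.length_of_mem_masks hlab).trans_le (length_allEdges_le P)) 1
  refine (codeSize_list_le hlabelling).trans_eq ?_
  rw [Input.masks, length_iterate_extendMasks, List.length_singleton, mul_one]

/-- The number of bits that suffice to index the hyperedges. -/
abbrev indexBits : ℕ := (logList (inputData P).cands).length

theorem two_pow_indexBits_le : 2 ^ indexBits P ≤ 2 * mainTerm I + 1 := by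
  have hlog := (two_pow_length_logList (inputData P).cands).2
  have hlength := length_allEdges_le P
  have hsize := size_le_mainTerm I
  rw [Input.length_cands] at hlog
  lia

/-- The factor `(log m) ^ O(k)` of the number of labellings is absorbed, since
`(L + 1) ^ j ≤ j! * 2 ^ (L + j)`. -/
theorem indexBits_pow_le (hd : 2 ≤ I.d) :
    (indexBits P + 1) ^ (2 * I.k) ≤ mainTerm I ^ 6 * (2 * mainTerm I + 1) := by
  have hfactorial : (2 * I.k).factorial ≤ (2 ^ I.k) ^ 2 * (I.k ^ I.k) ^ 2 := by
    refine (Nat.factorial_le_pow _).trans_eq ?_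
    rw [mul_pow, ← pow_mul, ← pow_mul, mul_comm 2 I.k]
  calc (indexBits P + 1) ^ (2 * I.k)
      ≤ (2 * I.k).factorial * 2 ^ (indexBits P + 2 * I.k) := succ_pow_le_factorial_mul _ _
    _ ≤ (2 ^ I.k) ^ 2 * (I.k ^ I.k) ^ 2 * (2 ^ indexBits P * (2 ^ I.k) ^ 2) := by
        rw [pow_add, mul_comm 2 I.k, pow_mul]
        gcongr
        rwa [mul_comm 2 I.k] at hfactorial
    _ ≤ mainTerm I ^ 2 * mainTerm I ^ 2 * ((2 * mainTerm I + 1) * mainTerm I ^ 2) := by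
        gcongr
        exacts [two_pow_le_mainTerm hd, k_pow_le_mainTerm hd, two_pow_indexBits_le P,
          two_pow_le_mainTerm hd]
    _ = mainTerm I ^ 6 * (2 * mainTerm I + 1) := by ring

theorem length_modulusList_range_le {k q : ℕ} (hk : 0 < k) (hq : 0 < q)
    (l : List (List (List Colour))) : (modulusList (List.range k) (List.range q) l).length ≤
      9 * k * q * ((logList l).length + 1) := by
  rw [length_modulusList, List.length_range, List.length_range]
  have hkq : 1 ≤ k * q := Nat.mul_pos hk hq
  have hadd : k + q + 1 ≤ 3 * (k * q) := by nlinarith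
  calc 2 * ((k + q + 1) * ((logList l).length + 1)) + 1
      ≤ 2 * (3 * (k * q) * ((logList l).length + 1)) + k * q * ((logList l).length + 1) := by
        gcongr
        exact Nat.mul_pos hkq (Nat.succ_pos _)
    _ = 7 * k * q * ((logList l).length + 1) := by ring
    _ ≤ _ := by gcongr; lia

theorem one_add_length_basicMasks_le (hI : I.LocallyUnbreakable)
    (h : longest (inputData P).cands ≠ []) :
    1 + (inputData P).basicMasks.length ≤
      2 ^ 9 * (I.k ^ 2 * (I.q ^ 2 * ((indexBits P + 1) ^ 2 * I.d ^ (6 * I.k)))) := by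
  have hdepth : (inputData P).depth = I.k := if_neg h
  have hU := length_modulusList_range_le I.k_pos I.q_pos (inputData P).cands
  have hpos : 1 ≤ I.k ^ 2 * (I.q ^ 2 * ((indexBits P + 1) ^ 2 * I.d ^ (6 * I.k))) := by
    have := I.k_pos
    have := I.q_pos
    have := I.d_pos
    exact Nat.succ_le_of_lt (by positivity)
  have hlength : (inputData P).basicMasks.length ≤
      162 * (I.k ^ 2 * (I.q ^ 2 * ((indexBits P + 1) ^ 2 * I.d ^ (6 * I.k)))) := by
    rw [Input.basicMasks, hdepth, length_residueMasks]
    exact (Nat.mul_le_mul hU (Nat.mul_le_mul hU (length_longest_cands_le P hI))).trans_eq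
      (by unfold colouringBound; ring)
  lia

theorem one_add_length_basicMasks_pow_le (hI : I.LocallyUnbreakable) :
    (1 + (inputData P).basicMasks.length) ^ (inputData P).depth ≤
      mainTerm I ^ 25 * (2 * mainTerm I + 1) := by
  have hX := mainTerm_pos I
  by_cases h : longest (inputData P).cands = []
  · rw [Input.depth, if_pos h, pow_zero]
    exact Nat.mul_pos (Nat.pow_pos hX) (Nat.succ_pos _)
  have hd := two_le_d P h
  rw [show (inputData P).depth = I.k from if_neg h]
  calc (1 + (inputData P).basicMasks.length) ^ I.k
      ≤ (2 ^ 9 * (I.k ^ 2 * (I.q ^ 2 * ((indexBits P + 1) ^ 2 * I.d ^ (6 * I.k))))) ^ I.k :=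
        Nat.pow_le_pow_left (one_add_length_basicMasks_le P hI h) _
    _ = (2 ^ I.k) ^ 9 * ((I.k ^ I.k) ^ 2 * ((I.q ^ I.k) ^ 2 *
        ((indexBits P + 1) ^ (2 * I.k) * (I.d ^ I.k ^ 2) ^ 6))) := by
        simp only [mul_pow, ← pow_mul]
        ring_nf
    _ ≤ mainTerm I ^ 9 * (mainTerm I ^ 2 * (mainTerm I ^ 2 *
        (mainTerm I ^ 6 * (2 * mainTerm I + 1) * mainTerm I ^ 6))) := by
        gcongr
        exacts [two_pow_le_mainTerm hd, k_pow_le_mainTerm hd, q_pow_le_mainTerm I,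
          indexBits_pow_le P hd, d_pow_le_mainTerm I]
    _ = mainTerm I ^ 25 * (2 * mainTerm I + 1) := by ring

theorem codeSize_inputData_le_mainTerm (hI : I.LocallyUnbreakable) :
    codeSize (inputData P) ≤ 67 * mainTerm I ^ 9 := by
  have hX := mainTerm_pos I
  have hsize := size_le_mainTerm I
  have hT := colouringBound_le I
  set X := mainTerm I
  calc codeSize (inputData P)
      ≤ I.m * (colouringBound I * (I.b + 1) * (2 * I.n + 8) + 2 * I.n + 6) + 2 * I.n + 17 :=
        codeSize_inputData_le P hI
    _ ≤ X * (2 * X ^ 6 * (2 * X) * (10 * X) + 2 * X + 6 * X) + 2 * X + 17 * X := by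
        gcongr <;> lia
    _ = 40 * X ^ 9 + 8 * X ^ 2 + 19 * X ^ 1 := by ring
    _ ≤ 40 * X ^ 9 + 8 * X ^ 9 + 19 * X ^ 9 := by gcongr <;> lia
    _ = 67 * X ^ 9 := by ring

theorem codeSize_masks_le_mainTerm (hI : I.LocallyUnbreakable) :
    codeSize (inputData P).masks ≤ 19 * mainTerm I ^ 28 := by
  have hX := mainTerm_pos I
  have hsize := size_le_mainTerm I
  have hcount := one_add_length_basicMasks_pow_le P hI
  set X := mainTerm I
  calc codeSize (inputData P).masks
      ≤ (1 + (inputData P).basicMasks.length) ^ (inputData P).depth *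
          ((I.m + I.n) * (2 * I.n + 2) + 2) + 1 := codeSize_masks_le P
    _ ≤ X ^ 25 * (2 * X + X) * (X * (2 * X + 2 * X) + 2 * X ^ 2) + X ^ 28 := by
        have hlength : I.m + I.n ≤ X := by lia
        have hwidth : 2 * I.n + 2 ≤ 2 * X + 2 * X := by lia
        have hsq : 1 ≤ X ^ 2 := Nat.pow_pos hX
        refine Nat.add_le_add (Nat.mul_le_mul (hcount.trans (by gcongr; lia)) ?_) (Nat.pow_pos hX)
        exact Nat.add_le_add (Nat.mul_le_mul hlength hwidth) (by lia)
    _ = 19 * X ^ 28 := by ring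

theorem runningTime_inputData_le (hI : I.LocallyUnbreakable) :
    (inputData P).runningTime ≤ 90 * mainTerm I ^ 28 := by
  have hX := mainTerm_pos I
  have hsize := size_le_mainTerm I
  have hone : mainTerm I ≤ mainTerm I ^ 28 := Nat.le_self_pow (by norm_num) _
  have hnine : mainTerm I ^ 9 ≤ mainTerm I ^ 28 := Nat.pow_le_pow_right hX (by norm_num)
  have hinput := codeSize_inputData_le_mainTerm P hI
  have hmasks := codeSize_masks_le_mainTerm P hI
  have hdepth := depth_le_mainTerm P
  have hq : (inputData P).q ≤ mainTerm I := q_le_mainTerm I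
  have hb : (inputData P).b ≤ mainTerm I := (Nat.le_add_left _ _).trans hsize
  rw [Input.runningTime]
  lia

end masks

end Painting

open Painting in
theorem lemma4p3 :
    ∃ (p : Program) (C : ℕ), ∀ I : HPInstance, I.IsProper → ∀ P : I.Presentation,
      ∃ t : ℕ, p.Runs (I.input P) I.solution t ∧
        t ≤ C * I.q ^ (C * I.k) * I.d ^ (C * I.k ^ 2) * (I.n + I.m + I.b) ^ C := by
  obtain ⟨p, Q, hp⟩ := Input.polyTimeIn_algorithm
  obtain ⟨C, hC⟩ := exists_eval_le_mul_pow (Q.comp (90 * .X ^ 28))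
  refine ⟨p, C, fun I hI P => ?_⟩
  obtain ⟨t, hruns, ht, -⟩ := hp (inputData P)
  rw [code_inputData, code_algorithm P hI] at hruns
  refine ⟨t, hruns, ?_⟩
  calc t ≤ Q.eval (inputData P).runningTime := ht
    _ ≤ Q.eval (90 * mainTerm I ^ 28) := eval_nat_mono Q (runningTime_inputData_le P hI.1)
    _ = (Q.comp (90 * .X ^ 28)).eval (mainTerm I) := by simp
    _ ≤ C * mainTerm I ^ C := hC _ (mainTerm_pos I)
    _ = _ := by
      simp only [mainTerm, mul_pow, ← pow_mul]
      ring_nf
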